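/- Let $\mathcal X,\mathcal S$ be standard Borel spaces (for instance Borel subsets of $\mathbb R^{d_x}$, $\mathbb R^{d_s}$). A unit is $(X,T,S(0),S(1),Y(0),Y(1),R)$ with law $\mathbb P$, where $X\in\mathcal X$ are covariates, $T\in\{0,1\}$ is the treatment, $S(t)\in\mathcal S$ and $Y(t)\in\mathbb R$ are the potential surrogates and outcomes, and $R\in\{0,1\}$ indicates that the outcome is observed. Put $S=S(T)$ and $Y=Y(T)$. The observed data point $W$ consists of $(X,T,S,R)$, together with $Y$ if $R=1$. The target is $\delta^*=\mathbb E[Y(1)]-\mathbb E[Y(0)]$. For $\epsilon\in(0,1/2)$ let $\mathcal M_\epsilon$ be the set of all laws with $\mathbb E[Y(t)^2]<\infty$ ($t=0,1$) such that, for $t=0,1$, $$(Y(t),S(t))\perp T\mid X,\qquad R\perp Y(t)\mid (X,T=t,S(t)),$$ and almost surely $\epsilon\le e(X)\le 1-\epsilon$ and $\epsilon\le r(t,X,S(t))\le 1$ for $t=0,1$, where $e(x)=P(T=1\mid X=x)$ and $r(t,x,s)=P(R=1\mid T=t,X=x,S=s)$ under the law in question. Let $\mathbb P\in\mathcal M_\epsilon$,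 with propensity scores $e^*,r^*$, and let $$\tilde\mu^*(t,x,s)=\mathbb E[Y\mid T=t,R=1,X=x,S=s],\qquad \mu^*(t,x)=\mathbb E[Y\mid T=t,X=x].$$ Let $\mathcal M$ be any one of the following four models: $\mathcal M_\epsilon$ (both propensity scores unknown), or the set of those laws in $\mathcal M_\epsilon$ whose treatment propensity score is $e^*$, or whose labelling propensity score is $r^*$, or both. Consider the regular one-dimensional parametric submodels $\gamma\mapsto P_\gamma\in\mathcal M$, $\gamma\in\mathbb R$, with $P_0=\mathbb P$: the laws of $W$ under $P_\gamma$ have densities with respect to a common $\sigma$-finite measure, are differentiable in quadratic mean at $\gamma=0$ with a score $g\in L^2$, and the second moments of $Y(0),Y(1)$ are bounded for $\gamma$ near $0$. Let \begin{align*} \psi(W)&=\mu^*(1,X)-\mu^*(0,X)+\frac{TR}{e^*(X)r^*(1,X,S)}\bigl(Y-\tilde\mu^*(1,X,S)\bigr)-\frac{(1-T)R}{(1-e^*(X))r^*(0,X,S)}\bigl(Y-\tilde\mu^*(0,X,S)\bigr)\\ &\quad+\frac{T}{e^*(X)}\bigl(\tilde\mu^*(1,X,S)-\mu^*(1,X)\bigr)-\frac{1-T}{1-e^*(X)}\bigl(\tilde\mu^*(0,X,S)-\mu^*(0,X)\bigr)-\delta^*.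 \end{align*} Then $\psi$ is the efficient influence function of $\delta^*$ at $\mathbb P$ in $\mathcal M$: it is square-integrable, along every such submodel $\frac{d}{d\gamma}\delta(P_\gamma)\big|_{\gamma=0}=\mathbb E[\psi(W)g(W)]$, where $\delta(P)$ denotes the average treatment effect under $P$, and $\psi$ lies in the tangent space, i.e. the closed linear span in $L^2$ of the scores of these submodels. Consequently the semiparametric efficiency lower bound for $\delta^*$ is $$V^*=\mathbb E[\psi(W)^2],$$ which is also the supremum, over these submodels, of the Cramér–Rao bounds $\bigl(\frac{d}{d\gamma}\delta(P_\gamma)|_{\gamma=0}\bigr)^2/\mathbb E[g(W)^2]$ (read as $0$ when $g=0$ almost surely). The bound $V^*$ is the same for all four models, that is, whether or not $e^*$ and $r^*$ are known. -/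

import Mathlib

open MeasureTheory ProbabilityTheory Filter
open scoped Topology ENNReal

namespace SurrogateATE

/-! ### Full data and observed data -/

/-- One unit of the population: `(X, T, (S(t))ₜ, (Y(t))ₜ, R)`, with `t = true` for treatment and
`t = false` for control, and `R = true` when the primary outcome is labelled. -/
abbrev FullData (𝒳 𝒮 : Type*) := 𝒳 × Bool × (Bool → 𝒮) × (Bool → ℝ) × Bool

/-- One observed data point `W = (X, T, S, R, Y)`. The outcome of an unlabelled unit
(`R = false`) is recorded as `0`; since `R` is observed, `0` is only a code for `NA`. -/
abbrev ObsData (𝒳 𝒮 : Type*) := 𝒳 × Bool × 𝒮 × Bool × ℝ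

/-- A binary variable as a real number. -/
def ind (b : Bool) : ℝ := if b then 1 else 0

section Variables

variable {𝒳 𝒮 : Type*}

/-- The covariates `X`. -/
def covX (z : FullData 𝒳 𝒮) : 𝒳 := z.1

/-- The treatment `T`. -/
def treatT (z : FullData 𝒳 𝒮) : Bool := z.2.1

/-- The potential surrogates `S(t)`. -/
def potS (t : Bool) (z : FullData 𝒳 𝒮) : 𝒮 := z.2.2.1 t

/-- The potential outcome `Y(t)`. -/
def potY (t : Bool) (z : FullData 𝒳 𝒮) : ℝ := z.2.2.2.1 t

/-- The labelling indicator `R`. -/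
def labelR (z : FullData 𝒳 𝒮) : Bool := z.2.2.2.2

/-- The actual surrogates `S = S(T)`. -/
def surS (z : FullData 𝒳 𝒮) : 𝒮 := potS (treatT z) z

/-- The actual outcome `Y = Y(T)`. -/
def outY (z : FullData 𝒳 𝒮) : ℝ := potY (treatT z) z

/-- The observed part of a unit. -/
def obs (z : FullData 𝒳 𝒮) : ObsData 𝒳 𝒮 :=
  (covX z, treatT z, surS z, labelR z, if labelR z then outY z else 0)

variable [MeasurableSpace 𝒳] [MeasurableSpace 𝒮]

theorem measurable_covX : Measurable (covX : FullData 𝒳 𝒮 → 𝒳) := measurable_fst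

theorem measurable_potS (t : Bool) : Measurable (potS t : FullData 𝒳 𝒮 → 𝒮) :=
  (measurable_pi_apply t).comp measurable_snd.snd.fst

theorem measurable_covX_potS (t : Bool) :
    Measurable (fun z : FullData 𝒳 𝒮 => (covX z, potS t z)) :=
  measurable_covX.prodMk (measurable_potS t)

/-- The law of the observed data. -/
noncomputable def obsLaw (P : ProbabilityMeasure (FullData 𝒳 𝒮)) : Measure (ObsData 𝒳 𝒮) :=
  (P : Measure (FullData 𝒳 𝒮)).map obs

/-- The average treatment effect `E[Y(1)] - E[Y(0)]`. -/
noncomputable def ate (P : ProbabilityMeasure (FullData 𝒳 𝒮)) : ℝ :=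
  ∫ z, potY true z ∂(P : Measure (FullData 𝒳 𝒮)) -
    ∫ z, potY false z ∂(P : Measure (FullData 𝒳 𝒮))

/-! ### Nuisance functions

Conditional expectations given random variables are determined only almost surely, so each
predicate says that a measurable function is a version of the quantity in question. -/

/-- `e(x) = P(T = 1 ∣ X = x)`. -/
def IsTreatmentPropensity (P : ProbabilityMeasure (FullData 𝒳 𝒮)) (e : 𝒳 → ℝ) : Prop :=
  Measurable e ∧
    (P : Measure (FullData 𝒳 𝒮))[fun z => ind (treatT z) |
        MeasurableSpace.comap covX inferInstance]
      =ᵐ[(P : Measure (FullData 𝒳 𝒮))] fun z => e (covX z)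

/-- `r(t, x, s) = P(R = 1 ∣ T = t, X = x, S = s)`. -/
def IsLabelPropensity (P : ProbabilityMeasure (FullData 𝒳 𝒮)) (r : Bool → 𝒳 → 𝒮 → ℝ) : Prop :=
  Measurable (fun p : Bool × 𝒳 × 𝒮 => r p.1 p.2.1 p.2.2) ∧
    (P : Measure (FullData 𝒳 𝒮))[fun z => ind (labelR z) |
        MeasurableSpace.comap (fun z => (treatT z, covX z, surS z)) inferInstance]
      =ᵐ[(P : Measure (FullData 𝒳 𝒮))] fun z => r (treatT z) (covX z) (surS z)

/-- `m(t, x, s) = E[Y ∣ T = t, R = 1, X = x, S = s]`: the regression of `Y` on `(T, X, S)` in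
the labelled population, i.e. under the conditional law given `R = 1`. -/
def IsSurrogateRegression (P : ProbabilityMeasure (FullData 𝒳 𝒮)) (m : Bool → 𝒳 → 𝒮 → ℝ) :
    Prop :=
  Measurable (fun p : Bool × 𝒳 × 𝒮 => m p.1 p.2.1 p.2.2) ∧
    (ProbabilityTheory.cond (P : Measure (FullData 𝒳 𝒮)) {z | labelR z = true})[outY |
        MeasurableSpace.comap (fun z => (treatT z, covX z, surS z)) inferInstance]
      =ᵐ[ProbabilityTheory.cond (P : Measure (FullData 𝒳 𝒮)) {z | labelR z = true}]
        fun z => m (treatT z) (covX z) (surS z)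

/-- `m(t, x) = E[Y ∣ T = t, X = x]`. -/
def IsOutcomeRegression (P : ProbabilityMeasure (FullData 𝒳 𝒮)) (m : Bool → 𝒳 → ℝ) : Prop :=
  Measurable (fun p : Bool × 𝒳 => m p.1 p.2) ∧
    (P : Measure (FullData 𝒳 𝒮))[outY |
        MeasurableSpace.comap (fun z => (treatT z, covX z)) inferInstance]
      =ᵐ[(P : Measure (FullData 𝒳 𝒮))] fun z => m (treatT z) (covX z)

/-! ### The model -/

/-- `(Y(t), S(t)) ⊥ T ∣ X` for `t = 0, 1`. -/
def UnconfoundedTreatment [StandardBorelSpace 𝒳] [StandardBorelSpace 𝒮]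
    (P : ProbabilityMeasure (FullData 𝒳 𝒮)) : Prop :=
  ∀ t : Bool, CondIndepFun (MeasurableSpace.comap covX inferInstance)
    measurable_covX.comap_le (fun z => (potY t z, potS t z)) treatT
    (P : Measure (FullData 𝒳 𝒮))

/-- `R ⊥ Y(t) ∣ (X, T = t, S(t))` for `t = 0, 1`: conditional independence given `(X, S(t))`
under the conditional law given `T = t`. -/
def MissingAtRandom [StandardBorelSpace 𝒳] [StandardBorelSpace 𝒮]
    (P : ProbabilityMeasure (FullData 𝒳 𝒮)) : Prop :=
  ∀ t : Bool, CondIndepFun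
    (MeasurableSpace.comap (fun z => (covX z, potS t z)) inferInstance)
    (measurable_covX_potS t).comap_le labelR (potY t)
    (ProbabilityTheory.cond (P : Measure (FullData 𝒳 𝒮)) {z | treatT z = t})

/-- Strict overlap with constant `ε`: almost surely `ε ≤ e(X) ≤ 1 - ε`, and
`ε ≤ r(t, X, S(t)) ≤ 1` for `t = 0, 1`. -/
def StrictOverlap (ε : ℝ) (P : ProbabilityMeasure (FullData 𝒳 𝒮)) : Prop :=
  (∃ e : 𝒳 → ℝ, IsTreatmentPropensity P e ∧
    ∀ᵐ z ∂(P : Measure (FullData 𝒳 𝒮)), ε ≤ e (covX z) ∧ e (covX z) ≤ 1 - ε) ∧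
  (∃ r : Bool → 𝒳 → 𝒮 → ℝ, IsLabelPropensity P r ∧
    ∀ t : Bool, ∀ᵐ z ∂(P : Measure (FullData 𝒳 𝒮)),
      ε ≤ r t (covX z) (potS t z) ∧ r t (covX z) (potS t z) ≤ 1)

/-- The laws of `(X, T, S(0), S(1), Y(0), Y(1), R)` that satisfy unconfoundedness and strict
overlap with constant `ε` and have square-integrable potential outcomes; apart from that they
are arbitrary. -/
def model (𝒳 𝒮 : Type*) [MeasurableSpace 𝒳] [MeasurableSpace 𝒮]
    [StandardBorelSpace 𝒳] [StandardBorelSpace 𝒮] (ε : ℝ) :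
    Set (ProbabilityMeasure (FullData 𝒳 𝒮)) :=
  {P | UnconfoundedTreatment P ∧ MissingAtRandom P ∧ StrictOverlap ε P ∧
    ∀ t : Bool, MemLp (potY t) 2 (P : Measure (FullData 𝒳 𝒮))}

/-- The submodel in which the treatment propensity score is known to be `e` (if `knownE`), and
the labelling propensity score is known to be `r` (if `knownR`). With both `knownE` and `knownR`
false this is `model 𝒳 𝒮 ε`. -/
def modelWith [StandardBorelSpace 𝒳] [StandardBorelSpace 𝒮] (ε : ℝ) (knownE knownR : Prop)
    (e : 𝒳 → ℝ) (r : Bool → 𝒳 → 𝒮 → ℝ) : Set (ProbabilityMeasure (FullData 𝒳 𝒮)) :=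
  {P | P ∈ model 𝒳 𝒮 ε ∧ (knownE → IsTreatmentPropensity P e) ∧
    (knownR → IsLabelPropensity P r)}

/-! ### Semiparametric efficiency -/

/-- `γ ↦ path γ` is a smooth and regular one-dimensional parametric submodel of `M` which passes
through `P` at `γ = 0` and whose score there, for the observed data, is `g`: the laws of the
observed data have densities with respect to a common dominating measure, the family of
densities is differentiable in quadratic mean at `0` with score `g`, and the second moments of
the potential outcomes are locally bounded. -/
structure IsRegularSubmodel (M : Set (ProbabilityMeasure (FullData 𝒳 𝒮)))
    (P : ProbabilityMeasure (FullData 𝒳 𝒮)) (path : ℝ → ProbabilityMeasure (FullData 𝒳 𝒮))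
    (g : ObsData 𝒳 𝒮 → ℝ) : Prop where
  mem : ∀ γ, path γ ∈ M
  zero : path 0 = P
  score_memLp : MemLp g 2 (obsLaw P)
  quadratic_mean : ∃ (ν : Measure (ObsData 𝒳 𝒮)) (q : ℝ → ObsData 𝒳 𝒮 → ℝ), SigmaFinite ν ∧
    (∀ γ, Measurable (q γ)) ∧ (∀ γ w, 0 ≤ q γ w) ∧
    (∀ γ, obsLaw (path γ) = ν.withDensity fun w => ENNReal.ofReal (q γ w)) ∧
    Tendsto (fun γ : ℝ => ∫⁻ w, ENNReal.ofReal
        (((√(q γ w) - √(q 0 w)) / γ - g w / 2 * √(q 0 w)) ^ 2) ∂ν) (𝓝[≠] 0) (𝓝 0)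
  moment_bounded : ∃ C : ℝ, ∀ᶠ γ in 𝓝 (0 : ℝ), ∀ t : Bool,
    ∫ z, potY t z ^ 2 ∂(path γ : Measure (FullData 𝒳 𝒮)) ≤ C

/-- The scores at `P` of the regular parametric submodels of `M`. -/
def tangentSet (M : Set (ProbabilityMeasure (FullData 𝒳 𝒮)))
    (P : ProbabilityMeasure (FullData 𝒳 𝒮)) : Set (Lp ℝ 2 (obsLaw P)) :=
  {g | ∃ path, IsRegularSubmodel M P path g}

/-- `ψ` is the efficient influence function of the parameter `θ` at `P` in the model `M`:
`θ` is pathwise differentiable with gradient `ψ`, i.e. the derivative of `θ` along every regular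
parametric submodel is the `L²` inner product of `ψ` with the score, and `ψ` belongs to the
tangent space, the closed linear span of the scores. -/
def IsEfficientInfluenceFunction (M : Set (ProbabilityMeasure (FullData 𝒳 𝒮)))
    (θ : ProbabilityMeasure (FullData 𝒳 𝒮) → ℝ) (P : ProbabilityMeasure (FullData 𝒳 𝒮))
    (ψ : ObsData 𝒳 𝒮 → ℝ) : Prop :=
  (∀ path g, IsRegularSubmodel M P path g →
    HasDerivAt (fun γ => θ (path γ)) (∫ w, ψ w * g w ∂(obsLaw P)) 0) ∧
  ∃ hψ : MemLp ψ 2 (obsLaw P),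
    hψ.toLp ψ ∈ (Submodule.span ℝ (tangentSet M P)).topologicalClosure

/-- The Cramér–Rao bounds `θ'(0)² / E[g²]` of the regular parametric submodels through `P`.
A submodel whose score vanishes contributes `0 / 0 = 0`, as it should when `θ'(0) = 0`. -/
def cramerRaoBounds (M : Set (ProbabilityMeasure (FullData 𝒳 𝒮)))
    (θ : ProbabilityMeasure (FullData 𝒳 𝒮) → ℝ) (P : ProbabilityMeasure (FullData 𝒳 𝒮)) :
    Set ℝ :=
  {v | ∃ path g d, IsRegularSubmodel M P path g ∧ HasDerivAt (fun γ => θ (path γ)) d 0 ∧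
    v = d ^ 2 / ∫ w, g w ^ 2 ∂(obsLaw P)}

/-- `V` is the semiparametric efficiency lower bound for `θ` at `P` in the model `M`: it is the
second moment of the efficient influence function, and it is the supremum of the Cramér–Rao
bounds of the regular parametric submodels. -/
def IsEfficiencyLowerBound (M : Set (ProbabilityMeasure (FullData 𝒳 𝒮)))
    (θ : ProbabilityMeasure (FullData 𝒳 𝒮) → ℝ) (P : ProbabilityMeasure (FullData 𝒳 𝒮))
    (V : ℝ) : Prop :=
  (∃ φ, IsEfficientInfluenceFunction M θ P φ ∧ V = ∫ w, φ w ^ 2 ∂(obsLaw P)) ∧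
  IsLUB (cramerRaoBounds M θ P) V

/-- The function `ψ(W; δ, η)` with `η = (e, r, μ̃, μ)`; `mS` stands for `μ̃` and `m` for `μ`. -/
noncomputable def psi (δ : ℝ) (e : 𝒳 → ℝ) (r mS : Bool → 𝒳 → 𝒮 → ℝ) (m : Bool → 𝒳 → ℝ) :
    ObsData 𝒳 𝒮 → ℝ :=
  fun ⟨x, t, s, ρ, y⟩ =>
    m true x - m false x
      + ind t * ind ρ / (e x * r true x s) * (y - mS true x s)
      - (1 - ind t) * ind ρ / ((1 - e x) * r false x s) * (y - mS false x s)
      + ind t / e x * (mS true x s - m true x)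
      - (1 - ind t) / (1 - e x) * (mS false x s - m false x)
      - δ

end Variables

end SurrogateATE

namespace SurrogateATE

/-! ### Square-integrable functions -/

section SquareIntegrable

variable {Ω A : Type*} [MeasurableSpace Ω] [MeasurableSpace A]

/-! Write H_t for the law of ((X, S(t)), Y(t)) and e_t(x) for P(T = t | X = x). The causal
assumptions are used through the identities in `IsIdentified`: the observed law restricted to T = t,
R = 1 shows H_t with density e_t r_t, restricted to T = t it shows the (X, S)-marginal of H_t with
density e_t, and the X-marginal is seen without selection. `isIdentified_clamp` derives this from
membership in the model, `IsIdentified.mem_model` is the converse.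

Gradient. Along a regular submodel the propensity scores of P_γ need not depend smoothly on γ, so
the weights cannot be differentiated. Two facts about families that are differentiable in quadratic
mean avoid this. An image of such a family is again one, with the conditional expectation of the
score as its score (`IsQMD.map`). If a family with score g is reweighted by bounded functions of π
so that its image, with score g_A, becomes another differentiable family, with score a, then the
result is differentiable with score g + a∘π - g_A∘π (`IsQMD.reweight`); nothing about the weights is
differentiated. Climbing from X to (X, S) to (X, S, Y) in this way makes H_t differentiable with a
score of five terms. Locally bounded second moments allow E[Y(t)] to be differentiated
(`IsQMD.hasDerivAt_integral`). Pairing Y with the five terms, and replacing Y by its regression on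
whatever variables a term depends on, gives exactly `armInfluence`
(`hasDerivAt_integral_of_selection`). The difference of the two arms is ψ up to the constant δ,
which is harmless because scores have mean zero.

Tangent space. Keep both propensity scores and tilt H_t by 1 + γ(a(x) + β_t), where a and β_t are
bounded, a has mean zero and β_t is centred given X. The tilted arms have a common covariate law,
hence come from a law of the full data: couple them given X, then assign T and R
(`exists_isIdentified_of_arms`). This law lies in all four models. The score is a + β_t on labelled
units and a + E[β_t | X, S(t)] on unlabelled ones. Algebraically ψ has this very form with
square-integrable directions (`psi_eq_tiltScore`), and truncating and recentring the directions
exhibits ψ as an L² limit of such scores (`exists_score_tendsto_psi`).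

So ψ is a gradient already in the largest model and tangent already in the smallest, which is why
knowledge of the propensity scores does not matter. Cauchy–Schwarz bounds every Cramér–Rao quotient
by E[ψ²], and the quotients of scores converging to ψ approach it. -/

theorem eLpNorm_two_sq (μ : Measure Ω) (f : Ω → ℝ) :
    eLpNorm f 2 μ ^ 2 = ∫⁻ ω, ENNReal.ofReal (f ω ^ 2) ∂μ := by
  have h := eLpNorm_nnreal_pow_eq_lintegral (μ := μ) (f := f) (p := 2) two_ne_zero
  have h2 : eLpNorm f 2 μ ^ (2 : ℝ) = ∫⁻ ω, ‖f ω‖ₑ ^ (2 : ℝ) ∂μ := by simpa using h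
  rw [← ENNReal.rpow_natCast, Nat.cast_ofNat, h2]
  refine lintegral_congr fun ω => ?_
  rw [Real.enorm_eq_ofReal_abs, ENNReal.ofReal_rpow_of_nonneg (abs_nonneg _) zero_le_two]
  norm_num

theorem toReal_eLpNorm_two_sq {μ : Measure Ω} {f : Ω → ℝ} (hf : AEStronglyMeasurable f μ) :
    (eLpNorm f 2 μ).toReal ^ 2 = ∫ ω, f ω ^ 2 ∂μ := by
  rw [← ENNReal.toReal_pow, eLpNorm_two_sq,
    integral_eq_lintegral_of_nonneg_ae (ae_of_all _ fun ω => sq_nonneg _) (hf.pow 2)]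

theorem tendsto_eLpNorm_two_iff {ι : Type*} {l : Filter ι} {μ : Measure Ω} {f : ι → Ω → ℝ} :
    Tendsto (fun i => eLpNorm (f i) 2 μ) l (𝓝 0) ↔
      Tendsto (fun i => ∫⁻ ω, ENNReal.ofReal (f i ω ^ 2) ∂μ) l (𝓝 0) := by
  simp_rw [← eLpNorm_two_sq]
  constructor
  · intro h
    have := ((ENNReal.continuous_pow 2).tendsto 0).comp h
    rwa [zero_pow two_ne_zero] at this
  · intro h
    have := ((ENNReal.continuous_rpow_const (y := (1 / 2 : ℝ))).tendsto 0).comp h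
    rw [ENNReal.zero_rpow_of_pos (by norm_num)] at this
    refine this.congr fun i => ?_
    simp only [Function.comp]
    rw [← ENNReal.rpow_natCast, ← ENNReal.rpow_mul]
    norm_num

theorem tendsto_toReal_zero {ι : Type*} {l : Filter ι} {f : ι → ℝ≥0∞} (h : Tendsto f l (𝓝 0)) :
    Tendsto (fun i => (f i).toReal) l (𝓝 0) :=
  (ENNReal.tendsto_toReal ENNReal.zero_ne_top).comp h

theorem abs_integral_mul_le_eLpNorm {μ : Measure Ω} {f g : Ω → ℝ} (hf : MemLp f 2 μ)
    (hg : MemLp g 2 μ) :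
    |∫ ω, f ω * g ω ∂μ| ≤ (eLpNorm f 2 μ).toReal * (eLpNorm g 2 μ).toReal := by
  have h1 : eLpNorm (f • g) 1 μ ≤ eLpNorm f 2 μ * eLpNorm g 2 μ :=
    eLpNorm_smul_le_mul_eLpNorm hg.1 hf.1
  rw [eLpNorm_one_eq_lintegral_enorm] at h1
  have h2 := (enorm_integral_le_lintegral_enorm (μ := μ) (f • g)).trans h1
  rw [← ENNReal.toReal_mul, ← Real.norm_eq_abs, ← toReal_enorm]
  exact ENNReal.toReal_mono (ENNReal.mul_ne_top hf.2.ne hg.2.ne) h2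

theorem sq_integral_mul_le {μ : Measure Ω} {f g : Ω → ℝ} (hf : MemLp f 2 μ) (hg : MemLp g 2 μ) :
    (∫ ω, f ω * g ω ∂μ) ^ 2 ≤ (∫ ω, f ω ^ 2 ∂μ) * ∫ ω, g ω ^ 2 ∂μ := by
  rw [← toReal_eLpNorm_two_sq hf.1, ← toReal_eLpNorm_two_sq hg.1, ← mul_pow, ← sq_abs]
  exact pow_le_pow_left₀ (abs_nonneg _) (abs_integral_mul_le_eLpNorm hf hg) 2

theorem integrable_mul_of_memLp_two {μ : Measure Ω} {f g : Ω → ℝ} (hf : MemLp f 2 μ)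
    (hg : MemLp g 2 μ) : Integrable (fun ω => f ω * g ω) μ :=
  hf.integrable_mul hg

theorem tendsto_eLpNorm_two_zero_of_dominated {μ : Measure Ω} {F : ℕ → Ω → ℝ} {G : Ω → ℝ}
    (hF : ∀ n, AEStronglyMeasurable (F n) μ) (hG : MemLp G 2 μ)
    (hb : ∀ n, ∀ᵐ ω ∂μ, |F n ω| ≤ |G ω|)
    (hlim : ∀ᵐ ω ∂μ, Tendsto (fun n => F n ω) atTop (𝓝 0)) :
    Tendsto (fun n => eLpNorm (F n) 2 μ) atTop (𝓝 0) := by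
  rw [tendsto_eLpNorm_two_iff]
  have := tendsto_lintegral_of_dominated_convergence' (μ := μ)
    (F := fun n ω => ENNReal.ofReal (F n ω ^ 2)) (f := fun _ => 0)
    (fun ω => ENNReal.ofReal (G ω ^ 2))
    (fun n => ((hF n).aemeasurable.pow_const 2).ennreal_ofReal)
    (fun n => by
      filter_upwards [hb n] with ω hω
      exact ENNReal.ofReal_le_ofReal (sq_le_sq.2 hω))
    (by rw [← eLpNorm_two_sq]; exact ENNReal.pow_ne_top hG.2.ne)
    (by
      filter_upwards [hlim] with ω hω
      have := (ENNReal.continuous_ofReal.tendsto _).comp (hω.pow 2)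
      rwa [zero_pow two_ne_zero, ENNReal.ofReal_zero] at this)
  simpa using this

/-- Multiplication by a bounded family of functions which converges almost everywhere on the
support of the limit, along a subsequence of any sequence, preserves convergence in `L²`. -/
theorem tendsto_eLpNorm_two_mul_of_bounded {ι : Type*} {l : Filter ι} [l.IsCountablyGenerated]
    {μ : Measure Ω} {f b : ι → Ω → ℝ} {f₀ b₀ : Ω → ℝ} {C : ℝ}
    (hf : ∀ i, AEStronglyMeasurable (f i) μ) (hf₀ : MemLp f₀ 2 μ)
    (hb : ∀ i, AEStronglyMeasurable (b i) μ) (hb₀ : AEStronglyMeasurable b₀ μ)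
    (hbC : ∀ i, ∀ᵐ ω ∂μ, |b i ω| ≤ C) (hb₀C : ∀ᵐ ω ∂μ, |b₀ ω| ≤ C)
    (hlim : Tendsto (fun i => eLpNorm (fun ω => f i ω - f₀ ω) 2 μ) l (𝓝 0))
    (hblim : ∀ s : ℕ → ι, Tendsto s atTop l → ∃ k : ℕ → ℕ,
      Tendsto k atTop atTop ∧
      ∀ᵐ ω ∂μ, f₀ ω ≠ 0 → Tendsto (fun n => b (s (k n)) ω) atTop (𝓝 (b₀ ω))) :
    Tendsto (fun i => eLpNorm (fun ω => b i ω * f i ω - b₀ ω * f₀ ω) 2 μ) l (𝓝 0) := by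
  refine tendsto_of_subseq_tendsto fun s hs => ?_
  obtain ⟨k, hk, hbk⟩ := hblim s hs
  refine ⟨k, ?_⟩
  have hsk : Tendsto (fun n => s (k n)) atTop l := hs.comp hk
  -- Split b f - b₀ f₀ as b (f - f₀) + (b - b₀) f₀. The second summand is handled by dominated
  -- convergence with majorant 2C|f₀|; where f₀ vanishes, no convergence of b is needed.
  have h1 : Tendsto (fun n => eLpNorm (fun ω => (b (s (k n)) ω - b₀ ω) * f₀ ω) 2 μ)
      atTop (𝓝 0) := by
    refine tendsto_eLpNorm_two_zero_of_dominated (G := fun ω => 2 * C * f₀ ω)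
      (fun n => ((hb _).sub hb₀).mul hf₀.1) (hf₀.const_mul _) (fun n => ?_) ?_
    · filter_upwards [hbC (s (k n)), hb₀C] with ω h1 h2
      rw [abs_mul, abs_mul]
      refine mul_le_mul_of_nonneg_right ?_ (abs_nonneg _)
      calc _ ≤ |b (s (k n)) ω| + |b₀ ω| := abs_sub _ _
        _ ≤ 2 * C := by linarith
        _ ≤ _ := le_abs_self _
    · filter_upwards [hbk] with ω hω
      by_cases h0 : f₀ ω = 0
      · simp [h0]
      · simpa using ((hω h0).sub_const (b₀ ω)).mul_const (f₀ ω)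
  have h2 : Tendsto (fun n => ENNReal.ofReal C *
      eLpNorm (fun ω => f (s (k n)) ω - f₀ ω) 2 μ) atTop (𝓝 0) := by
    simpa using ENNReal.Tendsto.const_mul (hlim.comp hsk) (Or.inr ENNReal.ofReal_ne_top)
  have h3 := h2.add h1
  rw [add_zero] at h3
  refine tendsto_of_tendsto_of_tendsto_of_le_of_le tendsto_const_nhds h3
    (fun _ => zero_le) fun n => ?_
  have e1 : (fun ω => b (s (k n)) ω * f (s (k n)) ω - b₀ ω * f₀ ω) =
      (fun ω => b (s (k n)) ω * (f (s (k n)) ω - f₀ ω)) +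
        fun ω => (b (s (k n)) ω - b₀ ω) * f₀ ω := by
    ext ω; simp only [Pi.add_apply]; ring
  rw [e1]
  refine (eLpNorm_add_le ((hb _).mul ((hf _).sub hf₀.1)) (((hb _).sub hb₀).mul hf₀.1)
    one_le_two).trans (add_le_add_left ?_ _)
  refine eLpNorm_le_mul_eLpNorm_of_ae_le_mul ?_ 2
  filter_upwards [hbC (s (k n))] with ω hω
  rw [Pi.mul_apply, norm_mul]
  exact mul_le_mul_of_nonneg_right hω (norm_nonneg _)

theorem exists_subseq_ae_tendsto {ι : Type*} {l : Filter ι} {μ : Measure Ω} {f : ι → Ω → ℝ}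
    {f₀ : Ω → ℝ} (hf : ∀ i, AEStronglyMeasurable (f i) μ) (hf₀ : AEStronglyMeasurable f₀ μ)
    (hlim : Tendsto (fun i => eLpNorm (fun ω => f i ω - f₀ ω) 2 μ) l (𝓝 0))
    (s : ℕ → ι) (hs : Tendsto s atTop l) :
    ∃ k : ℕ → ℕ, StrictMono k ∧
      ∀ᵐ ω ∂μ, Tendsto (fun n => f (s (k n)) ω) atTop (𝓝 (f₀ ω)) :=
  (tendstoInMeasure_of_tendsto_eLpNorm two_ne_zero (fun n => hf (s n)) hf₀
    (hlim.comp hs)).exists_seq_tendsto_ae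

theorem memLp_two_of_lintegral_lt_top {μ : Measure Ω} {f : Ω → ℝ}
    (hf : AEStronglyMeasurable f μ) (h : ∫⁻ ω, ENNReal.ofReal (f ω ^ 2) ∂μ < ∞) :
    MemLp f 2 μ := by
  refine ⟨hf, ?_⟩
  rw [← eLpNorm_two_sq] at h
  by_contra h'
  rw [not_lt, top_le_iff] at h'
  rw [h'] at h
  exact absurd h (by norm_num)

end SquareIntegrable

/-! ### Differentiability in quadratic mean -/

section QuadraticMean

variable {Ω A : Type*} [MeasurableSpace Ω] [MeasurableSpace A]

/-- The family `μ` has root densities `u` with respect to `ν` which are differentiable in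
quadratic mean at `0`, with score `g`. -/
structure IsQMD (ν : Measure Ω) (μ : ℝ → Measure Ω) (u : ℝ → Ω → ℝ) (g : Ω → ℝ) : Prop where
  finite : ∀ γ, IsFiniteMeasure (μ γ)
  measurable_root : ∀ γ, Measurable (u γ)
  nonneg : ∀ γ ω, 0 ≤ u γ ω
  density : ∀ γ, μ γ = ν.withDensity fun ω => ENNReal.ofReal (u γ ω ^ 2)
  measurable_score : Measurable g
  score_memLp : MemLp g 2 (μ 0)
  tendsto : Tendsto (fun γ : ℝ => eLpNorm
    (fun ω => (u γ ω - u 0 ω) / γ - g ω / 2 * u 0 ω) 2 ν) (𝓝[≠] 0) (𝓝 0)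

variable {ν : Measure Ω} {μ : ℝ → Measure Ω} {u : ℝ → Ω → ℝ} {g : Ω → ℝ}

theorem lintegral_withDensity_sq {v : Ω → ℝ} (hv : Measurable v) {f : Ω → ℝ≥0∞}
    (hf : Measurable f) :
    ∫⁻ ω, f ω ∂(ν.withDensity fun ω => ENNReal.ofReal (v ω ^ 2)) =
      ∫⁻ ω, ENNReal.ofReal (v ω ^ 2) * f ω ∂ν :=
  lintegral_withDensity_eq_lintegral_mul _ (hv.pow_const 2).ennreal_ofReal hf

theorem integral_withDensity_sq {v : Ω → ℝ} (hv : Measurable v) (f : Ω → ℝ) :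
    ∫ ω, f ω ∂(ν.withDensity fun ω => ENNReal.ofReal (v ω ^ 2)) = ∫ ω, v ω ^ 2 * f ω ∂ν := by
  rw [integral_withDensity_eq_integral_toReal_smul (hv.pow_const 2).ennreal_ofReal
    (ae_of_all _ fun _ => ENNReal.ofReal_lt_top)]
  simp [ENNReal.toReal_ofReal (sq_nonneg _)]

theorem memLp_two_withDensity_sq_iff {v : Ω → ℝ} (hv : Measurable v) {f : Ω → ℝ}
    (hf : Measurable f) :
    MemLp f 2 (ν.withDensity fun ω => ENNReal.ofReal (v ω ^ 2)) ↔
      MemLp (fun ω => f ω * v ω) 2 ν := by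
  rw [memLp_two_iff_integrable_sq hf.aestronglyMeasurable,
    memLp_two_iff_integrable_sq (f := fun ω => f ω * v ω) (hf.mul hv).aestronglyMeasurable,
    integrable_withDensity_iff_integrable_smul' (hv.pow_const 2).ennreal_ofReal
    (ae_of_all _ fun _ => ENNReal.ofReal_lt_top)]
  refine integrable_congr (ae_of_all _ fun ω => ?_)
  simp only [ENNReal.toReal_ofReal (sq_nonneg (v ω)), smul_eq_mul]
  ring

namespace IsQMD

theorem root_memLp (h : IsQMD ν μ u g) (γ : ℝ) : MemLp (u γ) 2 ν := by
  have := h.finite γ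
  have h1 : MemLp (fun _ : Ω => (1 : ℝ)) 2 (μ γ) := memLp_const 1
  rw [h.density, memLp_two_withDensity_sq_iff (h.measurable_root γ) measurable_const] at h1
  simpa using h1

theorem score_mul_root_memLp (h : IsQMD ν μ u g) : MemLp (fun ω => g ω * u 0 ω) 2 ν := by
  have h1 := h.score_memLp
  rwa [h.density, memLp_two_withDensity_sq_iff (h.measurable_root 0) h.measurable_score] at h1

theorem deriv_memLp (h : IsQMD ν μ u g) : MemLp (fun ω => g ω / 2 * u 0 ω) 2 ν := by
  have := h.score_mul_root_memLp.const_mul (1 / 2)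
  refine this.congr_norm ?_ (ae_of_all _ fun ω => by congr 1; ring)
  exact ((h.measurable_score.div_const 2).mul (h.measurable_root 0)).aestronglyMeasurable

theorem quotient_memLp (h : IsQMD ν μ u g) (γ : ℝ) :
    MemLp (fun ω => (u γ ω - u 0 ω) / γ) 2 ν := by
  have := ((h.root_memLp γ).sub (h.root_memLp 0)).mul_const γ⁻¹
  simpa [div_eq_mul_inv] using this

/-- Differentiability implies continuity: the increment is γ times a family bounded in L². The
neighbourhood filter is split into its punctured part and the point 0, where the claim is trivial.
-/
theorem tendsto_root (h : IsQMD ν μ u g) :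
    Tendsto (fun γ => eLpNorm (fun ω => u γ ω - u 0 ω) 2 ν) (𝓝 0) (𝓝 0) := by
  rw [← nhdsNE_sup_pure, tendsto_sup]
  constructor
  · have hb : Tendsto (fun γ : ℝ => ‖γ‖ₑ * (eLpNorm
      (fun ω => (u γ ω - u 0 ω) / γ - g ω / 2 * u 0 ω) 2 ν +
        eLpNorm (fun ω => g ω / 2 * u 0 ω) 2 ν)) (𝓝[≠] 0) (𝓝 (0 * (0 +
        eLpNorm (fun ω => g ω / 2 * u 0 ω) 2 ν))) := by
      refine ENNReal.Tendsto.mul ?_ (Or.inr ?_) (h.tendsto.add tendsto_const_nhds) (Or.inr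
          (by simp))
      · have : Tendsto (fun γ : ℝ => ‖γ‖ₑ) (𝓝 0) (𝓝 ‖(0 : ℝ)‖ₑ) := continuous_enorm.tendsto 0
        rw [enorm_zero] at this
        exact this.mono_left nhdsWithin_le_nhds
      · simpa using h.deriv_memLp.2.ne
    rw [zero_mul] at hb
    refine tendsto_of_tendsto_of_tendsto_of_le_of_le' tendsto_const_nhds hb
      (Eventually.of_forall fun _ => zero_le) ?_
    filter_upwards [self_mem_nhdsWithin] with γ hγ
    have e1 : (fun ω => u γ ω - u 0 ω) = γ • ((fun ω => (u γ ω - u 0 ω) / γ -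
        g ω / 2 * u 0 ω) + fun ω => g ω / 2 * u 0 ω) := by
      ext ω
      have : γ ≠ 0 := hγ
      simp only [Pi.smul_apply, Pi.add_apply, smul_eq_mul, sub_add_cancel]
      field_simp
    rw [e1, eLpNorm_const_smul]
    refine mul_le_mul_right (eLpNorm_add_le ?_ ?_ one_le_two) _
    · exact ((h.quotient_memLp γ).sub h.deriv_memLp).1
    · exact h.deriv_memLp.1
  · refine tendsto_pure_left.2 fun s hs => ?_
    have : eLpNorm (fun ω => u 0 ω - u 0 ω) 2 ν = 0 := by simp
    rw [this]
    exact mem_of_mem_nhds hs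

end IsQMD

end QuadraticMean

end SurrogateATE

/-! ### Differentiating expectations along a family -/

namespace SurrogateATE

namespace IsQMD

variable {Ω A : Type*} [MeasurableSpace Ω] [MeasurableSpace A]
  {ν : Measure Ω} {μ : ℝ → Measure Ω} {u : ℝ → Ω → ℝ} {g : Ω → ℝ}

theorem eLpNorm_mul_root (h : IsQMD ν μ u g) {f : Ω → ℝ} (hf : Measurable f) (γ : ℝ) :
    eLpNorm (fun ω => f ω * u γ ω) 2 ν ^ 2 = ∫⁻ ω, ENNReal.ofReal (f ω ^ 2) ∂(μ γ) := by
  rw [eLpNorm_two_sq, h.density, lintegral_withDensity_sq (h.measurable_root γ)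
    (hf.pow_const 2).ennreal_ofReal]
  refine lintegral_congr fun ω => ?_
  rw [← ENNReal.ofReal_mul (sq_nonneg _), mul_pow, mul_comm]

/-- Since f may be unbounded, f (u γ - u 0) is only known to be bounded in L², by 2K, while u γ - u
0 itself tends to zero. Hence f is truncated: on {|f| ≤ n} Cauchy–Schwarz is applied with f moved to
the derivative, and on the complement the fixed L² function d has small norm. The level n is chosen
first, then γ. -/
theorem tendsto_integral_mul_deriv (h : IsQMD ν μ u g) {f : Ω → ℝ} (hf : Measurable f) {K : ℝ}
    (hK : ∀ᶠ γ in 𝓝 (0 : ℝ), MemLp (fun ω => f ω * u γ ω) 2 ν ∧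
      (eLpNorm (fun ω => f ω * u γ ω) 2 ν).toReal ≤ K) :
    Tendsto (fun γ => ∫ ω, f ω * (u γ ω - u 0 ω) * (g ω / 2 * u 0 ω) ∂ν) (𝓝[≠] 0) (𝓝 0) := by
  set d : Ω → ℝ := fun ω => g ω / 2 * u 0 ω with hd
  have hdL : MemLp d 2 ν := h.deriv_memLp
  have hmeas : ∀ n : ℕ, MeasurableSet {ω | |f ω| ≤ n} := fun n =>
    measurableSet_le hf.abs measurable_const
  have htail : Tendsto (fun n : ℕ => eLpNorm ({ω | |f ω| ≤ n}ᶜ.indicator d) 2 ν) atTop (𝓝 0) := by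
    refine tendsto_eLpNorm_two_zero_of_dominated (G := d)
      (fun n => hdL.1.indicator (hmeas n).compl) hdL (fun n => ae_of_all _ fun ω => ?_)
      (ae_of_all _ fun ω => ?_)
    · exact norm_indicator_le_norm_self d ω
    · refine tendsto_const_nhds.congr' ?_
      obtain ⟨N, hN⟩ := exists_nat_ge |f ω|
      filter_upwards [eventually_ge_atTop N] with n hn
      have : |f ω| ≤ n := hN.trans (by exact_mod_cast hn)
      simp [this]
  have hroot : Tendsto (fun γ => (eLpNorm (fun ω => u γ ω - u 0 ω) 2 ν).toReal)
      (𝓝[≠] 0) (𝓝 0) := tendsto_toReal_zero (h.tendsto_root.mono_left nhdsWithin_le_nhds)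
  have htail' : Tendsto (fun n : ℕ => 2 * K * (eLpNorm ({ω | |f ω| ≤ n}ᶜ.indicator d) 2 ν).toReal)
      atTop (𝓝 0) := by
    simpa using (tendsto_toReal_zero htail).const_mul (2 * K)
  rw [Metric.tendsto_nhds]
  intro ε hε
  obtain ⟨n, hn⟩ := (htail'.eventually (gt_mem_nhds (half_pos hε))).exists
  have hcore : Tendsto (fun γ => (eLpNorm (fun ω => u γ ω - u 0 ω) 2 ν).toReal *
      (n * (eLpNorm d 2 ν).toReal)) (𝓝[≠] 0) (𝓝 0) := by
    simpa using hroot.mul_const (n * (eLpNorm d 2 ν).toReal)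
  filter_upwards [hcore.eventually (gt_mem_nhds (half_pos hε)),
    nhdsWithin_le_nhds hK] with γ hγ ⟨hγL, hγK⟩
  obtain ⟨h0L, h0K⟩ := hK.self_of_nhds
  have hsub : MemLp (fun ω => u γ ω - u 0 ω) 2 ν := (h.root_memLp γ).sub (h.root_memLp 0)
  have hfsub : MemLp (fun ω => f ω * (u γ ω - u 0 ω)) 2 ν := by
    simp only [mul_sub]
    exact hγL.sub h0L
  have hfd : MemLp ({ω | |f ω| ≤ n}.indicator (fun ω => f ω * d ω)) 2 ν := by
    refine (hdL.const_mul (n : ℝ)).mono ((hf.aestronglyMeasurable.mul hdL.1).indicator (hmeas n))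
      (ae_of_all _ fun ω => ?_)
    by_cases hω : |f ω| ≤ n
    · simp only [Set.indicator, Set.mem_ofPred_eq, hω, if_true, norm_mul, Real.norm_eq_abs,
        Nat.abs_cast]
      gcongr
    · simp [Set.indicator, hω]; positivity
  have hsplit : (∫ ω, f ω * (u γ ω - u 0 ω) * d ω ∂ν) =
      (∫ ω, (u γ ω - u 0 ω) * {ω | |f ω| ≤ n}.indicator (fun ω => f ω * d ω) ω ∂ν) +
      ∫ ω, (f ω * (u γ ω - u 0 ω)) * {ω | |f ω| ≤ n}ᶜ.indicator d ω ∂ν := by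
    rw [← integral_add (integrable_mul_of_memLp_two hsub hfd)
      (integrable_mul_of_memLp_two hfsub (hdL.indicator (hmeas n).compl))]
    refine integral_congr_ae (ae_of_all _ fun ω => ?_)
    by_cases hω : |f ω| ≤ n
    · simp [Set.indicator, hω]; ring
    · simp [Set.indicator, hω]
  rw [Real.dist_eq, sub_zero, hsplit]
  have e1 := abs_integral_mul_le_eLpNorm hsub hfd
  have e2 := abs_integral_mul_le_eLpNorm hfsub (hdL.indicator (hmeas n).compl)
  have e3 : (eLpNorm ({ω | |f ω| ≤ n}.indicator (fun ω => f ω * d ω)) 2 ν).toReal ≤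
      n * (eLpNorm d 2 ν).toReal := by
    have : eLpNorm ({ω | |f ω| ≤ n}.indicator (fun ω => f ω * d ω)) 2 ν ≤
        ENNReal.ofReal n * eLpNorm d 2 ν := by
      refine eLpNorm_le_mul_eLpNorm_of_ae_le_mul (ae_of_all _ fun ω => ?_) 2
      by_cases hω : |f ω| ≤ n
      · simp only [Set.indicator, Set.mem_ofPred_eq, hω, if_true, norm_mul]
        exact mul_le_mul_of_nonneg_right hω (norm_nonneg _)
      · simp [Set.indicator, hω]; positivity
    have := ENNReal.toReal_mono (ENNReal.mul_ne_top (by simp) hdL.2.ne) this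
    simpa using this
  have e4 : (eLpNorm (fun ω => f ω * (u γ ω - u 0 ω)) 2 ν).toReal ≤ 2 * K := by
    have : eLpNorm (fun ω => f ω * (u γ ω - u 0 ω)) 2 ν ≤
        eLpNorm (fun ω => f ω * u γ ω) 2 ν + eLpNorm (fun ω => f ω * u 0 ω) 2 ν := by
      simp only [mul_sub]
      exact eLpNorm_sub_le hγL.1 h0L.1 one_le_two
    have := ENNReal.toReal_mono (ENNReal.add_ne_top.2 ⟨hγL.2.ne, h0L.2.ne⟩) this
    rw [ENNReal.toReal_add hγL.2.ne h0L.2.ne] at this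
    linarith
  calc _ ≤ _ := abs_add_le _ _
    _ ≤ (eLpNorm (fun ω => u γ ω - u 0 ω) 2 ν).toReal * (n * (eLpNorm d 2 ν).toReal) +
        2 * K * (eLpNorm ({ω | |f ω| ≤ n}ᶜ.indicator d) 2 ν).toReal :=
      add_le_add (e1.trans (mul_le_mul_of_nonneg_left e3 ENNReal.toReal_nonneg))
        (e2.trans (mul_le_mul_of_nonneg_right e4 ENNReal.toReal_nonneg))
    _ < ε := by linarith

/-- The expectation of a function with locally bounded second moments is differentiable along a
family which is differentiable in quadratic mean. -/
theorem hasDerivAt_integral (h : IsQMD ν μ u g) {f : Ω → ℝ} (hf : Measurable f) {C : ℝ≥0∞}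
    (hC : C ≠ ∞) (hbound : ∀ᶠ γ in 𝓝 (0 : ℝ), ∫⁻ ω, ENNReal.ofReal (f ω ^ 2) ∂(μ γ) ≤ C) :
    HasDerivAt (fun γ => ∫ ω, f ω ∂(μ γ)) (∫ ω, f ω * g ω ∂(μ 0)) 0 := by
  set d : Ω → ℝ := fun ω => g ω / 2 * u 0 ω with hd
  have hdL : MemLp d 2 ν := h.deriv_memLp
  -- The square of the norm is at most C, so the norm is at most `max C 1`; this avoids a square
  -- root.
  set K : ℝ := (max C 1).toReal with hKdef
  have hCtop : max C 1 ≠ ∞ := by simp [hC]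
  have hK : ∀ᶠ γ in 𝓝 (0 : ℝ), MemLp (fun ω => f ω * u γ ω) 2 ν ∧
      (eLpNorm (fun ω => f ω * u γ ω) 2 ν).toReal ≤ K := by
    filter_upwards [hbound] with γ hγ
    rw [← h.eLpNorm_mul_root hf] at hγ
    have : eLpNorm (fun ω => f ω * u γ ω) 2 ν ≤ max C 1 := by
      by_contra! hlt
      have h1 : (1 : ℝ≥0∞) ≤ eLpNorm (fun ω => f ω * u γ ω) 2 ν := (le_max_right _ _).trans hlt.le
      have h2 := le_self_pow₀ h1 two_ne_zero
      exact absurd ((le_max_left C 1).trans_lt (hlt.trans_le (h2.trans hγ))) (lt_irrefl _)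
    exact ⟨⟨(hf.mul (h.measurable_root γ)).aestronglyMeasurable, this.trans_lt hCtop.lt_top⟩,
      ENNReal.toReal_mono hCtop this⟩
  have hB := h.tendsto_integral_mul_deriv hf hK
  -- With d = g u₀ / 2, the difference quotient of u², minus u₀² g, equals (u + u₀)((u - u₀)/γ - d)
  -- + (u - u₀) d. The first product tends to zero by quadratic mean differentiability, the second
  -- is `hB`.
  have hA : Tendsto (fun γ => ∫ ω, f ω * (u γ ω + u 0 ω) * ((u γ ω - u 0 ω) / γ - d ω) ∂ν)
      (𝓝[≠] 0) (𝓝 0) := by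
    have ht : Tendsto (fun γ => 2 * K * (eLpNorm
        (fun ω => (u γ ω - u 0 ω) / γ - d ω) 2 ν).toReal) (𝓝[≠] 0) (𝓝 0) := by
      simpa using (tendsto_toReal_zero h.tendsto).const_mul (2 * K)
    refine squeeze_zero_norm' ?_ ht
    filter_upwards [nhdsWithin_le_nhds hK] with γ ⟨hγL, hγK⟩
    obtain ⟨h0L, h0K⟩ := hK.self_of_nhds
    have hfadd : MemLp (fun ω => f ω * (u γ ω + u 0 ω)) 2 ν := by
      simp only [mul_add]
      exact hγL.add h0L
    refine (abs_integral_mul_le_eLpNorm hfadd ((h.quotient_memLp γ).sub hdL)).trans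
      (mul_le_mul_of_nonneg_right ?_ ENNReal.toReal_nonneg)
    have : eLpNorm (fun ω => f ω * (u γ ω + u 0 ω)) 2 ν ≤
        eLpNorm (fun ω => f ω * u γ ω) 2 ν + eLpNorm (fun ω => f ω * u 0 ω) 2 ν := by
      simp only [mul_add]
      exact eLpNorm_add_le hγL.1 h0L.1 one_le_two
    have := ENNReal.toReal_mono (ENNReal.add_ne_top.2 ⟨hγL.2.ne, h0L.2.ne⟩) this
    rw [ENNReal.toReal_add hγL.2.ne h0L.2.ne] at this
    linarith
  rw [hasDerivAt_iff_tendsto_slope, ← tendsto_sub_nhds_zero_iff]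
  change Tendsto (fun γ => ∫ ω, f ω * (u γ ω - u 0 ω) * d ω ∂ν) _ _ at hB
  have hAB := hA.add hB
  rw [add_zero] at hAB
  refine hAB.congr' ?_
  filter_upwards [self_mem_nhdsWithin, nhdsWithin_le_nhds hK] with γ hγ ⟨hγL, hγK⟩
  obtain ⟨h0L, h0K⟩ := hK.self_of_nhds
  have hγ0 : γ ≠ 0 := hγ
  have hfsub : MemLp (fun ω => f ω * (u γ ω - u 0 ω)) 2 ν := by
    simp only [mul_sub]
    exact hγL.sub h0L
  have hfadd : MemLp (fun ω => f ω * (u γ ω + u 0 ω)) 2 ν := by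
    simp only [mul_add]
    exact hγL.add h0L
  have i1 : Integrable (fun ω => f ω * (u γ ω + u 0 ω) * ((u γ ω - u 0 ω) / γ - d ω)) ν :=
    integrable_mul_of_memLp_two hfadd ((h.quotient_memLp γ).sub hdL)
  have i2 := integrable_mul_of_memLp_two hfsub hdL
  have i3 := integrable_mul_of_memLp_two hγL (h.root_memLp γ)
  have i4 := integrable_mul_of_memLp_two h0L (h.root_memLp 0)
  have i5 := integrable_mul_of_memLp_two h0L hdL
  have E1 : ∫ ω, f ω ∂(μ γ) = ∫ ω, f ω * u γ ω * u γ ω ∂ν := by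
    rw [h.density, integral_withDensity_sq (h.measurable_root γ)]
    exact integral_congr_ae (ae_of_all _ fun ω => by ring)
  have E2 : ∫ ω, f ω ∂(μ 0) = ∫ ω, f ω * u 0 ω * u 0 ω ∂ν := by
    rw [h.density, integral_withDensity_sq (h.measurable_root 0)]
    exact integral_congr_ae (ae_of_all _ fun ω => by ring)
  have E3 : ∫ ω, f ω * g ω ∂(μ 0) = ∫ ω, 2 * (f ω * u 0 ω * d ω) ∂ν := by
    rw [h.density, integral_withDensity_sq (h.measurable_root 0)]
    exact integral_congr_ae (ae_of_all _ fun ω => by simp only [hd]; ring)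
  rw [slope_def_field, E1, E2, E3, ← integral_add i1 i2, ← integral_sub i3 i4, sub_zero,
    ← integral_div]
  refine Eq.trans ?_ (integral_sub (f := fun ω => (f ω * u γ ω * u γ ω - f ω * u 0 ω * u 0 ω) / γ)
    ((i3.sub i4).div_const γ) (i5.const_mul 2))
  refine integral_congr_ae (ae_of_all _ fun ω => ?_)
  simp only
  field_simp
  ring

/-- The ratio u₀ / (v₀ ∘ π) is the square root of a conditional density given π, so multiplying by
it carries L² of the quotient into L² upstairs without increasing the norm. Only an inequality
holds, since the part of F on {v₀ = 0} is lost through division by zero. -/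
theorem eLpNorm_ratio_mul_comp_le {ν : Measure Ω} {u₀ : Ω → ℝ} (hu : Measurable u₀) {π : Ω → A}
    (hπ : Measurable π) {νA : Measure A} {v₀ : A → ℝ} (hv : Measurable v₀)
    (hmap : (ν.withDensity fun ω => ENNReal.ofReal (u₀ ω ^ 2)).map π =
      νA.withDensity fun a => ENNReal.ofReal (v₀ a ^ 2)) {F : A → ℝ} (hF : Measurable F) :
    eLpNorm (fun ω => u₀ ω / v₀ (π ω) * F (π ω)) 2 ν ≤ eLpNorm F 2 νA := by
  have hm : Measurable fun a => ENNReal.ofReal ((F a / v₀ a) ^ 2) :=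
    ((hF.div hv).pow_const 2).ennreal_ofReal
  rw [← ENNReal.pow_le_pow_left_iff two_ne_zero, eLpNorm_two_sq, eLpNorm_two_sq]
  calc _ = ∫⁻ ω, ENNReal.ofReal (u₀ ω ^ 2) * ENNReal.ofReal ((F (π ω) / v₀ (π ω)) ^ 2) ∂ν := by
        refine lintegral_congr fun ω => ?_
        rw [← ENNReal.ofReal_mul (sq_nonneg _)]
        congr 1
        ring
    _ = ∫⁻ a, ENNReal.ofReal ((F a / v₀ a) ^ 2)
          ∂((ν.withDensity fun ω => ENNReal.ofReal (u₀ ω ^ 2)).map π) := by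
        rw [lintegral_map hm hπ]
        exact (lintegral_withDensity_sq hu (hm.comp hπ)).symm
    _ = ∫⁻ a, ENNReal.ofReal (v₀ a ^ 2) * ENNReal.ofReal ((F a / v₀ a) ^ 2) ∂νA := by
        rw [hmap, lintegral_withDensity_sq hv hm]
    _ ≤ _ := by
        refine lintegral_mono fun a => ?_
        rw [← ENNReal.ofReal_mul (sq_nonneg _)]
        refine ENNReal.ofReal_le_ofReal ?_
        by_cases h0 : v₀ a = 0
        · simp [h0, sq_nonneg]
        · apply le_of_eq; field_simp

end IsQMD

end SurrogateATE

/-! ### Reweighting a family to a prescribed image -/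

namespace SurrogateATE

namespace IsQMD

variable {Ω A : Type*} [MeasurableSpace Ω] [MeasurableSpace A]
  {ν : Measure Ω} {Q : ℝ → Measure Ω} {u : ℝ → Ω → ℝ} {g : Ω → ℝ}

/-- The set {v₀ = 0} is null for the image law, so its preimage is null for the law with density
u₀². -/
theorem root_eq_zero_of_map_root_eq_zero {u₀ : Ω → ℝ} {π : Ω → A} (hu : Measurable u₀)
    (hπ : Measurable π) {νA : Measure A} {v₀ : A → ℝ} (hv : Measurable v₀)
    (hmap : (ν.withDensity fun ω => ENNReal.ofReal (u₀ ω ^ 2)).map π =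
      νA.withDensity fun a => ENNReal.ofReal (v₀ a ^ 2)) :
    ∀ᵐ ω ∂ν, v₀ (π ω) = 0 → u₀ ω = 0 := by
  have hS : MeasurableSet {a | v₀ a = 0} := hv (measurableSet_singleton 0)
  have hm : Measurable ({a | v₀ a = 0}.indicator (1 : A → ℝ≥0∞)) :=
    measurable_one.indicator hS
  have hmπ : Measurable fun ω => {a | v₀ a = 0}.indicator (1 : A → ℝ≥0∞) (π ω) := hm.comp hπ
  have h1 : ∫⁻ ω, ENNReal.ofReal (u₀ ω ^ 2) * {a | v₀ a = 0}.indicator 1 (π ω) ∂ν = 0 := by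
    rw [← lintegral_withDensity_sq hu hmπ]
    rw [← lintegral_map hm hπ, hmap, lintegral_withDensity_sq hv hm]
    refine (lintegral_congr fun a => ?_).trans lintegral_zero
    by_cases h : v₀ a = 0 <;> simp [h]
  rw [lintegral_eq_zero_iff (by fun_prop)] at h1
  filter_upwards [h1] with ω hω h0
  simpa [h0, sq_nonpos_iff] using hω

/-- If `Q` and another family on a quotient `A` are differentiable in quadratic mean, then so is
the family which keeps the conditional law of `Q` given the quotient map and has the other family
as its image in `A`, provided that the weights `ρ` are bounded. -/
theorem reweight [IsFiniteMeasure ν] (hQ : IsQMD ν Q u g) {π : Ω → A} (hπ : Measurable π)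
    {v : ℝ → A → ℝ} {gA : A → ℝ} (hA : IsQMD (ν.map π) (fun γ => (Q γ).map π) v gA)
    {α : ℝ → Measure A} {w : ℝ → A → ℝ} {a : A → ℝ} (hα : IsQMD (ν.map π) α w a)
    {ρ : ℝ → A → ℝ} {C : ℝ} (hρ : ∀ γ, Measurable (ρ γ)) (hρ0 : ∀ γ x, 0 ≤ ρ γ x)
    (hρC : ∀ γ x, ρ γ x ≤ C)
    (hαρ : ∀ γ, α γ = ((Q γ).map π).withDensity fun x => ENNReal.ofReal (ρ γ x)) :
    IsQMD ν (fun γ => (Q γ).withDensity fun ω => ENNReal.ofReal (ρ γ (π ω)))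
      (fun γ ω => √(ρ γ (π ω)) * u γ ω) (fun ω => g ω + a (π ω) - gA (π ω)) := by
  -- Both sides are root densities of the same measure, and densities with respect to a σ-finite
  -- measure are unique.
  have hw : ∀ γ, ∀ᵐ x ∂(ν.map π), w γ x = √(ρ γ x) * v γ x := by
    intro γ
    have h1 := hαρ γ
    rw [hα.density, hA.density, ← withDensity_mul _
      ((hA.measurable_root γ).pow_const 2).ennreal_ofReal (hρ γ).ennreal_ofReal,
      withDensity_eq_iff_of_sigmaFinite
          ((hα.measurable_root γ).pow_const 2).ennreal_ofReal.aemeasurable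
      (((hA.measurable_root γ).pow_const 2).ennreal_ofReal.mul (hρ γ).ennreal_ofReal).aemeasurable]
      at h1
    filter_upwards [h1] with x hx
    rw [Pi.mul_apply, ← ENNReal.ofReal_mul (sq_nonneg _), ENNReal.ofReal_eq_ofReal_iff
      (sq_nonneg _) (mul_nonneg (sq_nonneg _) (hρ0 γ x))] at hx
    rw [← Real.sqrt_sq (hα.nonneg γ x), hx, mul_comm, Real.sqrt_mul (hρ0 γ x),
      Real.sqrt_sq (hA.nonneg γ x)]
  have hmap0 : (ν.withDensity fun ω => ENNReal.ofReal (u 0 ω ^ 2)).map π =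
      (ν.map π).withDensity fun x => ENNReal.ofReal (v 0 x ^ 2) := by
    rw [← hQ.density, ← hA.density]
  have hzero := root_eq_zero_of_map_root_eq_zero (hQ.measurable_root 0) hπ
    (hA.measurable_root 0) hmap0
  have hσ : ∀ γ, Measurable fun x => √(ρ γ x) := fun γ => (hρ γ).sqrt
  have hσC : ∀ γ x, |√(ρ γ x)| ≤ √C := fun γ x => by
    rw [abs_of_nonneg (Real.sqrt_nonneg _)]
    exact Real.sqrt_le_sqrt (hρC γ x)
  -- No continuity of the weights in γ is assumed. It is recovered where v₀ ≠ 0, since there √ρ = w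
  -- / v and both roots converge almost everywhere along a subsequence.
  have hsub : ∀ s : ℕ → ℝ, Tendsto s atTop (𝓝[≠] 0) → ∃ k : ℕ → ℕ, Tendsto k atTop atTop ∧
      ∀ᵐ x ∂(ν.map π), v 0 x ≠ 0 →
        Tendsto (fun n => √(ρ (s (k n)) x)) atTop (𝓝 (√(ρ 0 x))) := by
    intro s hs
    obtain ⟨k, hk, hvk⟩ := exists_subseq_ae_tendsto
      (fun γ => (hA.measurable_root γ).aestronglyMeasurable)
      (hA.measurable_root 0).aestronglyMeasurable
      (hA.tendsto_root.mono_left nhdsWithin_le_nhds) s hs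
    obtain ⟨k', hk', hwk⟩ := exists_subseq_ae_tendsto
      (fun γ => (hα.measurable_root γ).aestronglyMeasurable)
      (hα.measurable_root 0).aestronglyMeasurable
      (hα.tendsto_root.mono_left nhdsWithin_le_nhds) _ (hs.comp hk.tendsto_atTop)
    refine ⟨k ∘ k', hk.tendsto_atTop.comp hk'.tendsto_atTop, ?_⟩
    filter_upwards [hvk, hwk, hw 0, ae_all_iff.2 fun n => hw (s (k (k' n)))] with x h1 h2 h3 h4 h0
    have h5 := h1.comp hk'.tendsto_atTop
    have h6 := h2.div h5 h0
    rw [h3, mul_div_assoc, div_self h0, mul_one] at h6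
    refine h6.congr' ?_
    filter_upwards [h5.eventually_ne h0] with n hn
    simp only [Function.comp, Pi.div_apply] at hn ⊢
    rw [h4, mul_div_assoc, div_self hn, mul_one]
  have hmeasd : ∀ γ, Measurable fun ω => (u γ ω - u 0 ω) / γ := fun γ =>
    ((hQ.measurable_root γ).sub (hQ.measurable_root 0)).div_const γ
  have hmeasv : ∀ γ, Measurable fun x => (v γ x - v 0 x) / γ := fun γ =>
    ((hA.measurable_root γ).sub (hA.measurable_root 0)).div_const γ
  have hmeasw : ∀ γ, Measurable fun x => (w γ x - w 0 x) / γ := fun γ =>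
    ((hα.measurable_root γ).sub (hα.measurable_root 0)).div_const γ
  have T1 : Tendsto (fun γ : ℝ => eLpNorm (fun ω => √(ρ γ (π ω)) * ((u γ ω - u 0 ω) / γ) -
      √(ρ 0 (π ω)) * (g ω / 2 * u 0 ω)) 2 ν) (𝓝[≠] 0) (𝓝 0) := by
    refine tendsto_eLpNorm_two_mul_of_bounded (fun γ => (hmeasd γ).aestronglyMeasurable)
      hQ.deriv_memLp (fun γ => ((hσ γ).comp hπ).aestronglyMeasurable)
      ((hσ 0).comp hπ).aestronglyMeasurable
      (fun γ => ae_of_all _ fun ω => hσC γ (π ω)) (ae_of_all _ fun ω => hσC 0 (π ω))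
      hQ.tendsto fun s hs => ?_
    obtain ⟨k, hk, hlim⟩ := hsub s hs
    refine ⟨k, hk, ?_⟩
    filter_upwards [ae_of_ae_map hπ.aemeasurable hlim, hzero] with ω h1 h2 h3
    refine h1 fun h0 => h3 ?_
    rw [h2 h0, mul_zero]
  have T2 : Tendsto (fun γ : ℝ => eLpNorm (fun x => √(ρ γ x) * ((v γ x - v 0 x) / γ) -
      √(ρ 0 x) * (gA x / 2 * v 0 x)) 2 (ν.map π)) (𝓝[≠] 0) (𝓝 0) := by
    refine tendsto_eLpNorm_two_mul_of_bounded (fun γ => (hmeasv γ).aestronglyMeasurable)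
      hA.deriv_memLp (fun γ => (hσ γ).aestronglyMeasurable) (hσ 0).aestronglyMeasurable
      (fun γ => ae_of_all _ fun ω => hσC γ ω) (ae_of_all _ fun ω => hσC 0 ω)
      hA.tendsto fun s hs => ?_
    obtain ⟨k, hk, hlim⟩ := hsub s hs
    refine ⟨k, hk, ?_⟩
    filter_upwards [hlim] with x h1 h3
    refine h1 fun h0 => h3 ?_
    rw [h0, mul_zero]
  have hgA := hA.measurable_score
  have ha := hα.measurable_score
  have hmF2 : ∀ γ : ℝ, Measurable fun x => (w γ x - w 0 x) / γ - a x / 2 * w 0 x := fun γ =>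
    (hmeasw γ).sub ((ha.div_const 2).mul (hα.measurable_root 0))
  have hmF3 : ∀ γ : ℝ, Measurable fun x => √(ρ γ x) * ((v γ x - v 0 x) / γ) -
      √(ρ 0 x) * (gA x / 2 * v 0 x) := fun γ =>
    ((hσ γ).mul (hmeasv γ)).sub ((hσ 0).mul ((hgA.div_const 2).mul (hA.measurable_root 0)))
  have hratio : Measurable fun ω => u 0 ω / v 0 (π ω) :=
    (hQ.measurable_root 0).div ((hA.measurable_root 0).comp hπ)
  refine ⟨fun γ => ?_, fun γ => ((hσ γ).comp hπ).mul (hQ.measurable_root γ),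
    fun γ ω => mul_nonneg (Real.sqrt_nonneg _) (hQ.nonneg γ ω), fun γ => ?_,
    (hQ.measurable_score.add (ha.comp hπ)).sub (hgA.comp hπ), ?_, ?_⟩
  · have := hQ.finite γ
    refine isFiniteMeasure_withDensity_ofReal ?_
    refine (HasFiniteIntegral.of_bounded (C := C) (ae_of_all _ fun ω => ?_))
    rw [Real.norm_eq_abs, abs_of_nonneg (hρ0 _ _)]
    exact hρC _ _
  · have hρπ : Measurable fun ω => ρ γ (π ω) := (hρ γ).comp hπ
    rw [hQ.density, ← withDensity_mul _ ((hQ.measurable_root γ).pow_const 2).ennreal_ofReal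
      hρπ.ennreal_ofReal]
    congr 1
    ext ω
    rw [Pi.mul_apply, ← ENNReal.ofReal_mul (sq_nonneg _), mul_pow, Real.sq_sqrt (hρ0 _ _),
      mul_comm]
  · have hle : ∀ f : Ω → ℝ, MemLp f 2 (Q 0) →
        MemLp f 2 ((Q 0).withDensity fun ω => ENNReal.ofReal (ρ 0 (π ω))) := by
      intro f hf
      refine hf.of_measure_le_smul (c := ENNReal.ofReal C) ENNReal.ofReal_ne_top ?_
      rw [← withDensity_const]
      exact withDensity_mono (ae_of_all _ fun ω => ENNReal.ofReal_le_ofReal (hρC _ _))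
    refine ((hle _ hQ.score_memLp).add ?_).sub (hle _ ?_)
    · have h1 := hα.score_memLp
      have h2 : α 0 = ((Q 0).withDensity fun ω => ENNReal.ofReal (ρ 0 (π ω))).map π := by
        rw [hαρ]
        ext s hs
        rw [withDensity_apply _ hs, Measure.map_apply hπ hs, withDensity_apply _ (hπ hs),
          setLIntegral_map hs (hρ 0).ennreal_ofReal hπ]
      rw [h2] at h1
      exact h1.comp_of_map hπ.aemeasurable
    · exact hA.score_memLp.comp_of_map hπ.aemeasurable
  · have hsum := (T1.add hα.tendsto).add T2
    rw [add_zero, add_zero] at hsum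
    refine tendsto_of_tendsto_of_tendsto_of_le_of_le tendsto_const_nhds hsum
      (fun _ => zero_le) fun γ => ?_
    have B2 := eLpNorm_ratio_mul_comp_le (hQ.measurable_root 0) hπ (hA.measurable_root 0) hmap0
      (hmF2 γ)
    have B3 := eLpNorm_ratio_mul_comp_le (hQ.measurable_root 0) hπ (hA.measurable_root 0) hmap0
      (hmF3 γ)
    refine le_trans ?_ (add_le_add (add_le_add_right B2 _) B3)
    have m1 : AEStronglyMeasurable (fun ω => √(ρ γ (π ω)) * ((u γ ω - u 0 ω) / γ) -
        √(ρ 0 (π ω)) * (g ω / 2 * u 0 ω)) ν :=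
      ((((hσ γ).comp hπ).mul (hmeasd γ)).sub (((hσ 0).comp hπ).mul
        ((hQ.measurable_score.div_const 2).mul (hQ.measurable_root 0)))).aestronglyMeasurable
    have m2 := (hratio.mul ((hmF2 γ).comp hπ)).aestronglyMeasurable (μ := ν)
    have m3 := (hratio.mul ((hmF3 γ).comp hπ)).aestronglyMeasurable (μ := ν)
    -- The quotient (√ρ_γ - √ρ_0)/γ, which is not controlled on its own, is eliminated: with w = √ρ
    -- v, u₀ times this quotient is (u₀/v₀) times the difference quotient of w minus √ρ_γ times that
    -- of v. The remainder thus splits into the one of T1, plus the transported remainder of w,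
    -- minus the transported one of T2.
    refine le_trans (le_of_eq ?_) ((eLpNorm_sub_le (m1.add m2) m3 one_le_two).trans
      (add_le_add_left (eLpNorm_add_le m1 m2 one_le_two) _))
    refine eLpNorm_congr_ae ?_
    filter_upwards [hzero, ae_of_ae_map hπ.aemeasurable (hw 0),
      ae_of_ae_map hπ.aemeasurable (hw γ)] with ω h0 hw0 hwγ
    simp only [Pi.sub_apply, Pi.add_apply, Pi.mul_apply, Function.comp, hw0, hwγ]
    by_cases hv0 : v 0 (π ω) = 0
    · simp [hv0, h0 hv0]; ring
    · field_simp
      ring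
end IsQMD

end SurrogateATE

/-! ### Norms on the fibres of a disintegration -/

namespace SurrogateATE

section FibreNorm

/-- First-order expansion of a Hilbert space norm at u₀, in scalars: V₀ and V₁ are the norms of u₀
and u₁, D that of u₁ - u₀, I and J the inner products of u₀ with u₁ - u₀ and with the derivative d,
E' the norm of d and e that of the remainder. The curvature error is bounded by a multiple of D and
of D²/V₀; taking the smaller keeps the factor min(1, D/V₀) bounded where V₀ is small. If V₀ = 0,
then E' = 0 and the error is at most e. -/
theorem abs_norm_sub_div_sub_le {V₀ V₁ D E E' e I J γ : ℝ} (hV₀ : 0 ≤ V₀) (hV₁ : 0 ≤ V₁)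
    (hD : 0 ≤ D) (he : 0 ≤ e) (hγ : γ ≠ 0)
    (hexp : V₁ ^ 2 = V₀ ^ 2 + 2 * I + D ^ 2) (hI : I ^ 2 ≤ V₀ ^ 2 * D ^ 2) (hDE : D = |γ| * E)
    (hE : E ≤ E' + e) (hJ : (I / γ - J) ^ 2 ≤ V₀ ^ 2 * e ^ 2) (hV0 : V₀ = 0 → E' = 0) :
    |(V₁ - V₀) / γ - J / V₀| ≤ 3 * e + 2 * (min 1 (D / V₀) * E') := by
  have hγ' : 0 < |γ| := abs_pos.2 hγ
  have hEE : E = D / |γ| := by rw [hDE]; field_simp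
  rcases hV₀.eq_or_lt with h0 | h0
  · subst h0
    have hI0 : I = 0 := by
      have : I ^ 2 ≤ 0 := by simpa using hI
      exact pow_eq_zero_iff two_ne_zero |>.1 (le_antisymm this (sq_nonneg _))
    have hVD : V₁ = D := by
      have : V₁ ^ 2 = D ^ 2 := by rw [hexp, hI0]; ring
      exact (pow_left_inj₀ hV₁ hD two_ne_zero).1 this
    rw [hV0 rfl, div_zero, sub_zero, sub_zero, abs_div, hVD, abs_of_nonneg hD, ← hEE, mul_zero,
      mul_zero, add_zero]
    rw [hV0 rfl] at hE
    linarith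
  · have hIabs : |I| ≤ V₀ * D := by
      refine abs_le_of_sq_le_sq (by rwa [mul_pow]) (mul_nonneg hV₀ hD)
    have hJabs : |I / γ - J| ≤ V₀ * e :=
      abs_le_of_sq_le_sq (by rwa [mul_pow]) (mul_nonneg hV₀ he)
    have hVV : |V₁ - V₀| ≤ D := by
      refine abs_le_of_sq_le_sq ?_ hD
      have hsub : V₁ ≥ V₀ - D ∧ V₀ + D ≥ V₁ := by
        have := abs_le.1 hIabs
        constructor <;> nlinarith
      rcases le_total D V₀ with hDV | hDV <;> nlinarith
    set X := V₁ - V₀ - I / V₀ with hX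
    -- Polarisation: `hexp` expresses I through the three norms, and |V₁ - V₀| ≤ D then gives |X| V₀
    -- ≤ D².
    have hXV : X * V₀ = (D ^ 2 - (V₁ - V₀) ^ 2) / 2 := by
      rw [hX, sub_mul, div_mul_cancel₀ _ h0.ne']
      linarith
    have hX1 : |X| ≤ 2 * D := by
      have : |I / V₀| ≤ D := by
        rw [abs_div, abs_of_pos h0, div_le_iff₀ h0]
        linarith
      exact (abs_sub _ _).trans (by linarith)
    have hX2 : |X| ≤ 2 * (D * (D / V₀)) := by
      have h2 : |X| * V₀ ≤ D ^ 2 := by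
        have h1 : |X| * V₀ = |X * V₀| := by rw [abs_mul, abs_of_pos h0]
        rw [h1, hXV, abs_le]
        have := sq_le_sq.2 (hVV.trans (le_abs_self D))
        constructor <;> nlinarith [sq_nonneg D, sq_nonneg (V₁ - V₀)]
      have h3 : |X| ≤ D ^ 2 / V₀ := (le_div_iff₀ h0).2 h2
      have h4 : D ^ 2 / V₀ = D * (D / V₀) := by ring
      rw [h4] at h3
      have : 0 ≤ D * (D / V₀) := by positivity
      linarith
    have hX3 : |X| ≤ 2 * (D * min 1 (D / V₀)) := by
      rcases min_cases 1 (D / V₀) with ⟨h, -⟩ | ⟨h, -⟩ <;> rw [h]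
      · linarith
      · exact hX2
    have hmin0 : 0 ≤ min 1 (D / V₀) := le_min zero_le_one (by positivity)
    have hmin1 : min 1 (D / V₀) ≤ 1 := min_le_left _ _
    have hX4 : |X / γ| ≤ 2 * (E * min 1 (D / V₀)) := by
      rw [abs_div, div_le_iff₀ hγ']
      calc |X| ≤ _ := hX3
        _ = _ := by rw [hDE]; ring
    have hX5 : |(I / γ - J) / V₀| ≤ e := by
      rw [abs_div, abs_of_pos h0, div_le_iff₀ h0]
      linarith
    have hsum : (V₁ - V₀) / γ - J / V₀ = X / γ + (I / γ - J) / V₀ := by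
      rw [hX]; field_simp; ring
    rw [hsum]
    have h6 : E * min 1 (D / V₀) ≤ min 1 (D / V₀) * E' + e := by
      calc E * min 1 (D / V₀) ≤ (E' + e) * min 1 (D / V₀) := mul_le_mul_of_nonneg_right hE hmin0
        _ = min 1 (D / V₀) * E' + min 1 (D / V₀) * e := by ring
        _ ≤ _ := by nlinarith
    have h7 := abs_add_le (X / γ) ((I / γ - J) / V₀)
    linarith

variable {Ω A : Type*} [MeasurableSpace Ω] [MeasurableSpace A]

/-- The `L²` norm with respect to the measures `κ a`. -/
noncomputable def fibreNorm (κ : Kernel A Ω) (f : Ω → ℝ) (a : A) : ℝ := √(∫ ω, f ω ^ 2 ∂(κ a))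

variable {κ : Kernel A Ω}

theorem fibreNorm_nonneg (f : Ω → ℝ) (a : A) : 0 ≤ fibreNorm κ f a := Real.sqrt_nonneg _

theorem fibreNorm_sq (f : Ω → ℝ) (a : A) : fibreNorm κ f a ^ 2 = ∫ ω, f ω ^ 2 ∂(κ a) :=
  Real.sq_sqrt (integral_nonneg fun _ => sq_nonneg _)

theorem measurable_integral_kernel [IsSFiniteKernel κ] {f : Ω → ℝ} (hf : Measurable f) :
    Measurable fun a => ∫ ω, f ω ∂(κ a) :=
  (StronglyMeasurable.integral_kernel hf.stronglyMeasurable).measurable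

theorem measurable_fibreNorm [IsSFiniteKernel κ] {f : Ω → ℝ} (hf : Measurable f) :
    Measurable (fibreNorm κ f) :=
  (measurable_integral_kernel (hf.pow_const 2)).sqrt

theorem fibreNorm_eq_eLpNorm {f : Ω → ℝ} (hf : Measurable f) (a : A) :
    fibreNorm κ f a = (eLpNorm f 2 (κ a)).toReal := by
  rw [fibreNorm, ← toReal_eLpNorm_two_sq hf.aestronglyMeasurable,
      Real.sqrt_sq ENNReal.toReal_nonneg]

theorem abs_fibreNorm_sub_div_sub_le {u₀ u₁ d : Ω → ℝ} (hu₀ : Measurable u₀) (hu₁ : Measurable u₁)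
    (hd : Measurable d) {a : A} (h₀ : MemLp u₀ 2 (κ a)) (h₁ : MemLp u₁ 2 (κ a))
    (hdL : MemLp d 2 (κ a)) (hd0 : fibreNorm κ u₀ a = 0 → fibreNorm κ d a = 0) {γ : ℝ}
    (hγ : γ ≠ 0) :
    |(fibreNorm κ u₁ a - fibreNorm κ u₀ a) / γ - (∫ ω, u₀ ω * d ω ∂(κ a)) / fibreNorm κ u₀ a| ≤
      3 * fibreNorm κ (fun ω => (u₁ ω - u₀ ω) / γ - d ω) a +
        2 * (min 1 (fibreNorm κ (fun ω => u₁ ω - u₀ ω) a / fibreNorm κ u₀ a) *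
          fibreNorm κ d a) := by
  have hs : MemLp (fun ω => u₁ ω - u₀ ω) 2 (κ a) := h₁.sub h₀
  have hq : MemLp (fun ω => (u₁ ω - u₀ ω) / γ) 2 (κ a) := by
    simpa [div_eq_mul_inv] using hs.mul_const γ⁻¹
  have hr : MemLp (fun ω => (u₁ ω - u₀ ω) / γ - d ω) 2 (κ a) := hq.sub hdL
  refine abs_norm_sub_div_sub_le (I := ∫ ω, u₀ ω * (u₁ ω - u₀ ω) ∂(κ a))
    (E := fibreNorm κ (fun ω => (u₁ ω - u₀ ω) / γ) a) (fibreNorm_nonneg _ _) (fibreNorm_nonneg _ _)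
    (fibreNorm_nonneg _ _) (fibreNorm_nonneg _ _) hγ ?_ ?_ ?_ ?_ ?_ hd0
  · rw [fibreNorm_sq, fibreNorm_sq, fibreNorm_sq, ← integral_const_mul,
      ← integral_add h₀.integrable_sq ((integrable_mul_of_memLp_two h₀ hs).const_mul 2)]
    refine Eq.trans ?_ (integral_add (f := fun ω => u₀ ω ^ 2 + 2 * (u₀ ω * (u₁ ω - u₀ ω)))
      (h₀.integrable_sq.add ((integrable_mul_of_memLp_two h₀ hs).const_mul 2)) hs.integrable_sq)
    exact integral_congr_ae (ae_of_all _ fun ω => by ring)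
  · rw [fibreNorm_sq, fibreNorm_sq]
    exact sq_integral_mul_le h₀ hs
  · have : ∀ ω, (u₁ ω - u₀ ω) ^ 2 = γ ^ 2 * ((u₁ ω - u₀ ω) / γ) ^ 2 := fun ω => by field_simp
    rw [fibreNorm]
    simp_rw [this]
    rw [integral_const_mul, Real.sqrt_mul (sq_nonneg _), Real.sqrt_sq_eq_abs, fibreNorm]
  · have m1 : Measurable fun ω => (u₁ ω - u₀ ω) / γ := (hu₁.sub hu₀).div_const γ
    have m2 : Measurable fun ω => (u₁ ω - u₀ ω) / γ - d ω := m1.sub hd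
    rw [fibreNorm_eq_eLpNorm m1, fibreNorm_eq_eLpNorm hd, fibreNorm_eq_eLpNorm m2,
      ← ENNReal.toReal_add hdL.2.ne hr.2.ne]
    refine ENNReal.toReal_mono (ENNReal.add_ne_top.2 ⟨hdL.2.ne, hr.2.ne⟩) ?_
    refine le_trans (le_of_eq ?_) (eLpNorm_add_le hdL.1 hr.1 one_le_two)
    congr 1
    ext ω
    simp
  · have : (∫ ω, u₀ ω * (u₁ ω - u₀ ω) ∂(κ a)) / γ - ∫ ω, u₀ ω * d ω ∂(κ a) =
        ∫ ω, u₀ ω * ((u₁ ω - u₀ ω) / γ - d ω) ∂(κ a) := by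
      rw [← integral_div, ← integral_sub ((integrable_mul_of_memLp_two h₀ hs).div_const γ)
        (integrable_mul_of_memLp_two h₀ hdL)]
      exact integral_congr_ae (ae_of_all _ fun ω => by ring)
    rw [this, fibreNorm_sq, fibreNorm_sq]
    exact sq_integral_mul_le h₀ hr

end FibreNorm

section Disintegration

variable {Ω A : Type*} [MeasurableSpace Ω] [StandardBorelSpace Ω] [Nonempty Ω]
  [MeasurableSpace A] {ν : Measure Ω} [IsFiniteMeasure ν] {π : Ω → A}

theorem lintegral_eq_lintegral_condDistrib_id (hπ : Measurable π) {F : A × Ω → ℝ≥0∞}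
    (hF : Measurable F) :
    ∫⁻ ω, F (π ω, ω) ∂ν = ∫⁻ a, ∫⁻ ω, F (a, ω) ∂(condDistrib id π ν a) ∂(ν.map π) := by
  rw [← Measure.lintegral_compProd hF, compProd_map_condDistrib aemeasurable_id,
    lintegral_map hF (hπ.prodMk measurable_id)]
  rfl

theorem integral_eq_integral_condDistrib_id (hπ : Measurable π) {F : A × Ω → ℝ}
    (hF : Measurable F) (hi : Integrable (fun ω => F (π ω, ω)) ν) :
    ∫ ω, F (π ω, ω) ∂ν = ∫ a, ∫ ω, F (a, ω) ∂(condDistrib id π ν a) ∂(ν.map π) := by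
  have hmeas : Measurable fun ω => (π ω, ω) := hπ.prodMk measurable_id
  have e : ν.map π ⊗ₘ condDistrib id π ν = ν.map fun ω => (π ω, ω) :=
    compProd_map_condDistrib aemeasurable_id
  rw [← Measure.integral_compProd, e, integral_map hmeas.aemeasurable hF.aestronglyMeasurable]
  rw [e]
  exact (integrable_map_measure hF.aestronglyMeasurable hmeas.aemeasurable).2 hi

theorem ae_memLp_condDistrib_id (hπ : Measurable π) {f : Ω → ℝ} (hf : Measurable f)
    (hL : MemLp f 2 ν) : ∀ᵐ a ∂(ν.map π), MemLp f 2 (condDistrib id π ν a) := by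
  have h1 : ∫⁻ ω, ENNReal.ofReal (f ω ^ 2) ∂ν ≠ ∞ := by
    rw [← eLpNorm_two_sq]
    exact ENNReal.pow_ne_top hL.2.ne
  have hm : Measurable fun p : A × Ω => ENNReal.ofReal (f p.2 ^ 2) := by fun_prop
  rw [lintegral_eq_lintegral_condDistrib_id hπ hm] at h1
  filter_upwards [ae_lt_top hm.lintegral_kernel_prod_right' h1] with a ha
  exact memLp_two_of_lintegral_lt_top hf.aestronglyMeasurable ha

/-- By Tonelli, the L² norm is the L² norm of the fibre norms. L² convergence upstairs thus becomes
L² convergence of functions on the quotient. -/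
theorem eLpNorm_fibreNorm (hπ : Measurable π) {f : Ω → ℝ} (hf : Measurable f)
    (hL : MemLp f 2 ν) :
    eLpNorm (fibreNorm (condDistrib id π ν) f) 2 (ν.map π) = eLpNorm f 2 ν := by
  have hm : Measurable fun p : A × Ω => ENNReal.ofReal (f p.2 ^ 2) := by fun_prop
  refine (ENNReal.pow_right_strictMono two_ne_zero).injective ?_
  rw [eLpNorm_two_sq, eLpNorm_two_sq,
    lintegral_eq_lintegral_condDistrib_id hπ hm]
  refine lintegral_congr_ae ?_
  filter_upwards [ae_memLp_condDistrib_id hπ hf hL] with a ha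
  rw [fibreNorm_sq, ofReal_integral_eq_lintegral_ofReal ha.integrable_sq
    (ae_of_all _ fun _ => sq_nonneg _)]

theorem memLp_fibreNorm (hπ : Measurable π) {f : Ω → ℝ} (hf : Measurable f)
    (hL : MemLp f 2 ν) : MemLp (fibreNorm (condDistrib id π ν) f) 2 (ν.map π) :=
  ⟨(measurable_fibreNorm hf).aestronglyMeasurable, by rw [eLpNorm_fibreNorm hπ hf hL]; exact hL.2⟩

end Disintegration

end SurrogateATE

/-! ### Images of differentiable families -/

namespace SurrogateATE

namespace IsQMD

variable {Ω A : Type*} [MeasurableSpace Ω] [StandardBorelSpace Ω] [Nonempty Ω]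
  [MeasurableSpace A] {ν : Measure Ω} [IsFiniteMeasure ν]
  {μ : ℝ → Measure Ω} {u : ℝ → Ω → ℝ} {g : Ω → ℝ} {π : Ω → A}

/-- The image density is the fibre integral of u², so its root is the fibre norm of u. -/
theorem map_density (h : IsQMD ν μ u g) (hπ : Measurable π) (γ : ℝ) :
    (μ γ).map π = (ν.map π).withDensity fun a =>
      ENNReal.ofReal (fibreNorm (condDistrib id π ν) (u γ) a ^ 2) := by
  have hu := h.measurable_root γ
  ext s hs
  have hm : Measurable fun p : A × Ω =>
      s.indicator (1 : A → ℝ≥0∞) p.1 * ENNReal.ofReal (u γ p.2 ^ 2) :=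
    ((measurable_one.indicator hs).comp measurable_fst).mul
      (((hu.comp measurable_snd).pow_const 2).ennreal_ofReal)
  rw [Measure.map_apply hπ hs, h.density, withDensity_apply _ (hπ hs), withDensity_apply _ hs,
    ← lintegral_indicator (hπ hs), ← lintegral_indicator hs]
  have e1 := lintegral_eq_lintegral_condDistrib_id (ν := ν) hπ hm
  calc _ = _ := lintegral_congr fun ω => by
        by_cases hω : π ω ∈ s <;> simp [Set.indicator, hω]
    _ = _ := e1
    _ = _ := by
        refine lintegral_congr_ae ?_
        filter_upwards [ae_memLp_condDistrib_id hπ hu (h.root_memLp γ)] with a ha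
        by_cases has : a ∈ s
        · simp only [Set.indicator, has, if_true, Pi.one_apply, one_mul]
          rw [fibreNorm_sq, ofReal_integral_eq_lintegral_ofReal ha.integrable_sq
            (ae_of_all _ fun _ => sq_nonneg _)]
        · simp [Set.indicator, has]

/-- The image under a measurable map of a family which is differentiable in quadratic mean is
differentiable in quadratic mean, and its score is the conditional expectation of the score. -/
theorem map (h : IsQMD ν μ u g) (hπ : Measurable π) :
    ∃ (v : ℝ → A → ℝ) (gA : A → ℝ), IsQMD (ν.map π) (fun γ => (μ γ).map π) v gA ∧
      ∀ f : A → ℝ, Measurable f → MemLp f 2 ((μ 0).map π) →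
        ∫ a, f a * gA a ∂((μ 0).map π) = ∫ ω, f (π ω) * g ω ∂(μ 0) := by
  set κ := condDistrib id π ν with hκ
  set d : Ω → ℝ := fun ω => g ω / 2 * u 0 ω with hd
  have hu := h.measurable_root
  have hg := h.measurable_score
  have hdm : Measurable d := (hg.div_const 2).mul (hu 0)
  set V : ℝ → A → ℝ := fun γ => fibreNorm κ (u γ) with hV
  have hVm : ∀ γ, Measurable (V γ) := fun γ => measurable_fibreNorm (hu γ)
  set J : A → ℝ := fun a => ∫ ω, u 0 ω * d ω ∂(κ a) with hJ
  have hJm : Measurable J := measurable_integral_kernel ((hu 0).mul hdm)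
  -- This is the conditional expectation of g, because 2J is the fibre integral of g u₀² and V₀² is
  -- that of u₀². Where V₀ vanishes the quotient is 0, which is harmless since the image law does
  -- not charge that set.
  set gA : A → ℝ := fun a => 2 * J a / V 0 a ^ 2 with hgA
  have hgAm : Measurable gA := (hJm.const_mul 2).div ((hVm 0).pow_const 2)
  have hL0 := ae_memLp_condDistrib_id hπ (hu 0) (h.root_memLp 0)
  have hLd := ae_memLp_condDistrib_id hπ hdm h.deriv_memLp
  have hd0 : ∀ᵐ a ∂(ν.map π), V 0 a = 0 → fibreNorm κ d a = 0 := by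
    filter_upwards [hL0] with a ha h0
    have h1 : ∫ ω, u 0 ω ^ 2 ∂(κ a) = 0 := by
      rw [← fibreNorm_sq]
      change V 0 a ^ 2 = 0
      rw [h0, zero_pow two_ne_zero]
    rw [integral_eq_zero_iff_of_nonneg (fun _ => sq_nonneg _) ha.integrable_sq] at h1
    have h2 : ∫ ω, d ω ^ 2 ∂(κ a) = 0 := by
      refine integral_eq_zero_of_ae ?_
      filter_upwards [h1] with ω hω
      have : u 0 ω = 0 := by simpa using hω
      simp [hd, this]
    rw [fibreNorm, h2, Real.sqrt_zero]
  have hJle : ∀ᵐ a ∂(ν.map π), |J a| ≤ V 0 a * fibreNorm κ d a := by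
    filter_upwards [hL0, hLd] with a h1 h2
    refine abs_le_of_sq_le_sq ?_ (mul_nonneg (fibreNorm_nonneg _ _) (fibreNorm_nonneg _ _))
    rw [mul_pow, fibreNorm_sq, fibreNorm_sq]
    exact sq_integral_mul_le h1 h2
  have hdens : ∀ γ, (μ γ).map π = (ν.map π).withDensity fun a => ENNReal.ofReal (V γ a ^ 2) :=
    fun γ => h.map_density hπ γ
  refine ⟨V, gA, ⟨fun γ => ?_, hVm, fun γ a => fibreNorm_nonneg _ _, hdens, hgAm, ?_, ?_⟩, ?_⟩
  · have := h.finite γ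
    infer_instance
  · rw [hdens, memLp_two_withDensity_sq_iff (hVm 0) hgAm]
    refine ((memLp_fibreNorm hπ hdm h.deriv_memLp).const_mul 2).mono
      (hgAm.mul (hVm 0)).aestronglyMeasurable ?_
    filter_upwards [hJle] with a ha
    rw [Real.norm_eq_abs, Real.norm_eq_abs, abs_mul 2, abs_two,
      abs_of_nonneg (fibreNorm_nonneg _ _)]
    rcases (fibreNorm_nonneg (κ := κ) (u 0) a).eq_or_lt with h0 | h0
    · have h0' : V 0 a = 0 := h0.symm
      rw [h0', mul_zero, abs_zero]
      have := fibreNorm_nonneg (κ := κ) d a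
      positivity
    · have h0' : 0 < V 0 a := h0
      have e : gA a * V 0 a = 2 * (J a / V 0 a) := by simp only [hgA]; field_simp
      rw [e, abs_mul, abs_two, abs_div, abs_of_pos h0']
      refine mul_le_mul_of_nonneg_left ((div_le_iff₀ h0').2 ?_) zero_le_two
      linarith
  · have hcomp : ∀ a, gA a / 2 * V 0 a = J a / V 0 a := fun a => by
      simp only [hgA]
      by_cases h0 : V 0 a = 0
      · simp [h0]
      · field_simp
    have hrm : ∀ γ : ℝ, Measurable fun ω => (u γ ω - u 0 ω) / γ - d ω := fun γ =>
      (((hu γ).sub (hu 0)).div_const γ).sub hdm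
    have hrL : ∀ γ : ℝ, MemLp (fun ω => (u γ ω - u 0 ω) / γ - d ω) 2 ν := fun γ =>
      (h.quotient_memLp γ).sub h.deriv_memLp
    have hsm : ∀ γ : ℝ, Measurable fun ω => u γ ω - u 0 ω := fun γ => (hu γ).sub (hu 0)
    have hsL : ∀ γ : ℝ, MemLp (fun ω => u γ ω - u 0 ω) 2 ν := fun γ =>
      (h.root_memLp γ).sub (h.root_memLp 0)
    set D : ℝ → A → ℝ := fun γ => fibreNorm κ fun ω => u γ ω - u 0 ω with hD
    have hDm : ∀ γ, Measurable (D γ) := fun γ => measurable_fibreNorm (hsm γ)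
    have hbm : ∀ γ, Measurable fun a => min 1 (D γ a / V 0 a) := fun γ =>
      measurable_const.min ((hDm γ).div (hVm 0))
    have hb0 : ∀ γ a, 0 ≤ min 1 (D γ a / V 0 a) := fun γ a =>
      le_min zero_le_one (div_nonneg (fibreNorm_nonneg _ _) (fibreNorm_nonneg _ _))
    have T1 : Tendsto (fun γ : ℝ => ENNReal.ofReal 3 *
        eLpNorm (fibreNorm κ fun ω => (u γ ω - u 0 ω) / γ - d ω) 2 (ν.map π)) (𝓝[≠] 0) (𝓝 0) := by
      have : Tendsto (fun γ : ℝ => eLpNorm (fibreNorm κ fun ω => (u γ ω - u 0 ω) / γ - d ω) 2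
          (ν.map π)) (𝓝[≠] 0) (𝓝 0) :=
        h.tendsto.congr fun γ => (eLpNorm_fibreNorm hπ (hrm γ) (hrL γ)).symm
      have := ENNReal.Tendsto.const_mul (a := ENNReal.ofReal 3) this (Or.inr ENNReal.ofReal_ne_top)
      rwa [mul_zero] at this
    -- The curvature term: the factor min(1, D/V₀) is bounded by 1 and tends to zero along
    -- subsequences, because D tends to zero in L², while the fibre norm of d is a fixed L²
    -- function.
    have T2 : Tendsto (fun γ : ℝ => ENNReal.ofReal 2 * eLpNorm
        (fun a => min 1 (D γ a / V 0 a) * fibreNorm κ d a - 0 * fibreNorm κ d a) 2 (ν.map π))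
        (𝓝[≠] 0) (𝓝 0) := by
      have : Tendsto (fun γ : ℝ => eLpNorm
          (fun a => min 1 (D γ a / V 0 a) * fibreNorm κ d a - 0 * fibreNorm κ d a) 2 (ν.map π))
          (𝓝[≠] 0) (𝓝 0) := by
        refine tendsto_eLpNorm_two_mul_of_bounded (C := 1) (b₀ := fun _ => 0)
          (f := fun _ => fibreNorm κ d)
          (fun γ => (measurable_fibreNorm hdm).aestronglyMeasurable)
          (memLp_fibreNorm hπ hdm h.deriv_memLp) (fun γ => (hbm γ).aestronglyMeasurable)
          aestronglyMeasurable_const (fun γ => ae_of_all _ fun a => ?_)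
          (ae_of_all _ fun a => by simp) (by simp) fun s hs => ?_
        · rw [abs_of_nonneg (hb0 γ a)]
          exact min_le_left _ _
        · have hD0 : Tendsto (fun γ => eLpNorm (fun a => D γ a - 0) 2 (ν.map π)) (𝓝[≠] 0)
            (𝓝 0) := by
            simp only [sub_zero]
            refine (h.tendsto_root.mono_left nhdsWithin_le_nhds).congr fun γ => ?_
            exact (eLpNorm_fibreNorm hπ (hsm γ) (hsL γ)).symm
          obtain ⟨k, hk, hlim⟩ := exists_subseq_ae_tendsto (f₀ := fun _ => 0)
            (fun γ => (hDm γ).aestronglyMeasurable) aestronglyMeasurable_const hD0 s hs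
          refine ⟨k, hk.tendsto_atTop, ?_⟩
          filter_upwards [hlim] with a ha _
          have := (tendsto_const_nhds (x := (1 : ℝ))).min (ha.div_const (V 0 a))
          simpa using this
      have := ENNReal.Tendsto.const_mul (a := ENNReal.ofReal 2) this (Or.inr ENNReal.ofReal_ne_top)
      rwa [mul_zero] at this
    have T12 := T1.add T2
    rw [add_zero] at T12
    refine tendsto_of_tendsto_of_tendsto_of_le_of_le' tendsto_const_nhds T12
      (Eventually.of_forall fun _ => zero_le) ?_
    filter_upwards [self_mem_nhdsWithin] with γ hγ
    have hγ0 : γ ≠ 0 := hγ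
    have b1 : eLpNorm (fun a => 3 * fibreNorm κ (fun ω => (u γ ω - u 0 ω) / γ - d ω) a) 2
        (ν.map π) ≤ ENNReal.ofReal 3 *
        eLpNorm (fibreNorm κ fun ω => (u γ ω - u 0 ω) / γ - d ω) 2 (ν.map π) :=
      eLpNorm_le_mul_eLpNorm_of_ae_le_mul (ae_of_all _ fun a => by
        rw [norm_mul, Real.norm_eq_abs, abs_of_pos (by norm_num : (0 : ℝ) < 3)]) 2
    have b2 : eLpNorm (fun a => 2 * (min 1 (D γ a / V 0 a) * fibreNorm κ d a)) 2
        (ν.map π) ≤ ENNReal.ofReal 2 * eLpNorm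
        (fun a => min 1 (D γ a / V 0 a) * fibreNorm κ d a - 0 * fibreNorm κ d a) 2 (ν.map π) :=
      eLpNorm_le_mul_eLpNorm_of_ae_le_mul (ae_of_all _ fun a => by
        rw [norm_mul, Real.norm_eq_abs, abs_two, zero_mul, sub_zero]) 2
    refine le_trans ?_ (add_le_add b1 b2)
    refine le_trans ?_ (eLpNorm_add_le
      ((measurable_fibreNorm (hrm γ)).const_mul 3).aestronglyMeasurable
      (((hbm γ).mul (measurable_fibreNorm hdm)).const_mul 2).aestronglyMeasurable one_le_two)
    refine eLpNorm_mono_ae ?_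
    filter_upwards [hL0, hLd, hd0, ae_memLp_condDistrib_id hπ (hu γ) (h.root_memLp γ)]
      with a h1 h2 h3 h4
    rw [hcomp]
    refine (abs_fibreNorm_sub_div_sub_le (hu 0) (hu γ) hdm h1 h4 h2 h3 hγ0).trans ?_
    exact le_abs_self _
  · intro f hf hfL
    have hfu : MemLp (fun ω => f (π ω) * u 0 ω) 2 ν := by
      have h1 : MemLp (fun ω => f (π ω)) 2 (μ 0) := hfL.comp_of_map hπ.aemeasurable
      have hfπ : Measurable fun ω => f (π ω) := hf.comp hπ
      rwa [h.density, memLp_two_withDensity_sq_iff (hu 0) hfπ] at h1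
    have hi := integrable_mul_of_memLp_two hfu h.score_mul_root_memLp
    have hF : Measurable fun p : A × Ω => f p.1 * u 0 p.2 * (g p.2 * u 0 p.2) := by fun_prop
    rw [hdens 0, integral_withDensity_sq (hVm 0), h.density 0, integral_withDensity_sq (hu 0)]
    have e1 := integral_eq_integral_condDistrib_id hπ hF hi
    refine Eq.trans ?_ (e1.symm.trans (integral_congr_ae (ae_of_all _ fun ω => by ring)))
    refine integral_congr_ae ?_
    filter_upwards [hJle, hL0, hd0] with a h1 h2 h3
    have e2 : ∫ ω, f a * u 0 ω * (g ω * u 0 ω) ∂(κ a) = f a * (2 * J a) := by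
      simp only [hJ]
      rw [← integral_const_mul, ← integral_const_mul]
      exact integral_congr_ae (ae_of_all _ fun ω => by simp only [hd]; ring)
    change V 0 a ^ 2 * (f a * gA a) = ∫ ω, f a * u 0 ω * (g ω * u 0 ω) ∂(κ a)
    rw [e2]
    simp only [hgA]
    by_cases h0 : V 0 a = 0
    · rw [h0, zero_mul] at h1
      have : J a = 0 := abs_eq_zero.1 (le_antisymm h1 (abs_nonneg _))
      simp [h0, this]
    · field_simp

end IsQMD

end SurrogateATE

/-! ### Success probabilities and conditional independence -/

namespace SurrogateATE

section Bernoulli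

variable {Ω A C : Type*} [MeasurableSpace Ω] [MeasurableSpace A] [MeasurableSpace C]

theorem map_withDensity_comp {μ : Measure Ω} {φ : Ω → A} (hφ : Measurable φ) {f : A → ℝ≥0∞}
    (hf : Measurable f) :
    (μ.withDensity fun ω => f (φ ω)).map φ = (μ.map φ).withDensity f := by
  ext s hs
  rw [withDensity_apply _ hs, Measure.map_apply hφ hs, withDensity_apply _ (hφ hs),
    setLIntegral_map hs hf hφ]

/-- Given `φ`, the binary variable `b` has success probability `q φ`. -/
def IsSuccessProbability (μ : Measure Ω) (b : Ω → Bool) (φ : Ω → A) (q : A → ℝ) : Prop :=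
  (μ.restrict {ω | b ω = true}).map φ = (μ.map φ).withDensity fun a => ENNReal.ofReal (q a)

theorem ind_nonneg (b : Bool) : 0 ≤ ind b := by cases b <;> simp [ind]

theorem ind_le_one (b : Bool) : ind b ≤ 1 := by cases b <;> simp [ind]

theorem measurable_ind : Measurable ind := measurable_of_finite _

theorem integrable_ind {μ : Measure Ω} [IsFiniteMeasure μ] {b : Ω → Bool} (hb : Measurable b) :
    Integrable (fun ω => ind (b ω)) μ :=
  Integrable.of_bound (measurable_ind.comp hb).aestronglyMeasurable 1 (ae_of_all _ fun ω => by
    rw [Real.norm_eq_abs, abs_of_nonneg (ind_nonneg _)]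
    exact ind_le_one _)

theorem measurableSet_eq_true {b : Ω → Bool} (hb : Measurable b) :
    MeasurableSet {ω | b ω = true} := hb (measurableSet_singleton true)

theorem setIntegral_ind {μ : Measure Ω} {b : Ω → Bool} (hb : Measurable b) (s : Set Ω) :
    ∫ ω in s, ind (b ω) ∂μ = (μ.restrict {ω | b ω = true}).real s := by
  have : (fun ω => ind (b ω)) = {ω | b ω = true}.indicator (fun _ => (1 : ℝ)) := by
    ext ω
    cases h : b ω <;> simp [ind, h]
  rw [this, setIntegral_indicator (measurableSet_eq_true hb), setIntegral_const, smul_eq_mul,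
    mul_one, measureReal_restrict_apply' (measurableSet_eq_true hb)]

theorem measure_eq_iff_setIntegral_ind {μ : Measure Ω} [IsFiniteMeasure μ] {b : Ω → Bool}
    (hb : Measurable b) {φ : Ω → A} (hφ : Measurable φ) {q : A → ℝ} (hq : Measurable q)
    (hq0 : ∀ a, 0 ≤ q a) (hq1 : ∀ a, q a ≤ 1) {s : Set A} (hs : MeasurableSet s) :
    (μ.restrict {ω | b ω = true}).map φ s =
        ((μ.map φ).withDensity fun a => ENNReal.ofReal (q a)) s ↔
      ∫ ω in φ ⁻¹' s, ind (b ω) ∂μ = ∫ ω in φ ⁻¹' s, q (φ ω) ∂μ := by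
  have hqφ : Measurable fun ω => q (φ ω) := hq.comp hφ
  have hi : Integrable (fun ω => q (φ ω)) μ :=
    Integrable.of_bound hqφ.aestronglyMeasurable 1 (ae_of_all _ fun ω => by
      rw [Real.norm_eq_abs, abs_of_nonneg (hq0 _)]
      exact hq1 _)
  rw [setIntegral_ind hb, Measure.map_apply hφ hs, withDensity_apply _ hs,
    setLIntegral_map hs hq.ennreal_ofReal hφ, ← ofReal_integral_eq_lintegral_ofReal
      hi.integrableOn (ae_of_all _ fun ω => hq0 _), measureReal_def,
    ← ENNReal.toReal_eq_toReal_iff' (measure_ne_top _ _) ENNReal.ofReal_ne_top,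
    ENNReal.toReal_ofReal (integral_nonneg fun ω => hq0 _)]

theorem isSuccessProbability_iff_setIntegral {μ : Measure Ω} [IsFiniteMeasure μ] {b : Ω → Bool}
    (hb : Measurable b) {φ : Ω → A} (hφ : Measurable φ) {q : A → ℝ} (hq : Measurable q)
    (hq0 : ∀ a, 0 ≤ q a) (hq1 : ∀ a, q a ≤ 1) :
    IsSuccessProbability μ b φ q ↔
      ∀ s, MeasurableSet s → ∫ ω in φ ⁻¹' s, ind (b ω) ∂μ = ∫ ω in φ ⁻¹' s, q (φ ω) ∂μ := by
  refine ⟨fun h s hs => ?_, fun h => Measure.ext fun s hs => ?_⟩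
  · rw [← measure_eq_iff_setIntegral_ind hb hφ hq hq0 hq1 hs, h]
  · rw [measure_eq_iff_setIntegral_ind hb hφ hq hq0 hq1 hs, h s hs]

/-- Passes between conditional expectations and identities of measures. The latter can be pushed
forward, restricted and reweighted directly, so later arguments work with them. -/
theorem isSuccessProbability_iff_condExp {μ : Measure Ω} [IsFiniteMeasure μ] {b : Ω → Bool}
    (hb : Measurable b) {φ : Ω → A} (hφ : Measurable φ) {q : A → ℝ} (hq : Measurable q)
    (hq0 : ∀ a, 0 ≤ q a) (hq1 : ∀ a, q a ≤ 1) :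
    IsSuccessProbability μ b φ q ↔
      μ[fun ω => ind (b ω) | MeasurableSpace.comap φ inferInstance] =ᵐ[μ] fun ω => q (φ ω) := by
  rw [isSuccessProbability_iff_setIntegral hb hφ hq hq0 hq1]
  have hqφ : Measurable fun ω => q (φ ω) := hq.comp hφ
  have hi : Integrable (fun ω => q (φ ω)) μ :=
    Integrable.of_bound hqφ.aestronglyMeasurable 1 (ae_of_all _ fun ω => by
      rw [Real.norm_eq_abs, abs_of_nonneg (hq0 _)]
      exact hq1 _)
  constructor
  · intro h
    refine (ae_eq_condExp_of_forall_setIntegral_eq hφ.comap_le (integrable_ind hb)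
      (fun _ _ _ => hi.integrableOn) ?_ ?_).symm
    · rintro _ ⟨s, hs, rfl⟩ -
      exact (h s hs).symm
    · exact (hq.comp (comap_measurable φ)).aestronglyMeasurable
  · intro h s hs
    rw [← setIntegral_condExp hφ.comap_le (integrable_ind hb) ⟨s, hs, rfl⟩]
    exact setIntegral_congr_ae (hφ hs) (h.mono fun ω hω _ => hω)

theorem condExp_indicator_mul {μ : Measure Ω} [IsFiniteMeasure μ] {f : Ω → A} (hf : Measurable f)
    {p : A → ℝ} (hp : Measurable p) (hp0 : ∀ a, 0 ≤ p a) (hp1 : ∀ a, p a ≤ 1) {h : Ω → ℝ}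
    (hh : Integrable h μ) :
    μ[fun ω => p (f ω) * h ω | MeasurableSpace.comap f inferInstance] =ᵐ[μ] fun ω => p (f ω) *
        (μ[h | MeasurableSpace.comap f inferInstance]) ω :=
  condExp_stronglyMeasurable_mul_of_bound hf.comap_le
    (hp.comp (comap_measurable f)).stronglyMeasurable hh 1 (ae_of_all _ fun ω => by
      rw [Real.norm_eq_abs, abs_of_nonneg (hp0 _)]
      exact hp1 _)

/-- A binary variable is conditionally independent of `g` given `f` if and only if its success
probability given `(f, g)` is its success probability given `f`. -/
theorem condIndepFun_iff_isSuccessProbability [StandardBorelSpace Ω] {μ : Measure Ω}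
    [IsFiniteMeasure μ] {b : Ω → Bool} (hb : Measurable b) {f : Ω → A} (hf : Measurable f)
    {g : Ω → C} (hg : Measurable g) {p : A → ℝ} (hp : Measurable p) (hp0 : ∀ a, 0 ≤ p a)
    (hp1 : ∀ a, p a ≤ 1) (hbf : IsSuccessProbability μ b f p) :
    CondIndepFun (MeasurableSpace.comap f inferInstance) hf.comap_le g b μ ↔
      IsSuccessProbability μ b (fun ω => (f ω, g ω)) fun x => p x.1 := by
  have hfg : Measurable fun ω => (f ω, g ω) := hf.prodMk hg
  have hpf : Measurable fun ω => p (f ω) := hp.comp hf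
  have hpi : ∀ s, MeasurableSet s → Integrable (s.indicator fun ω => p (f ω)) μ := fun s hs =>
    (Integrable.of_bound hpf.aestronglyMeasurable 1 (ae_of_all _ fun ω => by
      rw [Real.norm_eq_abs, abs_of_nonneg (hp0 _)]
      exact hp1 _)).indicator hs
  have hone : ∀ s, MeasurableSet s → Integrable (s.indicator fun _ => (1 : ℝ)) μ := fun s hs =>
    (integrable_const 1).indicator hs
  have hbe := (isSuccessProbability_iff_condExp hb hf hp hp0 hp1).1 hbf
  have hib := integrable_ind (μ := μ) hb
  have hpull : ∀ s, MeasurableSet s →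
      μ[s.indicator fun ω => p (f ω) | MeasurableSpace.comap f inferInstance] =ᵐ[μ] fun ω =>
        p (f ω) * (μ[s.indicator fun _ => (1 : ℝ) | MeasurableSpace.comap f inferInstance]) ω := by
    intro s hs
    have e2 : (s.indicator fun ω => p (f ω)) = fun ω => p (f ω) * s.indicator (fun _ => 1) ω := by
      ext ω
      by_cases hω : ω ∈ s <;> simp [hω]
    rw [e2]
    exact condExp_indicator_mul hf hp hp0 hp1 (hone s hs)
  rw [condIndepFun_iff_condExp_inter_preimage_eq_mul hg hb]
  constructor
  · intro h
    -- On a rectangle the claim reduces to integrals over an f-measurable set, where the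
    -- factorisation of conditional probabilities applies.
    refine Measure.ext_prod fun {s t} hs ht => ?_
    rw [measure_eq_iff_setIntegral_ind (q := fun x : A × C => p x.1) hb hfg
      (hp.comp measurable_fst) (fun x => hp0 x.1) (fun x => hp1 x.1) (hs.prod ht),
      Set.mk_preimage_prod, ← setIntegral_indicator (hg ht), ← setIntegral_indicator (hg ht),
      ← setIntegral_condExp hf.comap_le (hib.indicator (hg ht)) ⟨s, hs, rfl⟩,
      ← setIntegral_condExp hf.comap_le (hpi _ (hg ht)) ⟨s, hs, rfl⟩]
    refine setIntegral_congr_ae (hf hs) ?_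
    have e3 : (fun ω => ind (b ω)) = (b ⁻¹' {true}).indicator fun _ => (1 : ℝ) := by
      ext ω
      cases h : b ω <;> simp [ind, h]
    have e4 : (g ⁻¹' t).indicator (fun ω => ind (b ω)) =
        (g ⁻¹' t ∩ b ⁻¹' {true}).indicator fun _ => (1 : ℝ) := by
      rw [e3, Set.indicator_indicator]
    rw [e3] at hbe
    rw [e4]
    filter_upwards [h t {true} ht (measurableSet_singleton _), hbe, hpull _ (hg ht)]
      with ω h1 h2 h3 _
    rw [h1, h3, h2, mul_comm]
  · intro h s t hs ht
    have h1 : _ =ᵐ[μ] fun ω => p (f ω) := (isSuccessProbability_iff_condExp hb hfg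
        (hp.comp measurable_fst)
      (fun x => hp0 x.1) (fun x => hp1 x.1)).1 h
    have hle : MeasurableSpace.comap f inferInstance ≤
        MeasurableSpace.comap (fun ω => (f ω, g ω)) inferInstance :=
      (measurable_fst.comp (comap_measurable fun ω => (f ω, g ω))).comap_le
    have hs' : MeasurableSet[MeasurableSpace.comap (fun ω => (f ω, g ω)) inferInstance]
        (g ⁻¹' s) := (measurable_snd.comp (comap_measurable fun ω => (f ω, g ω))) hs
    have h2 : μ[(g ⁻¹' s).indicator fun ω => ind (b ω) | MeasurableSpace.comap f inferInstance]
        =ᵐ[μ] fun ω => p (f ω) * (μ[(g ⁻¹' s).indicator fun _ => (1 : ℝ) |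
          MeasurableSpace.comap f inferInstance]) ω := by
      -- Tower property: condition first on (f, g), where the success probability is a function of f
      -- by assumption, then on f.
      refine (condExp_condExp_of_le hle hfg.comap_le).symm.trans
        ((condExp_congr_ae ?_).trans (hpull _ (hg hs)))
      refine (condExp_indicator hib hs').trans ?_
      filter_upwards [h1] with ω hω
      by_cases hωs : ω ∈ g ⁻¹' s <;> simp only [Set.indicator, hωs, if_true, if_false, hω]
    -- Every event about a binary variable has an indicator affine in `ind b`, so the factorisation
    -- need only be known for b = 1.
    obtain ⟨c₀, c₁, hc⟩ : ∃ c₀ c₁ : ℝ, ∀ ω, (b ⁻¹' t).indicator (fun _ => (1 : ℝ)) ω =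
        c₀ + c₁ * ind (b ω) := by
      refine ⟨t.indicator (fun _ => 1) false,
        t.indicator (fun _ => 1) true - t.indicator (fun _ => 1) false, fun ω => ?_⟩
      by_cases hω : b ω ∈ t <;> cases hbω : b ω <;> rw [hbω] at hω <;>
        simp [Set.indicator, hbω, hω, ind]
    have e1 : (g ⁻¹' s ∩ b ⁻¹' t).indicator (fun _ => (1 : ℝ)) =
        c₀ • (g ⁻¹' s).indicator (fun _ => (1 : ℝ)) +
          c₁ • (g ⁻¹' s).indicator fun ω => ind (b ω) := by
      ext ω
      rw [← Set.indicator_indicator]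
      by_cases h1 : ω ∈ g ⁻¹' s
      · simp only [Pi.add_apply, Pi.smul_apply, Set.indicator_of_mem h1, hc, smul_eq_mul, mul_one]
      · simp only [Pi.add_apply, Pi.smul_apply, Set.indicator_of_notMem h1, smul_zero, add_zero]
    have e2 : (b ⁻¹' t).indicator (fun _ => (1 : ℝ)) =
        (fun _ => c₀) + c₁ • fun ω => ind (b ω) := by
      ext ω
      simp [hc]
    rw [e1, e2]
    filter_upwards [condExp_add ((hone _ (hg hs)).smul c₀) ((hib.indicator (hg hs)).smul c₁)
        (MeasurableSpace.comap f inferInstance),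
      condExp_smul c₀ ((g ⁻¹' s).indicator fun _ => (1 : ℝ))
          (MeasurableSpace.comap f inferInstance),
      condExp_smul c₁ ((g ⁻¹' s).indicator fun ω => ind (b ω))
        (MeasurableSpace.comap f inferInstance), h2,
      condExp_add (integrable_const c₀) (hib.smul c₁) (MeasurableSpace.comap f inferInstance),
      condExp_smul c₁ (fun ω => ind (b ω)) (MeasurableSpace.comap f inferInstance), hbe]
      with ω k1 k2 k3 k4 k5 k6 k7
    rw [k1, k5]
    simp only [Pi.add_apply, k2, k3, k6, Pi.smul_apply, k4, k7, smul_eq_mul,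
      condExp_const hf.comap_le c₀]
    ring

end Bernoulli

end SurrogateATE

/-! ### The model assumptions as identities between measures -/

namespace SurrogateATE

section SuccessProbability

variable {Ω A C : Type*} [MeasurableSpace Ω] [MeasurableSpace A] [MeasurableSpace C]

/-- A success probability given a fine variable that depends only on a coarser one is also the
success probability given the coarser one. -/
theorem IsSuccessProbability.comp {μ : Measure Ω} {b : Ω → Bool} {φ : Ω → A} {θ : A → C}
    {q : C → ℝ} (hφ : Measurable φ) (hθ : Measurable θ) (hq : Measurable q)
    (h : IsSuccessProbability μ b φ fun a => q (θ a)) :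
    IsSuccessProbability μ b (fun ω => θ (φ ω)) q := by
  have h' : ∀ ν : Measure Ω, ν.map (fun ω => θ (φ ω)) = (ν.map φ).map θ := fun ν =>
    (Measure.map_map hθ hφ).symm
  rw [IsSuccessProbability, h', h, h', map_withDensity_comp hθ hq.ennreal_ofReal]

theorem isSuccessProbability_smul_iff {μ : Measure Ω} {b : Ω → Bool} {φ : Ω → A} {q : A → ℝ}
    {c : ℝ≥0∞} (hc : c ≠ 0) (hc' : c ≠ ∞) :
    IsSuccessProbability (c • μ) b φ q ↔ IsSuccessProbability μ b φ q := by
  rw [IsSuccessProbability, IsSuccessProbability, Measure.restrict_smul, Measure.map_smul,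
    Measure.map_smul, withDensity_smul_measure]
  refine ⟨fun h => ?_, fun h => by rw [h]⟩
  have := congrArg (fun ν => c⁻¹ • ν) h
  simpa only [smul_smul, ENNReal.inv_mul_cancel hc hc', one_smul] using this

theorem isSuccessProbability_cond_iff {μ : Measure Ω} [IsFiniteMeasure μ] {b : Ω → Bool}
    {φ : Ω → A} {q : A → ℝ} {s : Set Ω} :
    IsSuccessProbability (ProbabilityTheory.cond μ s) b φ q ↔
      IsSuccessProbability (μ.restrict s) b φ q := by
  -- If s is null, the conditional law and the restriction are both the zero measure; otherwise they
  -- differ by a finite nonzero factor.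
  by_cases h0 : μ s = 0
  · have : μ.restrict s = 0 := Measure.restrict_eq_zero.2 h0
    rw [ProbabilityTheory.cond, this, smul_zero]
  · exact isSuccessProbability_smul_iff (ENNReal.inv_ne_zero.2 (measure_ne_top _ _))
      (ENNReal.inv_ne_top.2 h0)

end SuccessProbability

theorem setOf_treatT_beq {𝒳 𝒮 : Type*} (t : Bool) :
    {z : FullData 𝒳 𝒮 | (treatT z == t) = true} = {z | treatT z = t} := by
  ext z; simp

/-- `P(T = t ∣ X = x)` in terms of `e(x) = P(T = 1 ∣ X = x)`. -/
def armPropensity {𝒳 : Type*} (e : 𝒳 → ℝ) (t : Bool) (x : 𝒳) : ℝ := if t then e x else 1 - e x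

theorem armPropensity_nonneg {𝒳 : Type*} {e : 𝒳 → ℝ} (he0 : ∀ x, 0 ≤ e x) (he1 : ∀ x, e x ≤ 1)
    (t : Bool) (x : 𝒳) : 0 ≤ armPropensity e t x := by
  cases t
  · exact sub_nonneg.2 (he1 x)
  · exact he0 x

theorem armPropensity_le_one {𝒳 : Type*} {e : 𝒳 → ℝ} (he0 : ∀ x, 0 ≤ e x) (he1 : ∀ x, e x ≤ 1)
    (t : Bool) (x : 𝒳) : armPropensity e t x ≤ 1 := by
  cases t
  · exact sub_le_self _ (he0 x)
  · exact he1 x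

section Identification

variable {𝒳 𝒮 : Type*} [MeasurableSpace 𝒳] [MeasurableSpace 𝒮]

/-- The covariates together with the potential surrogates and outcome of arm `t`. -/
def armData (t : Bool) (z : FullData 𝒳 𝒮) : (𝒳 × 𝒮) × ℝ := ((covX z, potS t z), potY t z)

theorem measurable_armPropensity {e : 𝒳 → ℝ} (he : Measurable e) (t : Bool) :
    Measurable (armPropensity e t) := by
  cases t
  · exact measurable_const.sub he
  · exact he

theorem measurable_treatT : Measurable (treatT : FullData 𝒳 𝒮 → Bool) := measurable_snd.fst

theorem measurable_potY (t : Bool) : Measurable (potY t : FullData 𝒳 𝒮 → ℝ) :=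
  (measurable_pi_apply t).comp measurable_snd.snd.snd.fst

theorem measurable_labelR : Measurable (labelR : FullData 𝒳 𝒮 → Bool) :=
  measurable_snd.snd.snd.snd

theorem measurable_armData (t : Bool) : Measurable (armData t : FullData 𝒳 𝒮 → _) :=
  (measurable_covX_potS t).prodMk (measurable_potY t)

theorem measurable_surS : Measurable (surS : FullData 𝒳 𝒮 → 𝒮) := by
  have : (surS : FullData 𝒳 𝒮 → 𝒮) =
      fun z => if treatT z = true then potS true z else potS false z := by
    ext z
    cases h : treatT z <;> simp [surS, h]
  rw [this]
  exact Measurable.ite (measurable_treatT (measurableSet_singleton true)) (measurable_potS true)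
    (measurable_potS false)

theorem measurable_outY : Measurable (outY : FullData 𝒳 𝒮 → ℝ) := by
  have : (outY : FullData 𝒳 𝒮 → ℝ) =
      fun z => if treatT z = true then potY true z else potY false z := by
    ext z
    cases h : treatT z <;> simp [outY, h]
  rw [this]
  exact Measurable.ite (measurable_treatT (measurableSet_singleton true)) (measurable_potY true)
    (measurable_potY false)

theorem measurable_obs : Measurable (obs : FullData 𝒳 𝒮 → ObsData 𝒳 𝒮) :=
  measurable_covX.prodMk (measurable_treatT.prodMk (measurable_surS.prodMk
    (measurable_labelR.prodMk (Measurable.ite (measurable_labelR (measurableSet_singleton true))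
      measurable_outY measurable_const))))

theorem measurableSet_treatT_eq (t : Bool) : MeasurableSet {z : FullData 𝒳 𝒮 | treatT z = t} :=
  measurable_treatT (measurableSet_singleton t)

theorem measurableSet_labelR_eq (t : Bool) : MeasurableSet {z : FullData 𝒳 𝒮 | labelR z = t} :=
  measurable_labelR (measurableSet_singleton t)

variable {P : ProbabilityMeasure (FullData 𝒳 𝒮)} {e : 𝒳 → ℝ} {r : Bool → 𝒳 → 𝒮 → ℝ}

theorem isTreatmentPropensity_iff (he : Measurable e) (he0 : ∀ x, 0 ≤ e x) (he1 : ∀ x, e x ≤ 1) :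
    IsTreatmentPropensity P e ↔
      IsSuccessProbability (P : Measure (FullData 𝒳 𝒮)) treatT covX e := by
  rw [isSuccessProbability_iff_condExp measurable_treatT measurable_covX he he0 he1]
  exact ⟨fun h => h.2, fun h => ⟨he, h⟩⟩

theorem isSuccessProbability_armPropensity (he : Measurable e) (he0 : ∀ x, 0 ≤ e x)
    (he1 : ∀ x, e x ≤ 1)
    (h : IsSuccessProbability (P : Measure (FullData 𝒳 𝒮)) treatT covX e) (t : Bool) :
    IsSuccessProbability (P : Measure (FullData 𝒳 𝒮)) (fun z => treatT z == t) covX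
      (armPropensity e t) := by
  cases t
  · have hb : Measurable fun z : FullData 𝒳 𝒮 => treatT z == false :=
      (measurable_of_finite (· == false)).comp measurable_treatT
    rw [isSuccessProbability_iff_condExp hb measurable_covX (measurable_armPropensity he false)
      (fun x => sub_nonneg.2 (he1 x)) (fun x => sub_le_self _ (he0 x))]
    rw [isSuccessProbability_iff_condExp measurable_treatT measurable_covX he he0 he1] at h
    have e1 : (fun z : FullData 𝒳 𝒮 => ind (treatT z == false)) =
        (fun _ => (1 : ℝ)) - fun z => ind (treatT z) := by
      ext z
      cases hz : treatT z <;> simp [ind, hz]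
    rw [e1]
    filter_upwards [condExp_sub (integrable_const (1 : ℝ))
      (integrable_ind (μ := (P : Measure (FullData 𝒳 𝒮))) measurable_treatT)
      (MeasurableSpace.comap covX inferInstance), h] with z h1 h2
    rw [h1, Pi.sub_apply, h2, condExp_const measurable_covX.comap_le]
    rfl
  · have : (fun z : FullData 𝒳 𝒮 => treatT z == true) = treatT := by ext z; simp
    rw [this]
    exact h

/-- Conditioning on T among the regressors is the same as working on each event {T = t} separately,
where S is S(t). Conversely, every set of values of (T, X, S) is a disjoint union of two slices with
fixed T. -/
theorem isLabelPropensity_iff (hr : Measurable fun p : Bool × 𝒳 × 𝒮 => r p.1 p.2.1 p.2.2)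
    (hr0 : ∀ t x s, 0 ≤ r t x s) (hr1 : ∀ t x s, r t x s ≤ 1) :
    IsLabelPropensity P r ↔
      ∀ t, IsSuccessProbability ((P : Measure (FullData 𝒳 𝒮)).restrict {z | treatT z = t}) labelR
        (fun z => (covX z, potS t z)) fun a => r t a.1 a.2 := by
  have hφ : Measurable fun z : FullData 𝒳 𝒮 => (treatT z, covX z, surS z) :=
    measurable_treatT.prodMk (measurable_covX.prodMk measurable_surS)
  have hrt : ∀ t, Measurable fun a : 𝒳 × 𝒮 => r t a.1 a.2 := fun t =>
    hr.comp (measurable_const.prodMk measurable_id)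
  have e0 : IsLabelPropensity P r ↔
      IsSuccessProbability (P : Measure (FullData 𝒳 𝒮)) labelR
        (fun z => (treatT z, covX z, surS z)) fun p => r p.1 p.2.1 p.2.2 := by
    rw [isSuccessProbability_iff_condExp measurable_labelR hφ hr (fun _ => hr0 _ _ _)
      (fun _ => hr1 _ _ _)]
    exact ⟨fun h => h.2, fun h => ⟨hr, h⟩⟩
  have hset : ∀ t (s : Set (𝒳 × 𝒮)), (fun z : FullData 𝒳 𝒮 => (treatT z, covX z, surS z)) ⁻¹'
      ({t} ×ˢ s) = (fun z => (covX z, potS t z)) ⁻¹' s ∩ {z | treatT z = t} := by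
    intro t s
    ext z
    simp only [Set.mem_preimage, Set.mem_prod, Set.mem_singleton_iff, Set.mem_inter_iff,
      Set.mem_ofPred_eq, surS]
    constructor
    · rintro ⟨h1, h2⟩
      rw [h1] at h2
      exact ⟨h2, h1⟩
    · rintro ⟨h1, h2⟩
      rw [h2]
      exact ⟨rfl, h1⟩
  have hcongr : ∀ t (s : Set (𝒳 × 𝒮)), MeasurableSet s →
      ∫ z in (fun z : FullData 𝒳 𝒮 => (treatT z, covX z, surS z)) ⁻¹' ({t} ×ˢ s),
        r (treatT z) (covX z) (surS z) ∂(P : Measure (FullData 𝒳 𝒮)) =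
      ∫ z in (fun z => (covX z, potS t z)) ⁻¹' s, r t (covX z) (potS t z)
        ∂((P : Measure (FullData 𝒳 𝒮)).restrict {z | treatT z = t}) := by
    intro t s hs
    rw [Measure.restrict_restrict (measurable_covX_potS t hs), ← hset]
    refine setIntegral_congr_fun (hφ ((measurableSet_singleton t).prod hs)) fun z hz => ?_
    rw [hset] at hz
    have : treatT z = t := hz.2
    simp only [surS, this]
  rw [e0, isSuccessProbability_iff_setIntegral measurable_labelR hφ hr (fun _ => hr0 _ _ _)
      (fun _ => hr1 _ _ _)]
  constructor
  · intro h t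
    rw [isSuccessProbability_iff_setIntegral measurable_labelR (measurable_covX_potS t) (hrt t)
      (fun _ => hr0 _ _ _) (fun _ => hr1 _ _ _)]
    intro s hs
    rw [← hcongr t s hs, ← h _ ((measurableSet_singleton t).prod hs),
      Measure.restrict_restrict (measurable_covX_potS t hs), hset]
  · intro h s hs
    have hs' : ∀ t, MeasurableSet {a : 𝒳 × 𝒮 | (t, a) ∈ s} := fun t => measurable_prodMk_left hs
    have hsplit : (fun z : FullData 𝒳 𝒮 => (treatT z, covX z, surS z)) ⁻¹' s =
        (fun z : FullData 𝒳 𝒮 => (treatT z, covX z, surS z)) ⁻¹' ({true} ×ˢ {a | (true, a) ∈ s}) ∪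
        (fun z : FullData 𝒳 𝒮 => (treatT z, covX z, surS z)) ⁻¹' ({false} ×ˢ {a | (false,
            a) ∈ s}) := by
      ext z
      cases hz : treatT z <;> simp [hz]
    have hdisj : Disjoint
        ((fun z : FullData 𝒳 𝒮 => (treatT z, covX z, surS z)) ⁻¹' ({true} ×ˢ {a | (true, a) ∈ s}))
        ((fun z : FullData 𝒳 𝒮 => (treatT z, covX z, surS z)) ⁻¹'
          ({false} ×ˢ {a | (false, a) ∈ s})) := by
      rw [Set.disjoint_left]
      intro z h1 h2
      have h1' : treatT z = true := h1.1
      have h2' : treatT z = false := h2.1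
      rw [h1'] at h2'
      exact absurd h2' (by simp)
    have hi : Integrable (fun z => r (treatT z) (covX z) (surS z)) (P : Measure (FullData 𝒳 𝒮)) :=
      Integrable.of_bound (hr.comp hφ).aestronglyMeasurable 1 (ae_of_all _ fun z => by
        rw [Real.norm_eq_abs, abs_of_nonneg (hr0 _ _ _)]
        exact hr1 _ _ _)
    have hpiece : ∀ t, ∫ z in (fun z : FullData 𝒳 𝒮 => (treatT z, covX z, surS z)) ⁻¹'
          ({t} ×ˢ {a | (t, a) ∈ s}), ind (labelR z) ∂(P : Measure (FullData 𝒳 𝒮)) =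
        ∫ z in (fun z : FullData 𝒳 𝒮 => (treatT z, covX z, surS z)) ⁻¹'
          ({t} ×ˢ {a | (t, a) ∈ s}), r (treatT z) (covX z) (surS z)
            ∂(P : Measure (FullData 𝒳 𝒮)) := by
      intro t
      have h1 := (isSuccessProbability_iff_setIntegral measurable_labelR (measurable_covX_potS t)
        (hrt t) (fun _ => hr0 _ _ _) (fun _ => hr1 _ _ _)).1 (h t) _ (hs' t)
      rw [hcongr t _ (hs' t), ← h1, hset,
        Measure.restrict_restrict (measurable_covX_potS t (hs' t))]
    have hm2 := hφ ((measurableSet_singleton false).prod (hs' false))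
    rw [hsplit, setIntegral_union hdisj hm2 (integrable_ind measurable_labelR).integrableOn
      (integrable_ind measurable_labelR).integrableOn,
      setIntegral_union hdisj hm2 hi.integrableOn hi.integrableOn, hpiece, hpiece]

variable [StandardBorelSpace 𝒳] [StandardBorelSpace 𝒮]

/-- Unconfoundedness says that the probability of T = t given (X, Y(t), S(t)) is the one given X.
Selecting arm t therefore only tilts its law by e_t(X). -/
theorem map_armData_restrict_treatT (hU : UnconfoundedTreatment P) (he : Measurable e)
    (he0 : ∀ x, 0 ≤ e x) (he1 : ∀ x, e x ≤ 1) (hPe : IsTreatmentPropensity P e) (t : Bool) :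
    ((P : Measure (FullData 𝒳 𝒮)).restrict {z | treatT z = t}).map (armData t) =
      ((P : Measure (FullData 𝒳 𝒮)).map (armData t)).withDensity fun a =>
        ENNReal.ofReal (armPropensity e t a.1.1) := by
  have hb : Measurable fun z : FullData 𝒳 𝒮 => treatT z == t :=
    (measurable_of_finite (· == t)).comp measurable_treatT
  have hg : Measurable fun z : FullData 𝒳 𝒮 => (potY t z, potS t z) :=
    (measurable_potY t).prodMk (measurable_potS t)
  have h1 := isSuccessProbability_armPropensity he he0 he1
    ((isTreatmentPropensity_iff he he0 he1).1 hPe) t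
  have h2 := (hU t).comp measurable_id (measurable_of_finite (· == t))
  have hp := measurable_armPropensity he t
  have h3 := (condIndepFun_iff_isSuccessProbability hb measurable_covX hg hp
    (armPropensity_nonneg he0 he1 t) (armPropensity_le_one he0 he1 t) h1).1 h2
  have hθ : Measurable fun x : 𝒳 × ℝ × 𝒮 => ((x.1, x.2.2), x.2.1) := by fun_prop
  have h4 := IsSuccessProbability.comp (q := fun a : (𝒳 × 𝒮) × ℝ => armPropensity e t a.1.1)
    (measurable_covX.prodMk hg) hθ (hp.comp measurable_fst.fst) h3
  rw [← setOf_treatT_beq]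
  exact h4

/-- Given T = t, the probability of being labelled given (X, S(t), Y(t)) is the one given (X, S(t));
passing from the conditional law to the restricted measure only removes a normalising factor. -/
theorem missingAtRandom_iff (hr : Measurable fun p : Bool × 𝒳 × 𝒮 => r p.1 p.2.1 p.2.2)
    (hr0 : ∀ t x s, 0 ≤ r t x s) (hr1 : ∀ t x s, r t x s ≤ 1) (hPr : IsLabelPropensity P r) :
    MissingAtRandom P ↔ ∀ t,
      ((P : Measure (FullData 𝒳 𝒮)).restrict {z | treatT z = t ∧ labelR z = true}).map
          (armData t) =
        (((P : Measure (FullData 𝒳 𝒮)).restrict {z | treatT z = t}).map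
          (armData t)).withDensity fun a => ENNReal.ofReal (r t a.1.1 a.1.2) := by
  have hrt : ∀ t, Measurable fun a : 𝒳 × 𝒮 => r t a.1 a.2 := fun t =>
    hr.comp (measurable_const.prodMk measurable_id)
  have h := (isLabelPropensity_iff hr hr0 hr1).1 hPr
  refine forall_congr' fun t => ?_
  have hset : {z : FullData 𝒳 𝒮 | treatT z = t ∧ labelR z = true} =
      {z | labelR z = true} ∩ {z | treatT z = t} := by
    ext z; exact and_comm
  rw [hset, ← Measure.restrict_restrict (measurableSet_labelR_eq true)]
  have h1 := condIndepFun_iff_isSuccessProbability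
    (μ := ProbabilityTheory.cond (P : Measure (FullData 𝒳 𝒮)) {z | treatT z = t})
    measurable_labelR (measurable_covX_potS t) (measurable_potY t) (hrt t)
    (fun _ => hr0 _ _ _) (fun _ => hr1 _ _ _) (isSuccessProbability_cond_iff.2 (h t))
  rw [isSuccessProbability_cond_iff] at h1
  exact (⟨fun h => h.symm, fun h => h.symm⟩ : _ ↔ _).trans h1

end Identification

end SurrogateATE

/-! ### Identification with overlap at every point -/

namespace SurrogateATE

section Weights

variable {Ω : Type*} [MeasurableSpace Ω]

theorem withDensity_ofReal_inv {μ : Measure Ω} {k : Ω → ℝ} (hk : Measurable k)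
    (hk0 : ∀ ω, 0 < k ω) :
    (μ.withDensity fun ω => ENNReal.ofReal (k ω)).withDensity
      (fun ω => ENNReal.ofReal (k ω)⁻¹) = μ := by
  have h := withDensity_inv_same (μ := μ) hk.ennreal_ofReal
    (ae_of_all _ fun ω => (ENNReal.ofReal_pos.2 (hk0 ω)).ne')
    (ae_of_all _ fun ω => ENNReal.ofReal_ne_top)
  have e : (fun ω => ENNReal.ofReal (k ω)⁻¹) = (fun ω => ENNReal.ofReal (k ω))⁻¹ := by
    ext ω
    exact ENNReal.ofReal_inv_of_pos (hk0 ω)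
  rw [e]
  exact h

theorem ae_of_ae_withDensity {μ : Measure Ω} {k : Ω → ℝ} (hk : Measurable k)
    (hk0 : ∀ ω, 0 < k ω) {p : Ω → Prop}
    (h : ∀ᵐ ω ∂(μ.withDensity fun ω => ENNReal.ofReal (k ω)), p ω) : ∀ᵐ ω ∂μ, p ω := by
  rw [← withDensity_ofReal_inv (μ := μ) hk hk0]
  exact (withDensity_absolutelyContinuous _ _).ae_le h

end Weights

section Identified

variable {𝒳 𝒮 : Type*} [MeasurableSpace 𝒳] [MeasurableSpace 𝒮]

/-- The law of each arm is identified from the observed data through propensity scores which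
satisfy strict overlap everywhere. -/
structure IsIdentified (ε : ℝ) (P : ProbabilityMeasure (FullData 𝒳 𝒮)) (e : 𝒳 → ℝ)
    (r : Bool → 𝒳 → 𝒮 → ℝ) : Prop where
  measurable_e : Measurable e
  measurable_r : Measurable fun p : Bool × 𝒳 × 𝒮 => r p.1 p.2.1 p.2.2
  le_e : ∀ x, ε ≤ e x
  e_le : ∀ x, e x ≤ 1 - ε
  le_r : ∀ t x s, ε ≤ r t x s
  r_le : ∀ t x s, r t x s ≤ 1
  map_arm : ∀ t, ((P : Measure (FullData 𝒳 𝒮)).restrict {z | treatT z = t}).map (armData t) =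
    ((P : Measure (FullData 𝒳 𝒮)).map (armData t)).withDensity fun a =>
      ENNReal.ofReal (armPropensity e t a.1.1)
  map_label : ∀ t, ((P : Measure (FullData 𝒳 𝒮)).restrict
      {z | treatT z = t ∧ labelR z = true}).map (armData t) =
    ((P : Measure (FullData 𝒳 𝒮)).map (armData t)).withDensity fun a =>
      ENNReal.ofReal (armPropensity e t a.1.1 * r t a.1.1 a.1.2)

/-- The truncation of a function to values in `[ε, c]`. -/
def clamp (ε c y : ℝ) : ℝ := max ε (min y c)

theorem le_clamp (ε c y : ℝ) : ε ≤ clamp ε c y := le_max_left _ _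

theorem clamp_le {ε c : ℝ} (h : ε ≤ c) (y : ℝ) : clamp ε c y ≤ c := max_le h (min_le_right _ _)

theorem clamp_eq {ε c y : ℝ} (h1 : ε ≤ y) (h2 : y ≤ c) : clamp ε c y = y := by
  rw [clamp, min_eq_left h2, max_eq_right h1]

theorem measurable_clamp (ε c : ℝ) : Measurable (clamp ε c) :=
  measurable_const.max (measurable_id.min measurable_const)

variable {ε : ℝ} {P : ProbabilityMeasure (FullData 𝒳 𝒮)} {e : 𝒳 → ℝ} {r : Bool → 𝒳 → 𝒮 → ℝ}

theorem IsTreatmentPropensity.congr_ae {e' : 𝒳 → ℝ} (he : IsTreatmentPropensity P e)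
    (he' : Measurable e')
    (h : ∀ᵐ z ∂(P : Measure (FullData 𝒳 𝒮)), e' (covX z) = e (covX z)) :
    IsTreatmentPropensity P e' :=
  ⟨he', he.2.trans (h.mono fun _ hz => hz.symm)⟩

theorem IsLabelPropensity.congr_ae {r' : Bool → 𝒳 → 𝒮 → ℝ} (hr : IsLabelPropensity P r)
    (hr' : Measurable fun p : Bool × 𝒳 × 𝒮 => r' p.1 p.2.1 p.2.2)
    (h : ∀ t, ∀ᵐ z ∂(P : Measure (FullData 𝒳 𝒮)),
      r' t (covX z) (potS t z) = r t (covX z) (potS t z)) :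
    IsLabelPropensity P r' := by
  refine ⟨hr', hr.2.trans ?_⟩
  filter_upwards [ae_all_iff.2 h] with z hz
  exact (hz (treatT z)).symm

theorem IsIdentified.le_armPropensity (h : IsIdentified ε P e r) (t : Bool) (x : 𝒳) :
    ε ≤ armPropensity e t x := by
  have h1 := h.e_le x
  have h2 := h.le_e x
  cases t <;> simp only [armPropensity, Bool.false_eq_true, if_false, if_true] <;> linarith

theorem IsIdentified.armPropensity_le (hε : 0 < ε) (h : IsIdentified ε P e r) (t : Bool) (x : 𝒳) :
    armPropensity e t x ≤ 1 := by
  have h1 := h.e_le x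
  have h2 := h.le_e x
  cases t <;> simp only [armPropensity, Bool.false_eq_true, if_false, if_true] <;> linarith

variable [StandardBorelSpace 𝒳] [StandardBorelSpace 𝒮]

/-- Overlap is stated for some version of e, and any two versions agree almost surely at X, so
truncation changes the given version only on a null set. -/
theorem clamp_treatmentPropensity_ae_eq (hP : P ∈ model 𝒳 𝒮 ε) (he : IsTreatmentPropensity P e) :
    ∀ᵐ z ∂(P : Measure (FullData 𝒳 𝒮)), clamp ε (1 - ε) (e (covX z)) = e (covX z) := by
  obtain ⟨e', he', hb⟩ := hP.2.2.1.1
  filter_upwards [he'.2, he.2, hb] with z h1 h2 h3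
  rw [← h2, h1]
  exact clamp_eq h3.1 h3.2

/-- Two versions of r are known to agree only at (T, X, S(T)), so r(t, ·) is determined only on {T =
t}, whereas overlap concerns (X, S(t)) for all units. The law of (X, S(t)) on {T = t} is the full
one with a positive density e_t, so the two have the same null sets and the agreement extends to
everyone. -/
theorem clamp_labelPropensity_ae_eq (hε : 0 < ε) (hε' : ε < 1 / 2) (hP : P ∈ model 𝒳 𝒮 ε)
    (hr : IsLabelPropensity P r) (t : Bool) :
    ∀ᵐ z ∂(P : Measure (FullData 𝒳 𝒮)),
      clamp ε 1 (r t (covX z) (potS t z)) = r t (covX z) (potS t z) := by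
  obtain ⟨e, he, -⟩ := hP.2.2.1.1
  obtain ⟨r', hr', hb⟩ := hP.2.2.1.2
  have hem : Measurable fun x => clamp ε (1 - ε) (e x) := (measurable_clamp _ _).comp he.1
  have h0 : ∀ x, ε ≤ clamp ε (1 - ε) (e x) := fun x => le_clamp _ _ _
  have h1 : ∀ x, clamp ε (1 - ε) (e x) ≤ 1 - ε := fun x => clamp_le (by linarith) _
  have harm := map_armData_restrict_treatT hP.1 hem (fun x => hε.le.trans (h0 x))
    (fun x => (h1 x).trans (by linarith))
    (he.congr_ae hem (clamp_treatmentPropensity_ae_eq hP he)) t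
  have hpos : ∀ x, 0 < armPropensity (fun x => clamp ε (1 - ε) (e x)) t x := by
    intro x
    cases t
    · have := h1 x
      simp only [armPropensity, Bool.false_eq_true, if_false]
      linarith
    · have := h0 x
      simp only [armPropensity, if_true]
      linarith
  have hset : MeasurableSet {a : (𝒳 × 𝒮) × ℝ | r' t a.1.1 a.1.2 = r t a.1.1 a.1.2} := by
    have m1 : Measurable fun a : (𝒳 × 𝒮) × ℝ => r' t a.1.1 a.1.2 :=
      hr'.1.comp (measurable_const.prodMk measurable_fst)
    have m2 : Measurable fun a : (𝒳 × 𝒮) × ℝ => r t a.1.1 a.1.2 :=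
      hr.1.comp (measurable_const.prodMk measurable_fst)
    exact measurableSet_eq_fun m1 m2
  have h2 : ∀ᵐ z ∂((P : Measure (FullData 𝒳 𝒮)).restrict {z | treatT z = t}),
      r' t (covX z) (potS t z) = r t (covX z) (potS t z) := by
    rw [ae_restrict_iff' (measurableSet_treatT_eq t)]
    filter_upwards [hr.2, hr'.2] with z h3 h4 hz
    have hz' : treatT z = t := hz
    rw [h3] at h4
    simp only [surS, hz'] at h4
    exact h4.symm
  have h3 : ∀ᵐ a ∂((P : Measure (FullData 𝒳 𝒮)).map (armData t)),
      r' t a.1.1 a.1.2 = r t a.1.1 a.1.2 := by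
    refine ae_of_ae_withDensity ((measurable_armPropensity hem t).comp measurable_fst.fst)
      (fun a => hpos a.1.1) ?_
    simp only [Function.comp]
    rw [← harm]
    exact (ae_map_iff (measurable_armData t).aemeasurable hset).2 h2
  filter_upwards [ae_of_ae_map (measurable_armData t).aemeasurable h3, hb t] with z h4 h5
  have h4' : r' t (covX z) (potS t z) = r t (covX z) (potS t z) := h4
  rw [← h4']
  exact clamp_eq h5.1 h5.2

/-- The missingness identity on {T = t} composed with the treatment identity multiplies the
densities to e_t r_t. Passing to truncations makes the bounds hold everywhere, so that divisions by
propensity scores are safe pointwise. -/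
theorem isIdentified_clamp (hε : 0 < ε) (hε' : ε < 1 / 2) (hP : P ∈ model 𝒳 𝒮 ε)
    (he : IsTreatmentPropensity P e) (hr : IsLabelPropensity P r) :
    IsIdentified ε P (fun x => clamp ε (1 - ε) (e x)) fun t x s => clamp ε 1 (r t x s) := by
  have hem : Measurable fun x => clamp ε (1 - ε) (e x) := (measurable_clamp _ _).comp he.1
  have hrm : Measurable fun p : Bool × 𝒳 × 𝒮 => clamp ε 1 (r p.1 p.2.1 p.2.2) :=
    (measurable_clamp _ _).comp hr.1
  have h0 : ∀ x, ε ≤ clamp ε (1 - ε) (e x) := fun x => le_clamp _ _ _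
  have h1 : ∀ x, clamp ε (1 - ε) (e x) ≤ 1 - ε := fun x => clamp_le (by linarith) _
  have k0 : ∀ t x s, ε ≤ clamp ε 1 (r t x s) := fun t x s => le_clamp _ _ _
  have k1 : ∀ t x s, clamp ε 1 (r t x s) ≤ 1 := fun t x s => clamp_le (by linarith) _
  have e0 := fun x => hε.le.trans (h0 x)
  have e1 : ∀ x, clamp ε (1 - ε) (e x) ≤ 1 := fun x => (h1 x).trans (by linarith)
  have harm := map_armData_restrict_treatT hP.1 hem e0 e1
    (he.congr_ae hem (clamp_treatmentPropensity_ae_eq hP he))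
  refine ⟨hem, hrm, h0, h1, k0, k1, harm, fun t => ?_⟩
  have hrt : Measurable fun a : (𝒳 × 𝒮) × ℝ => clamp ε 1 (r t a.1.1 a.1.2) :=
    hrm.comp (measurable_const.prodMk measurable_fst)
  have hpt : Measurable fun a : (𝒳 × 𝒮) × ℝ =>
      armPropensity (fun x => clamp ε (1 - ε) (e x)) t a.1.1 :=
    (measurable_armPropensity hem t).comp measurable_fst.fst
  rw [(missingAtRandom_iff hrm (fun t x s => hε.le.trans (k0 t x s)) k1
    (hr.congr_ae hrm (clamp_labelPropensity_ae_eq hε hε' hP hr))).1 hP.2.1 t, harm,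
    ← withDensity_mul _ hpt.ennreal_ofReal hrt.ennreal_ofReal]
  congr 1
  ext a
  rw [Pi.mul_apply, ENNReal.ofReal_mul (armPropensity_nonneg e0 e1 t _)]

theorem exists_isIdentified (hε : 0 < ε) (hε' : ε < 1 / 2) (hP : P ∈ model 𝒳 𝒮 ε) :
    ∃ e r, IsIdentified ε P e r := by
  obtain ⟨e, he, -⟩ := hP.2.2.1.1
  obtain ⟨r, hr, -⟩ := hP.2.2.1.2
  exact ⟨_, _, isIdentified_clamp hε hε' hP he hr⟩

end Identified

/-! ### Marginals of the observed law -/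

section Observed

variable {𝒳 𝒮 : Type*} [MeasurableSpace 𝒳] [MeasurableSpace 𝒮]

/-- The observed covariates and surrogates. -/
def obsXS (w : ObsData 𝒳 𝒮) : 𝒳 × 𝒮 := (w.1, w.2.2.1)

/-- The observed covariates, surrogates and outcome. -/
def obsXSY (w : ObsData 𝒳 𝒮) : (𝒳 × 𝒮) × ℝ := ((w.1, w.2.2.1), w.2.2.2.2)

/-- The observations in arm `t`. -/
def obsArm (𝒳 𝒮 : Type*) (t : Bool) : Set (ObsData 𝒳 𝒮) := {w | w.2.1 = t}

/-- The labelled observations in arm `t`. -/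
def obsLabelled (𝒳 𝒮 : Type*) (t : Bool) : Set (ObsData 𝒳 𝒮) :=
  {w | w.2.1 = t ∧ w.2.2.2.1 = true}

theorem measurable_obsXS : Measurable (obsXS : ObsData 𝒳 𝒮 → _) := by
  unfold obsXS; fun_prop

theorem measurable_obsXSY : Measurable (obsXSY : ObsData 𝒳 𝒮 → _) := by
  unfold obsXSY; fun_prop

theorem measurableSet_obsArm (t : Bool) : MeasurableSet (obsArm 𝒳 𝒮 t) :=
  measurable_snd.fst (measurableSet_singleton t)

theorem measurableSet_obsLabelled (t : Bool) : MeasurableSet (obsLabelled 𝒳 𝒮 t) :=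
  (measurableSet_obsArm t).inter (measurable_snd.snd.snd.fst (measurableSet_singleton true))

theorem map_fst_obsLaw (P : ProbabilityMeasure (FullData 𝒳 𝒮)) :
    (obsLaw P).map Prod.fst = (P : Measure (FullData 𝒳 𝒮)).map covX := by
  rw [obsLaw, Measure.map_map measurable_fst measurable_obs]
  rfl

theorem map_obsXS_obsLaw (P : ProbabilityMeasure (FullData 𝒳 𝒮)) (t : Bool) :
    ((obsLaw P).restrict (obsArm 𝒳 𝒮 t)).map obsXS =
      (((P : Measure (FullData 𝒳 𝒮)).restrict {z | treatT z = t}).map (armData t)).map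
        Prod.fst := by
  rw [obsLaw, Measure.restrict_map measurable_obs (measurableSet_obsArm t),
    Measure.map_map measurable_obsXS measurable_obs,
    Measure.map_map measurable_fst (measurable_armData t)]
  refine Measure.map_congr ((ae_restrict_iff' (measurable_obs (measurableSet_obsArm t))).2
    (ae_of_all _ fun z hz => ?_))
  have hz' : treatT z = t := hz
  simp only [Function.comp, obsXS, obs, armData, surS, hz']

/-- Only for labelled units is the recorded last component the outcome itself and not the code 0. -/
theorem map_obsXSY_obsLaw (P : ProbabilityMeasure (FullData 𝒳 𝒮)) (t : Bool) :
    ((obsLaw P).restrict (obsLabelled 𝒳 𝒮 t)).map obsXSY =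
      ((P : Measure (FullData 𝒳 𝒮)).restrict {z | treatT z = t ∧ labelR z = true}).map
        (armData t) := by
  rw [obsLaw, Measure.restrict_map measurable_obs (measurableSet_obsLabelled t),
    Measure.map_map measurable_obsXSY measurable_obs]
  refine Measure.map_congr ((ae_restrict_iff' (measurable_obs (measurableSet_obsLabelled t))).2
    (ae_of_all _ fun z hz => ?_))
  have hz' : treatT z = t ∧ labelR z = true := hz
  simp only [Function.comp, obsXSY, obs, armData, surS, outY, hz'.1, hz'.2, if_true]

end Observed

end SurrogateATE

/-! ### Undoing selection within a differentiable family -/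

namespace SurrogateATE

namespace IsQMD

variable {Ω A B : Type*} [MeasurableSpace Ω] [MeasurableSpace A] [MeasurableSpace B]

theorem restrict {ν : Measure Ω} {μ : ℝ → Measure Ω} {u : ℝ → Ω → ℝ} {g : Ω → ℝ}
    (h : IsQMD ν μ u g) {s : Set Ω} (hs : MeasurableSet s) :
    IsQMD ν (fun γ => (μ γ).restrict s) (fun γ => s.indicator (u γ)) g := by
  refine ⟨fun γ => ?_, fun γ => (h.measurable_root γ).indicator hs,
    fun γ => Set.indicator_nonneg fun ω _ => h.nonneg γ ω, fun γ => ?_, h.measurable_score,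
    h.score_memLp.restrict s, ?_⟩
  · have := h.finite γ
    infer_instance
  · rw [h.density, restrict_withDensity hs, ← withDensity_indicator hs]
    congr 1
    ext ω
    by_cases hω : ω ∈ s <;> simp [hω]
  · refine tendsto_of_tendsto_of_tendsto_of_le_of_le tendsto_const_nhds h.tendsto
      (fun _ => zero_le) fun γ => eLpNorm_mono_ae (ae_of_all _ fun ω => ?_)
    by_cases hω : ω ∈ s
    · simp [hω]
    · simp only [Set.indicator_of_notMem hω, sub_zero, zero_div, mul_zero, norm_zero]
      exact norm_nonneg _

theorem memLp_withDensity_of_le {μ : Measure Ω} {q f : Ω → ℝ} {c : ℝ} (hq : ∀ x, q x ≤ c)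
    (hf : MemLp f 2 μ) : MemLp f 2 (μ.withDensity fun x => ENNReal.ofReal (q x)) := by
  refine hf.of_measure_le_smul (c := ENNReal.ofReal c) ENNReal.ofReal_ne_top ?_
  rw [← withDensity_const]
  exact withDensity_mono (ae_of_all _ fun ω => ENNReal.ofReal_le_ofReal (hq ω))

/-- Undoing a selection whose probability is bounded away from zero: if the selected law
`k • H γ` and the image of `H γ` in the first factor are differentiable in quadratic mean, then so
is `H γ`. -/
theorem of_withDensity_fst [StandardBorelSpace A] [Nonempty A] [StandardBorelSpace B] [Nonempty B]
    {ν : Measure (A × B)} [IsFiniteMeasure ν] {H Q : ℝ → Measure (A × B)} {k : ℝ → A → ℝ} {c : ℝ}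
    (hc : 0 < c) (hk : ∀ γ, Measurable (k γ)) (hck : ∀ γ a, c ≤ k γ a)
    (hHQ : ∀ γ, Q γ = (H γ).withDensity fun p => ENNReal.ofReal (k γ p.1))
    {u : ℝ → A × B → ℝ} {g : A × B → ℝ} (hQ : IsQMD ν Q u g) {w : ℝ → A → ℝ} {a : A → ℝ}
    (hα : IsQMD (ν.map Prod.fst) (fun γ => (H γ).map Prod.fst) w a) :
    ∃ (u' : ℝ → A × B → ℝ) (gA : A → ℝ),
      IsQMD ν H u' (fun p => g p + a p.1 - gA p.1) ∧
      MemLp g 2 (H 0) ∧ Measurable gA ∧ MemLp gA 2 ((H 0).map Prod.fst) ∧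
      ∀ f : A → ℝ, Measurable f → MemLp f 2 ((H 0).map Prod.fst) →
        ∫ x, f x * gA x ∂((H 0).map Prod.fst) = ∫ p, f p.1 / k 0 p.1 * g p ∂(Q 0) := by
  obtain ⟨v, gA, hA, hdual⟩ := hQ.map measurable_fst
  have hk0 : ∀ γ a, 0 < k γ a := fun γ a => hc.trans_le (hck γ a)
  have hkfst : ∀ γ, Measurable fun p : A × B => k γ p.1 := fun γ => (hk γ).comp measurable_fst
  have hQfst : ∀ γ, (Q γ).map Prod.fst =
      ((H γ).map Prod.fst).withDensity fun x => ENNReal.ofReal (k γ x) := fun γ => by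
    rw [hHQ, map_withDensity_comp measurable_fst (hk γ).ennreal_ofReal]
  have hαρ : ∀ γ, (H γ).map Prod.fst =
      ((Q γ).map Prod.fst).withDensity fun x => ENNReal.ofReal (k γ x)⁻¹ := fun γ => by
    rw [hQfst, withDensity_ofReal_inv (hk γ) (hk0 γ)]
  have hHQ' : ∀ γ, H γ = (Q γ).withDensity fun p => ENNReal.ofReal (k γ p.1)⁻¹ := fun γ => by
    rw [hHQ, withDensity_ofReal_inv (hkfst γ) fun p => hk0 γ p.1]
  have hinv : ∀ γ a, (k γ a)⁻¹ ≤ c⁻¹ := fun γ a => inv_anti₀ hc (hck γ a)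
  -- The weights are 1/k, bounded by 1/c; they restore the first marginal of H γ, which is
  -- differentiable by assumption.
  have hrw := hQ.reweight measurable_fst hA hα (ρ := fun γ x => (k γ x)⁻¹) (C := c⁻¹)
    (fun γ => (hk γ).inv) (fun γ x => (inv_pos.2 (hk0 γ x)).le) hinv hαρ
  refine ⟨fun γ p => √(k γ p.1)⁻¹ * u γ p, gA, ?_, ?_, hA.measurable_score, ?_, ?_⟩
  · simp only [← hHQ'] at hrw
    exact hrw
  · rw [hHQ' 0]
    exact memLp_withDensity_of_le (fun p => hinv 0 p.1) hQ.score_memLp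
  · rw [hαρ 0]
    exact memLp_withDensity_of_le (fun x => hinv 0 x) hA.score_memLp
  · intro f hf hfL
    -- The selected marginal has density k, and k (f/k)² = f²/k ≤ f²/c.
    have hfk : MemLp (fun x => f x / k 0 x) 2 ((Q 0).map Prod.fst) := by
      have hm : AEStronglyMeasurable (fun x => f x / k 0 x) ((Q 0).map Prod.fst) :=
        (hf.div (hk 0)).aestronglyMeasurable
      refine memLp_two_of_lintegral_lt_top hm ?_
      have hm1 : Measurable fun x => ENNReal.ofReal (k 0 x) := (hk 0).ennreal_ofReal
      have hm2 : Measurable fun x => ENNReal.ofReal ((f x / k 0 x) ^ 2) :=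
        ((hf.div (hk 0)).pow_const 2).ennreal_ofReal
      rw [hQfst, lintegral_withDensity_eq_lintegral_mul _ hm1 hm2]
      refine lt_of_le_of_lt (b := ∫⁻ x, ENNReal.ofReal c⁻¹ * ENNReal.ofReal (f x ^ 2)
        ∂((H 0).map Prod.fst)) (lintegral_mono fun x => ?_) ?_
      · rw [Pi.mul_apply, ← ENNReal.ofReal_mul (hk0 0 x).le, ← ENNReal.ofReal_mul
          (inv_pos.2 hc).le]
        refine ENNReal.ofReal_le_ofReal ?_
        have e1 : k 0 x * (f x / k 0 x) ^ 2 = (k 0 x)⁻¹ * f x ^ 2 := by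
          have := (hk0 0 x).ne'
          field_simp
        rw [e1]
        exact mul_le_mul_of_nonneg_right (hinv 0 x) (sq_nonneg _)
      · rw [lintegral_const_mul' _ _ ENNReal.ofReal_ne_top, ← eLpNorm_two_sq]
        exact ENNReal.mul_lt_top ENNReal.ofReal_lt_top (ENNReal.pow_lt_top hfL.2)
    have hfkm : Measurable fun x => f x / k 0 x := hf.div (hk 0)
    rw [← hdual (fun x => f x / k 0 x) hfkm hfk, hQfst, integral_withDensity_eq_integral_toReal_smul
      (hk 0).ennreal_ofReal (ae_of_all _ fun _ => ENNReal.ofReal_lt_top)]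
    refine integral_congr_ae (ae_of_all _ fun x => ?_)
    have := (hk0 0 x).ne'
    simp only [ENNReal.toReal_ofReal (hk0 0 x).le, smul_eq_mul]
    field_simp

end IsQMD

section Arm

variable {𝒳 𝒮 : Type*} [MeasurableSpace 𝒳] [MeasurableSpace 𝒮]

/-- A regular submodel is differentiable in quadratic mean with respect to a finite measure. -/
theorem IsRegularSubmodel.exists_isQMD {M : Set (ProbabilityMeasure (FullData 𝒳 𝒮))}
    {P : ProbabilityMeasure (FullData 𝒳 𝒮)} {path : ℝ → ProbabilityMeasure (FullData 𝒳 𝒮)}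
    {g : ObsData 𝒳 𝒮 → ℝ} (h : IsRegularSubmodel M P path g) :
    ∃ (ν : Measure (ObsData 𝒳 𝒮)) (u : ℝ → ObsData 𝒳 𝒮 → ℝ) (g' : ObsData 𝒳 𝒮 → ℝ),
      IsFiniteMeasure ν ∧ g =ᵐ[obsLaw P] g' ∧ IsQMD ν (fun γ => obsLaw (path γ)) u g' := by
  obtain ⟨ν₀, q, hσ, hq, hq0, hd, ht⟩ := h.quadratic_mean
  -- Disintegration needs a finite dominating measure. With φ positive and integrable, ν₀ is
  -- replaced by φ ν₀ and q by q/φ; the factor φ cancels in the quadratic mean remainder.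
  obtain ⟨φ, hφ0, hφm, hφi⟩ := exists_pos_lintegral_lt_of_sigmaFinite ν₀ one_ne_zero
  set g' := h.score_memLp.1.mk g with hg'
  have hgg : g =ᵐ[obsLaw P] g' := h.score_memLp.1.ae_eq_mk
  have hg'm : Measurable g' := h.score_memLp.1.stronglyMeasurable_mk.measurable
  have hφm' : Measurable fun w => (φ w : ℝ) := measurable_coe_nnreal_real.comp hφm
  have hφ0' : ∀ w, 0 < (φ w : ℝ) := fun w => NNReal.coe_pos.2 (hφ0 w)
  have hφE : Measurable fun w => (φ w : ℝ≥0∞) := measurable_coe_nnreal_ennreal.comp hφm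
  have hum : ∀ γ, Measurable fun w => √(q γ w / φ w) := fun γ => ((hq γ).div hφm').sqrt
  refine ⟨ν₀.withDensity fun w => φ w, fun γ w => √(q γ w / φ w), g',
    isFiniteMeasure_withDensity (hφi.trans ENNReal.one_lt_top).ne, hgg, ?_, hum,
    fun γ w => Real.sqrt_nonneg _, fun γ => ?_, hg'm, ?_, ?_⟩
  · intro γ
    exact Measure.isFiniteMeasure_map _ _
  · rw [hd, ← withDensity_mul _ hφE ((hum γ).pow_const 2).ennreal_ofReal]
    congr 1
    ext w
    rw [Pi.mul_apply, Real.sq_sqrt (div_nonneg (hq0 γ w) (hφ0' w).le),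
      ← ENNReal.ofReal_coe_nnreal, ← ENNReal.ofReal_mul (hφ0' w).le,
      mul_div_cancel₀ _ (hφ0' w).ne']
  · rw [h.zero]
    exact h.score_memLp.ae_eq hgg
  · rw [tendsto_eLpNorm_two_iff]
    refine ht.congr fun γ => ?_
    have hm : Measurable fun w => ENNReal.ofReal
        (((√(q γ w / φ w) - √(q 0 w / φ w)) / γ - g' w / 2 * √(q 0 w / φ w)) ^ 2) :=
      ((((hum γ).sub (hum 0)).div_const γ).sub ((hg'm.div_const 2).mul (hum 0))).pow_const 2
        |>.ennreal_ofReal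
    rw [lintegral_withDensity_eq_lintegral_mul _ hφE hm]
    -- The measurable version agrees with g only almost everywhere for P, hence only where q₀ ≠ 0;
    -- this suffices, as the score always appears multiplied by √q₀.
    have hae : ∀ᵐ w ∂ν₀, ENNReal.ofReal (q 0 w) ≠ 0 → g w = g' w := by
      rw [← ae_withDensity_iff (hq 0).ennreal_ofReal, ← hd 0, h.zero]
      exact hgg
    refine lintegral_congr_ae ?_
    filter_upwards [hae] with w hw
    have hgw : g w * √(q 0 w) = g' w * √(q 0 w) := by
      rcases (hq0 0 w).eq_or_lt with h0 | h0
      · rw [← h0]; simp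
      · rw [hw (ENNReal.ofReal_pos.2 h0).ne']
    rw [Pi.mul_apply, ← ENNReal.ofReal_coe_nnreal, ← ENNReal.ofReal_mul (hφ0' w).le]
    congr 1
    rw [Real.sqrt_div (hq0 γ w), Real.sqrt_div (hq0 0 w)]
    have hs := Real.sqrt_pos.2 (hφ0' w)
    have e1 : (φ w : ℝ) = √(φ w) ^ 2 := (Real.sq_sqrt (hφ0' w).le).symm
    have e2 : (√(q γ w) / √(φ w) - √(q 0 w) / √(φ w)) / γ - g' w / 2 * (√(q 0 w) / √(φ w)) =
        ((√(q γ w) - √(q 0 w)) / γ - g w / 2 * √(q 0 w)) / √(φ w) := by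
      have : g w / 2 * √(q 0 w) = g' w / 2 * √(q 0 w) := by linarith
      rw [this]
      ring
    rw [e2, div_pow, ← e1, mul_div_cancel₀ _ (hφ0' w).ne']

end Arm

end SurrogateATE

/-! ### Regressions as L² projections -/

namespace SurrogateATE

section Regression

variable {Ω Ω' A B : Type*} [MeasurableSpace Ω] [MeasurableSpace Ω'] [MeasurableSpace A]
  [MeasurableSpace B]

/-- `M ∘ φ` is the orthogonal projection of `f` on the square-integrable functions of `φ`. -/
structure IsRegression (μ : Measure Ω) (f : Ω → ℝ) (φ : Ω → A) (M : A → ℝ) : Prop where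
  measurable : Measurable M
  memLp : MemLp (fun ω => M (φ ω)) 2 μ
  integral_mul : ∀ h : A → ℝ, Measurable h → MemLp (fun ω => h (φ ω)) 2 μ →
    ∫ ω, f ω * h (φ ω) ∂μ = ∫ ω, M (φ ω) * h (φ ω) ∂μ

theorem isRegression_of_condExp {μ : Measure Ω} [IsFiniteMeasure μ] {f : Ω → ℝ} {φ : Ω → A}
    {M : A → ℝ} (hf : MemLp f 2 μ) (hφ : Measurable φ) (hM : Measurable M)
    (h : μ[f | MeasurableSpace.comap φ inferInstance] =ᵐ[μ] fun ω => M (φ ω)) :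
    IsRegression μ f φ M := by
  have hML : MemLp (fun ω => M (φ ω)) 2 μ := (hf.condExp one_le_two).ae_eq h
  refine ⟨hM, hML, fun k hk hkL => ?_⟩
  have hfk : Integrable (fun ω => f ω * k (φ ω)) μ := integrable_mul_of_memLp_two hf hkL
  have hkm : StronglyMeasurable[MeasurableSpace.comap φ inferInstance] fun ω => k (φ ω) :=
    (hk.comp (comap_measurable φ)).stronglyMeasurable
  have h1 := condExp_mul_of_stronglyMeasurable_right (m := MeasurableSpace.comap φ inferInstance)
    hkm hfk (hf.integrable one_le_two)
  rw [← integral_condExp hφ.comap_le]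
  refine integral_congr_ae ?_
  filter_upwards [h1, h] with ω h1 h2
  have : (μ[fun ω => f ω * k (φ ω) | MeasurableSpace.comap φ inferInstance]) ω = _ := h1
  rw [this, Pi.mul_apply, h2]

namespace IsRegression

variable {μ : Measure Ω} {f : Ω → ℝ} {φ : Ω → A} {M : A → ℝ}

theorem smul (h : IsRegression μ f φ M) {c : ℝ≥0∞} (hc0 : c ≠ 0) (hc : c ≠ ∞) :
    IsRegression (c • μ) f φ M := by
  refine ⟨h.measurable, h.memLp.smul_measure hc, fun k hk hkL => ?_⟩
  have hk' : MemLp (fun ω => k (φ ω)) 2 μ := by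
    have := hkL.smul_measure (ENNReal.inv_ne_top.2 hc0)
    rwa [smul_smul, ENNReal.inv_mul_cancel hc0 hc, one_smul] at this
  rw [integral_smul_measure, integral_smul_measure, h.integral_mul k hk hk']

theorem congr {f' : Ω → ℝ} {φ' : Ω → A} (h : IsRegression μ f φ M) (hf : f =ᵐ[μ] f')
    (hφ : φ =ᵐ[μ] φ') : IsRegression μ f' φ' M := by
  have hc : ∀ k : A → ℝ, (fun ω => k (φ ω)) =ᵐ[μ] fun ω => k (φ' ω) := fun k => by
    filter_upwards [hφ] with ω hω
    rw [hω]
  refine ⟨h.measurable, h.memLp.ae_eq (hc M), fun k hk hkL => ?_⟩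
  have h1 := h.integral_mul k hk (hkL.ae_eq (hc k).symm)
  exact (integral_congr_ae (hf.mul (hc k))).symm.trans
    (h1.trans (integral_congr_ae ((hc M).mul (hc k))))

/-- A test function on the event {b = t}, extended by zero to the other values of b, is a test
function of (b, φ). -/
theorem restrict_eq [MeasurableSingletonClass B] {b : Ω → B}
    (hb : Measurable b) {φ : Ω → A}
    {M : B → A → ℝ} (h : IsRegression μ f (fun ω => (b ω, φ ω)) fun p => M p.1 p.2) (t : B) :
    IsRegression (μ.restrict {ω | b ω = t}) f φ (M t) := by
  classical
  have hs : MeasurableSet {ω | b ω = t} := hb (measurableSet_singleton t)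
  have hres : ∀ F G : Ω → ℝ, (∀ ω, b ω = t → F ω = G ω) →
      F =ᵐ[μ.restrict {ω | b ω = t}] G := fun F G hFG =>
    (ae_restrict_iff' hs).2 (ae_of_all _ hFG)
  have hMt : Measurable (M t) := h.measurable.comp measurable_prodMk_left
  refine ⟨hMt, (h.memLp.restrict _).ae_eq (hres _ _ fun ω hω => by simp only [hω]),
    fun k hk hkL => ?_⟩
  set k' : B × A → ℝ := fun p => if p.1 = t then k p.2 else 0 with hk'
  have hk'm : Measurable k' := Measurable.ite (measurable_fst (measurableSet_singleton t))
    (hk.comp measurable_snd) measurable_const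
  have hk'i : (fun ω => k' (b ω, φ ω)) = {ω | b ω = t}.indicator fun ω => k (φ ω) := by
    ext ω
    by_cases hω : b ω = t <;> simp [hk', hω]
  have h1 := h.integral_mul k' hk'm (by rw [hk'i]; exact (memLp_indicator_iff_restrict hs).2 hkL)
  have e : ∀ F G : Ω → ℝ, (∀ ω, b ω = t → F ω = G ω) →
      ∫ ω, F ω * k' (b ω, φ ω) ∂μ = ∫ ω in {ω | b ω = t}, G ω * k (φ ω) ∂μ := fun F G hFG => by
    rw [← integral_indicator hs]
    refine integral_congr_ae (ae_of_all _ fun ω => ?_)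
    by_cases hω : b ω = t
    · simp [hk', hω, hFG ω hω]
    · simp [hk', hω]
  rwa [e f f fun _ _ => rfl, e (fun ω => M (b ω) (φ ω)) (fun ω => M t (φ ω))
    fun ω hω => by rw [hω]] at h1

theorem of_map {π : Ω' → Ω} {μ : Measure Ω'} (hπ : Measurable π) (hf : Measurable f)
    (hφ : Measurable φ) (h : IsRegression μ (fun ω => f (π ω)) (fun ω => φ (π ω)) M) :
    IsRegression (μ.map π) f φ M := by
  have hm : ∀ k : A → ℝ, Measurable k → Measurable fun ω => k (φ ω) := fun k hk => hk.comp hφ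
  refine ⟨h.measurable, ?_, fun k hk hkL => ?_⟩
  · rw [memLp_map_measure_iff (hm M h.measurable).aestronglyMeasurable hπ.aemeasurable]
    exact h.memLp
  · rw [memLp_map_measure_iff (hm k hk).aestronglyMeasurable hπ.aemeasurable] at hkL
    have e1 := integral_map (μ := μ) hπ.aemeasurable (hf.mul (hm k hk)).aestronglyMeasurable
    have e2 := integral_map (μ := μ) hπ.aemeasurable
      ((hm M h.measurable).mul (hm k hk)).aestronglyMeasurable
    exact e1.trans ((h.integral_mul k hk hkL).trans e2.symm)

theorem integral_withDensity_ofReal {k F : Ω → ℝ} (hk : Measurable k) (hk0 : ∀ ω, 0 ≤ k ω) :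
    ∫ ω, F ω ∂(μ.withDensity fun ω => ENNReal.ofReal (k ω)) = ∫ ω, k ω * F ω ∂μ := by
  rw [integral_withDensity_eq_integral_toReal_smul hk.ennreal_ofReal
    (ae_of_all _ fun _ => ENNReal.ofReal_lt_top)]
  simp [ENNReal.toReal_ofReal (hk0 _)]

/-- A regression is not affected by a selection that depends on the regressors only. -/
theorem of_withDensity (hφ : Measurable φ) {k : A → ℝ} (hk : Measurable k) {c : ℝ} (hc : 0 < c)
    {C : ℝ} (hck : ∀ a, c ≤ k a) (hkC : ∀ a, k a ≤ C)
    (h : IsRegression (μ.withDensity fun ω => ENNReal.ofReal (k (φ ω))) f φ M) :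
    IsRegression μ f φ M := by
  have hk0 : ∀ a, 0 < k a := fun a => hc.trans_le (hck a)
  have hkφ : Measurable fun ω => k (φ ω) := hk.comp hφ
  have hinv := withDensity_ofReal_inv (μ := μ) hkφ fun ω => hk0 (φ ω)
  refine ⟨h.measurable, ?_, fun g hg hgL => ?_⟩
  · rw [← hinv]
    exact IsQMD.memLp_withDensity_of_le (c := c⁻¹) (fun ω => inv_anti₀ hc (hck _)) h.memLp
  -- Testing against g/k cancels the selection density.
  · have h1 := h.integral_mul (fun a => (k a)⁻¹ * g a) (hk.inv.mul hg) ?_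
    · rw [integral_withDensity_ofReal hkφ fun ω => (hk0 _).le,
        integral_withDensity_ofReal hkφ fun ω => (hk0 _).le] at h1
      have e : ∀ F : Ω → ℝ, ∫ ω, k (φ ω) * (F ω * ((k (φ ω))⁻¹ * g (φ ω))) ∂μ =
          ∫ ω, F ω * g (φ ω) ∂μ := fun F => by
        refine integral_congr_ae (ae_of_all _ fun ω => ?_)
        have := (hk0 (φ ω)).ne'
        simp only
        field_simp
      rwa [e, e] at h1
    · have h2 := IsQMD.memLp_withDensity_of_le (fun ω => hkC (φ ω)) hgL
      refine h2.of_le_mul (c := c⁻¹) ((hk.inv.mul hg).comp hφ).aestronglyMeasurable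
        (ae_of_all _ fun ω => ?_)
      rw [norm_mul, norm_inv, Real.norm_of_nonneg (hk0 _).le]
      exact mul_le_mul_of_nonneg_right (inv_anti₀ hc (hck _)) (norm_nonneg _)

end IsRegression

end Regression

section Arm

variable {𝒳 𝒮 : Type*} [MeasurableSpace 𝒳] [MeasurableSpace 𝒮]
  {P : ProbabilityMeasure (FullData 𝒳 𝒮)} {e : 𝒳 → ℝ} {r : Bool → 𝒳 → 𝒮 → ℝ} {ε : ℝ}

theorem memLp_outY (h : ∀ t, MemLp (potY t) 2 (P : Measure (FullData 𝒳 𝒮))) :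
    MemLp outY 2 (P : Measure (FullData 𝒳 𝒮)) := by
  refine ((h true).norm.add (h false).norm).mono measurable_outY.aestronglyMeasurable
    (ae_of_all _ fun z => ?_)
  rw [Pi.add_apply, Real.norm_of_nonneg (add_nonneg (norm_nonneg _) (norm_nonneg _))]
  cases hz : treatT z <;> simp [outY, hz]

/-- The regression on the surrogates is the same for all units as for the labelled ones. -/
theorem IsIdentified.isRegression_surrogate (hε : 0 < ε) (hid : IsIdentified ε P e r)
    (hY : ∀ t, MemLp (potY t) 2 (P : Measure (FullData 𝒳 𝒮))) {mS : Bool → 𝒳 → 𝒮 → ℝ}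
    (hmS : IsSurrogateRegression P mS) (t : Bool) :
    IsRegression ((P : Measure (FullData 𝒳 𝒮)).map (armData t)) Prod.snd Prod.fst
      fun a => mS t a.1 a.2 := by
  set Q := (P : Measure (FullData 𝒳 𝒮))
  have hφ : Measurable fun z : FullData 𝒳 𝒮 => (treatT z, covX z, surS z) :=
    measurable_treatT.prodMk (measurable_covX.prodMk measurable_surS)
  have h0 : IsRegression (Q.restrict {z | labelR z = true}) outY
      (fun z => (treatT z, covX z, surS z)) fun p => mS p.1 p.2.1 p.2.2 := by
    -- Without labelled units the restricted measure is zero and every measurable function is a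
    -- regression; otherwise the normalisation of the conditional law is undone.
    by_cases hz : Q {z | labelR z = true} = 0
    · have : Q.restrict {z | labelR z = true} = 0 := Measure.restrict_eq_zero.2 hz
      rw [this]
      exact ⟨hmS.1, ⟨aestronglyMeasurable_zero_measure _, by simp⟩, fun _ _ _ => by simp⟩
    · have hL : MemLp outY 2 (ProbabilityTheory.cond Q {z | labelR z = true}) :=
        ((memLp_outY hY).restrict _).smul_measure (ENNReal.inv_ne_top.2 hz)
      have h1 := isRegression_of_condExp hL hφ hmS.1 hmS.2
      have h2 := h1.smul hz (measure_ne_top _ _)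
      rwa [ProbabilityTheory.cond, smul_smul, ENNReal.mul_inv_cancel hz (measure_ne_top _ _),
        one_smul] at h2
  have h1 := h0.restrict_eq (M := fun t (a : 𝒳 × 𝒮) => mS t a.1 a.2) measurable_treatT t
  rw [Measure.restrict_restrict (measurableSet_treatT_eq t)] at h1
  have hs : MeasurableSet {z : FullData 𝒳 𝒮 | treatT z = t ∧ labelR z = true} :=
    (measurableSet_treatT_eq t).inter (measurableSet_labelR_eq true)
  have h2 : IsRegression (Q.restrict {z | treatT z = t ∧ labelR z = true}) (potY t)
      (fun z => (covX z, potS t z)) fun a => mS t a.1 a.2 :=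
    h1.congr ((ae_restrict_iff' hs).2 (ae_of_all _ fun z hz => by simp [outY, hz.1]))
      ((ae_restrict_iff' hs).2 (ae_of_all _ fun z hz => by simp [surS, hz.1]))
  have h3 := IsRegression.of_map (f := Prod.snd) (φ := Prod.fst) (measurable_armData t)
    measurable_snd measurable_fst h2
  rw [hid.map_label] at h3
  refine IsRegression.of_withDensity measurable_fst
    (k := fun a => armPropensity e t a.1 * r t a.1 a.2)
    (((measurable_armPropensity hid.measurable_e t).comp measurable_fst).mul
      (hid.measurable_r.comp (measurable_const.prodMk measurable_id))) (mul_pos hε hε) (C := 1)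
    (fun a => mul_le_mul (hid.le_armPropensity t _) (hid.le_r _ _ _) hε.le
      (hε.le.trans (hid.le_armPropensity t _)))
    (fun a => mul_le_one₀ (hid.armPropensity_le hε t _) (hε.le.trans (hid.le_r _ _ _))
      (hid.r_le _ _ _)) h3

/-- On {T = t} the regression on (T, X) is the one on X, under a law tilted by e_t(X). The tilt
depends on the regressor alone and can be removed, which transfers the regression to all units. -/
theorem IsIdentified.isRegression_outcome (hε : 0 < ε) (hid : IsIdentified ε P e r)
    (hY : ∀ t, MemLp (potY t) 2 (P : Measure (FullData 𝒳 𝒮))) {m : Bool → 𝒳 → ℝ}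
    (hm : IsOutcomeRegression P m) (t : Bool) :
    IsRegression ((P : Measure (FullData 𝒳 𝒮)).map (armData t)) Prod.snd (fun a => a.1.1)
      (m t) := by
  have h0 := (isRegression_of_condExp (memLp_outY hY) (measurable_treatT.prodMk measurable_covX)
    hm.1 hm.2).restrict_eq measurable_treatT t
  have hs := measurableSet_treatT_eq (𝒳 := 𝒳) (𝒮 := 𝒮) t
  have h1 : IsRegression ((P : Measure (FullData 𝒳 𝒮)).restrict {z | treatT z = t}) (potY t)
      covX (m t) :=
    h0.congr ((ae_restrict_iff' hs).2 (ae_of_all _ fun z hz => by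
      have hz' : treatT z = t := hz
      simp [outY, hz'])) (ae_eq_refl _)
  have h2 := IsRegression.of_map (f := Prod.snd)
    (φ := fun a : (𝒳 × 𝒮) × ℝ => a.1.1) (measurable_armData t)
    measurable_snd measurable_fst.fst h1
  rw [hid.map_arm] at h2
  exact IsRegression.of_withDensity measurable_fst.fst
    (measurable_armPropensity hid.measurable_e t) hε (C := 1) (hid.le_armPropensity t)
    (hid.armPropensity_le hε t) h2

end Arm

end SurrogateATE

/-! ### The derivative of a mean potential outcome -/

namespace SurrogateATE

theorem memLp_div_of_le {Ω : Type*} [MeasurableSpace Ω] {μ : Measure Ω} {f k : Ω → ℝ} {c : ℝ}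
    (hf : MemLp f 2 μ) (hk : Measurable k) (hc : 0 < c) (hck : ∀ ω, c ≤ k ω) :
    MemLp (fun ω => f ω / k ω) 2 μ := by
  refine hf.of_le_mul (c := c⁻¹) (hf.1.aemeasurable.div hk.aemeasurable).aestronglyMeasurable
      (ae_of_all _ fun ω => ?_)
  have e1 : ‖f ω / k ω‖ = (k ω)⁻¹ * ‖f ω‖ := by
    rw [norm_div, div_eq_inv_mul, Real.norm_of_nonneg (hc.trans_le (hck ω)).le]
  rw [e1]
  exact mul_le_mul_of_nonneg_right (inv_anti₀ hc (hck ω)) (norm_nonneg _)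

theorem integral_add_add_sub_sub {Ω : Type*} [MeasurableSpace Ω] {μ : Measure Ω}
    {f₁ f₂ f₃ f₄ f₅ : Ω → ℝ} (h₁ : Integrable f₁ μ) (h₂ : Integrable f₂ μ) (h₃ : Integrable f₃ μ)
    (h₄ : Integrable f₄ μ) (h₅ : Integrable f₅ μ) :
    ∫ ω, f₁ ω + f₂ ω + f₃ ω - f₄ ω - f₅ ω ∂μ =
      ∫ ω, f₁ ω ∂μ + ∫ ω, f₂ ω ∂μ + ∫ ω, f₃ ω ∂μ - ∫ ω, f₄ ω ∂μ - ∫ ω, f₅ ω ∂μ := by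
  have e := integral_sub (((h₁.add h₂).add h₃).sub h₄) h₅
  have e' := integral_sub ((h₁.add h₂).add h₃) h₄
  have e'' := integral_add (h₁.add h₂) h₃
  rw [← integral_add h₁ h₂]
  simp only [Pi.add_apply, Pi.sub_apply] at e e' e''
  rw [e, e', e'']

variable {𝒳 𝒮 : Type*}

/-- The summand of the efficient influence function that belongs to `E[Y(t)]`. -/
noncomputable def armInfluence (e : 𝒳 → ℝ) (r mS : Bool → 𝒳 → 𝒮 → ℝ) (m : Bool → 𝒳 → ℝ)
    (t : Bool) (w : ObsData 𝒳 𝒮) : ℝ :=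
  (obsLabelled 𝒳 𝒮 t).indicator (fun w => (w.2.2.2.2 - mS t w.1 w.2.2.1) /
      (armPropensity e t w.1 * r t w.1 w.2.2.1)) w +
    (obsArm 𝒳 𝒮 t).indicator (fun w => (mS t w.1 w.2.2.1 - m t w.1) / armPropensity e t w.1) w +
    m t w.1

theorem psi_eq_armInfluence (δ : ℝ) (e : 𝒳 → ℝ) (r mS : Bool → 𝒳 → 𝒮 → ℝ) (m : Bool → 𝒳 → ℝ)
    (w : ObsData 𝒳 𝒮) :
    psi δ e r mS m w = armInfluence e r mS m true w - armInfluence e r mS m false w - δ := by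
  obtain ⟨x, t, s, ρ, y⟩ := w
  cases t <;> cases ρ <;>
    simp only [psi, armInfluence, obsLabelled, obsArm, ind, armPropensity, Set.indicator,
      Set.mem_ofPred_eq, Bool.false_eq_true, Bool.true_eq_false, if_true, if_false, and_true,
      and_false] <;> ring

variable [MeasurableSpace 𝒳] [MeasurableSpace 𝒮]

namespace IsIdentified

variable {P : ProbabilityMeasure (FullData 𝒳 𝒮)} {e : 𝒳 → ℝ} {r : Bool → 𝒳 → 𝒮 → ℝ} {ε : ℝ}

theorem measurable_label (h : IsIdentified ε P e r) (t : Bool) :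
    Measurable fun a : 𝒳 × 𝒮 => armPropensity e t a.1 * r t a.1 a.2 :=
  ((measurable_armPropensity h.measurable_e t).comp measurable_fst).mul
    (h.measurable_r.comp (measurable_const.prodMk measurable_id))

theorem le_label (hε : 0 < ε) (h : IsIdentified ε P e r) (t : Bool) (a : 𝒳 × 𝒮) :
    ε * ε ≤ armPropensity e t a.1 * r t a.1 a.2 :=
  mul_le_mul (h.le_armPropensity t _) (h.le_r _ _ _) hε.le
    (hε.le.trans (h.le_armPropensity t _))

theorem label_le (hε : 0 < ε) (h : IsIdentified ε P e r) (t : Bool) (a : 𝒳 × 𝒮) :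
    armPropensity e t a.1 * r t a.1 a.2 ≤ 1 :=
  mul_le_one₀ (h.armPropensity_le hε t _) (hε.le.trans (h.le_r _ _ _)) (h.r_le _ _ _)

theorem map_obsXSY_eq (h : IsIdentified ε P e r) (t : Bool) :
    ((obsLaw P).restrict (obsLabelled 𝒳 𝒮 t)).map obsXSY =
      ((P : Measure (FullData 𝒳 𝒮)).map (armData t)).withDensity fun p =>
        ENNReal.ofReal (armPropensity e t p.1.1 * r t p.1.1 p.1.2) := by
  rw [map_obsXSY_obsLaw, h.map_label]

theorem map_obsXS_eq (h : IsIdentified ε P e r) (t : Bool) :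
    ((obsLaw P).restrict (obsArm 𝒳 𝒮 t)).map obsXS =
      (((P : Measure (FullData 𝒳 𝒮)).map (armData t)).map Prod.fst).withDensity fun a =>
        ENNReal.ofReal (armPropensity e t a.1) := by
  have hm : Measurable fun a : 𝒳 × 𝒮 => ENNReal.ofReal (armPropensity e t a.1) :=
    ((measurable_armPropensity h.measurable_e t).comp measurable_fst).ennreal_ofReal
  rw [map_obsXS_obsLaw, h.map_arm, ← map_withDensity_comp measurable_fst hm]

theorem memLp_obsXSY (hε : 0 < ε) (h : IsIdentified ε P e r) {t : Bool} {F : (𝒳 × 𝒮) × ℝ → ℝ}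
    (hF : Measurable F) (hFL : MemLp F 2 ((P : Measure (FullData 𝒳 𝒮)).map (armData t))) :
    MemLp ((obsLabelled 𝒳 𝒮 t).indicator fun w => F (obsXSY w)) 2 (obsLaw P) := by
  rw [memLp_indicator_iff_restrict (measurableSet_obsLabelled t)]
  refine (memLp_map_measure_iff (hF.aestronglyMeasurable)
    measurable_obsXSY.aemeasurable).1 ?_
  rw [h.map_obsXSY_eq]
  exact IsQMD.memLp_withDensity_of_le (fun p => h.label_le hε t p.1) hFL

theorem memLp_obsXS (hε : 0 < ε) (h : IsIdentified ε P e r) {t : Bool} {F : 𝒳 × 𝒮 → ℝ}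
    (hF : Measurable F)
    (hFL : MemLp F 2 (((P : Measure (FullData 𝒳 𝒮)).map (armData t)).map Prod.fst)) :
    MemLp ((obsArm 𝒳 𝒮 t).indicator fun w => F (obsXS w)) 2 (obsLaw P) := by
  rw [memLp_indicator_iff_restrict (measurableSet_obsArm t)]
  refine (memLp_map_measure_iff (hF.aestronglyMeasurable)
    measurable_obsXS.aemeasurable).1 ?_
  rw [h.map_obsXS_eq]
  exact IsQMD.memLp_withDensity_of_le (fun p => h.armPropensity_le hε t p.1) hFL

end IsIdentified

theorem map_fst_map_fst_armData (P : ProbabilityMeasure (FullData 𝒳 𝒮)) (t : Bool) :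
    (((P : Measure (FullData 𝒳 𝒮)).map (armData t)).map Prod.fst).map Prod.fst =
      (obsLaw P).map Prod.fst := by
  rw [map_fst_obsLaw, Measure.map_map measurable_fst (measurable_armData t),
    Measure.map_map measurable_fst (measurable_fst.comp (measurable_armData t))]
  rfl

section

variable {P : ProbabilityMeasure (FullData 𝒳 𝒮)} {e : 𝒳 → ℝ} {r mS : Bool → 𝒳 → 𝒮 → ℝ} {ε : ℝ}
  {m : Bool → 𝒳 → ℝ} {t : Bool}

theorem memLp_snd_map_armData (hY : MemLp (potY t) 2 (P : Measure (FullData 𝒳 𝒮))) :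
    MemLp Prod.snd 2 ((P : Measure (FullData 𝒳 𝒮)).map (armData t)) :=
  (memLp_map_measure_iff measurable_snd.aestronglyMeasurable
    (measurable_armData t).aemeasurable).2 hY

theorem memLp_fst_of_isRegression {M : 𝒳 × 𝒮 → ℝ}
    (hM : IsRegression ((P : Measure (FullData 𝒳 𝒮)).map (armData t)) Prod.snd Prod.fst M) :
    MemLp M 2 (((P : Measure (FullData 𝒳 𝒮)).map (armData t)).map Prod.fst) :=
  (memLp_map_measure_iff hM.measurable.aestronglyMeasurable measurable_fst.aemeasurable).2 hM.memLp

theorem memLp_fst_fst_of_isRegression {M : 𝒳 → ℝ}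
    (hM : IsRegression ((P : Measure (FullData 𝒳 𝒮)).map (armData t)) Prod.snd
      (fun a => a.1.1) M) :
    MemLp (fun a : 𝒳 × 𝒮 => M a.1) 2
      (((P : Measure (FullData 𝒳 𝒮)).map (armData t)).map Prod.fst) :=
  (memLp_map_measure_iff (hM.measurable.comp measurable_fst).aestronglyMeasurable
    measurable_fst.aemeasurable).2 hM.memLp

theorem memLp_obsLaw_of_isRegression {M : 𝒳 → ℝ}
    (hM : IsRegression ((P : Measure (FullData 𝒳 𝒮)).map (armData t)) Prod.snd
      (fun a => a.1.1) M) :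
    MemLp M 2 ((obsLaw P).map Prod.fst) := by
  rw [← map_fst_map_fst_armData P t]
  exact (memLp_map_measure_iff hM.measurable.aestronglyMeasurable
    measurable_fst.aemeasurable).2 (memLp_fst_fst_of_isRegression hM)

theorem memLp_armInfluence (hε : 0 < ε) (h : IsIdentified ε P e r)
    (hY : MemLp (potY t) 2 (P : Measure (FullData 𝒳 𝒮)))
    (hM : IsRegression ((P : Measure (FullData 𝒳 𝒮)).map (armData t)) Prod.snd Prod.fst
      fun a => mS t a.1 a.2)
    (hm : IsRegression ((P : Measure (FullData 𝒳 𝒮)).map (armData t)) Prod.snd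
      (fun a => a.1.1) (m t)) :
    MemLp (armInfluence e r mS m t) 2 (obsLaw P) := by
  have hp := measurable_armPropensity h.measurable_e t
  have hp1 : Measurable fun a : 𝒳 × 𝒮 => armPropensity e t a.1 := hp.comp measurable_fst
  have hl := h.measurable_label t
  have hl1 : Measurable fun p : (𝒳 × 𝒮) × ℝ => armPropensity e t p.1.1 * r t p.1.1 p.1.2 :=
    hl.comp measurable_fst
  have hMm := hM.measurable
  have h1 := h.memLp_obsXSY hε
    (((measurable_snd.sub (hMm.comp measurable_fst))).div hl1)
    (memLp_div_of_le ((memLp_snd_map_armData hY).sub hM.memLp) hl1 (mul_pos hε hε)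
      fun p => h.le_label hε t p.1)
  have h2 := h.memLp_obsXS hε
    ((hMm.sub (hm.measurable.comp measurable_fst)).div hp1)
    (memLp_div_of_le ((memLp_fst_of_isRegression hM).sub (memLp_fst_fst_of_isRegression hm))
      hp1 hε fun p => h.le_armPropensity t p.1)
  have h3 := (memLp_map_measure_iff hm.measurable.aestronglyMeasurable
    measurable_fst.aemeasurable).1 (memLp_obsLaw_of_isRegression hm)
  exact (h1.add h2).add h3

end

/-- The derivative of the mean of the last component `y` of the law `H γ` of a triple
`((x, s), y)` which is observed after two selections: the pair `(x, s)` is recorded on `S₁` and the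
whole triple on `S₂`. -/
theorem hasDerivAt_integral_of_selection {Ω : Type*} [MeasurableSpace Ω] [StandardBorelSpace Ω]
    [Nonempty Ω] [StandardBorelSpace 𝒳] [Nonempty 𝒳] [StandardBorelSpace 𝒮] [Nonempty 𝒮]
    {ν : Measure Ω} [IsFiniteMeasure ν] {O : ℝ → Measure Ω} {u : ℝ → Ω → ℝ} {g : Ω → ℝ}
    (hO : IsQMD ν O u g) {π : Ω → (𝒳 × 𝒮) × ℝ} (hπ : Measurable π) {S₁ S₂ : Set Ω}
    (hS₁ : MeasurableSet S₁) (hS₂ : MeasurableSet S₂) {H : ℝ → Measure ((𝒳 × 𝒮) × ℝ)}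
    {k₁ : ℝ → 𝒳 → ℝ} {k₂ : ℝ → 𝒳 × 𝒮 → ℝ} {c₁ c₂ C₁ C₂ : ℝ} (hc₁ : 0 < c₁) (hc₂ : 0 < c₂)
    (hk₁ : ∀ γ, Measurable (k₁ γ)) (hk₂ : ∀ γ, Measurable (k₂ γ)) (hck₁ : ∀ γ x, c₁ ≤ k₁ γ x)
    (hck₂ : ∀ γ a, c₂ ≤ k₂ γ a) (hkC₁ : ∀ γ x, k₁ γ x ≤ C₁) (hkC₂ : ∀ γ a, k₂ γ a ≤ C₂)
    (hHX : ∀ γ, (O γ).map (fun ω => (π ω).1.1) = ((H γ).map Prod.fst).map Prod.fst)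
    (hH₁ : ∀ γ, ((O γ).restrict S₁).map (fun ω => (π ω).1) =
      ((H γ).map Prod.fst).withDensity fun a => ENNReal.ofReal (k₁ γ a.1))
    (hH₂ : ∀ γ, ((O γ).restrict S₂).map π =
      (H γ).withDensity fun p => ENNReal.ofReal (k₂ γ p.1))
    (hY : MemLp Prod.snd 2 (H 0)) {M : 𝒳 × 𝒮 → ℝ} {m : 𝒳 → ℝ}
    (hM : IsRegression (H 0) Prod.snd Prod.fst M)
    (hm : IsRegression (H 0) Prod.snd (fun p => p.1.1) m) {C : ℝ≥0∞} (hC : C ≠ ∞)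
    (hb : ∀ᶠ γ in 𝓝 (0 : ℝ), ∫⁻ p, ENNReal.ofReal (p.2 ^ 2) ∂(H γ) ≤ C) :
    HasDerivAt (fun γ => ∫ p, p.2 ∂(H γ))
      (∫ ω, (S₂.indicator (fun ω => ((π ω).2 - M (π ω).1) / k₂ 0 (π ω).1) ω +
        S₁.indicator (fun ω => (M (π ω).1 - m (π ω).1.1) / k₁ 0 (π ω).1.1) ω +
        m (π ω).1.1) * g ω ∂(O 0)) 0 := by
  have hπ₁ : Measurable fun ω => (π ω).1 := hπ.fst
  have hπX : Measurable fun ω => (π ω).1.1 := hπ₁.fst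
  have hM1 : Measurable fun p : (𝒳 × 𝒮) × ℝ => M p.1 := hM.measurable.comp measurable_fst
  have hML : MemLp M 2 ((H 0).map Prod.fst) :=
    (memLp_map_measure_iff hM.measurable.aestronglyMeasurable measurable_fst.aemeasurable).2
      hM.memLp
  have hm1 : Measurable fun a : 𝒳 × 𝒮 => m a.1 := hm.measurable.comp measurable_fst
  have hmL1 : MemLp (fun a : 𝒳 × 𝒮 => m a.1) 2 ((H 0).map Prod.fst) :=
    (memLp_map_measure_iff hm1.aestronglyMeasurable measurable_fst.aemeasurable).2 hm.memLp
  have hmL : MemLp m 2 (((H 0).map Prod.fst).map Prod.fst) :=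
    (memLp_map_measure_iff hm.measurable.aestronglyMeasurable measurable_fst.aemeasurable).2 hmL1
  have hk₁' : Measurable fun a : 𝒳 × 𝒮 => k₁ 0 a.1 := (hk₁ 0).comp measurable_fst
  have hk₂' : Measurable fun p : (𝒳 × 𝒮) × ℝ => k₂ 0 p.1 := (hk₂ 0).comp measurable_fst
  -- Three observed families supply the scores: the unselected x-marginal (gX), the pair seen on S₁
  -- (g₁) and the triple seen on S₂ (g₂). Undoing the selection k₁ gives the law of (x, s) with
  -- score g₁ + gX - g₁A, and undoing k₂ then gives H with score g₂ + (g₁ + gX - g₁A) - g₂A, where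
  -- g₁A and g₂A are the scores of the selected first marginals.
  obtain ⟨vX, gX, hX, dualX⟩ := hO.map hπX
  obtain ⟨v₁, g₁, h₁, dual₁⟩ := (hO.restrict hS₁).map hπ₁
  obtain ⟨v₂, g₂, h₂, dual₂⟩ := (hO.restrict hS₂).map hπ
  have hν₁ : (ν.map fun ω => (π ω).1).map Prod.fst = ν.map fun ω => (π ω).1.1 := by
    rw [Measure.map_map measurable_fst hπ₁]; rfl
  have hν₂ : (ν.map π).map Prod.fst = ν.map fun ω => (π ω).1 := by
    rw [Measure.map_map measurable_fst hπ]; rfl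
  have hX₁ : IsQMD ((ν.map fun ω => (π ω).1).map Prod.fst)
      (fun γ => ((H γ).map Prod.fst).map Prod.fst) vX gX := by
    simp only [← hHX, hν₁]
    exact hX
  obtain ⟨u₁, g₁A, hQ₁, hg₁, hg₁Am, hg₁A, dual₁A⟩ :=
    IsQMD.of_withDensity_fst hc₁ hk₁ hck₁ hH₁ h₁ hX₁
  rw [← hν₂] at hQ₁
  obtain ⟨u₂, g₂A, hQ₂, hg₂, hg₂Am, hg₂A, dual₂A⟩ :=
    IsQMD.of_withDensity_fst hc₂ hk₂ hck₂ hH₂ h₂ hQ₁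
  have hder := hQ₂.hasDerivAt_integral measurable_snd hC hb
  refine hder.congr_deriv ?_
  -- the scores of the marginal laws, as functions on the arm
  have hg₁' : MemLp (fun p : (𝒳 × 𝒮) × ℝ => g₁ p.1) 2 (H 0) :=
    (memLp_map_measure_iff hg₁.1 measurable_fst.aemeasurable).1 hg₁
  have hg₁A₁ : MemLp (fun a : 𝒳 × 𝒮 => g₁A a.1) 2 ((H 0).map Prod.fst) :=
    (memLp_map_measure_iff hg₁A.1 measurable_fst.aemeasurable).1 hg₁A
  have hg₁A' : MemLp (fun p : (𝒳 × 𝒮) × ℝ => g₁A p.1.1) 2 (H 0) :=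
    (memLp_map_measure_iff hg₁A₁.1 measurable_fst.aemeasurable).1 hg₁A₁
  have hgXL := hX₁.score_memLp
  have hgX₁ : MemLp (fun a : 𝒳 × 𝒮 => gX a.1) 2 ((H 0).map Prod.fst) :=
    (memLp_map_measure_iff hgXL.1 measurable_fst.aemeasurable).1 hgXL
  have hgX' : MemLp (fun p : (𝒳 × 𝒮) × ℝ => gX p.1.1) 2 (H 0) :=
    (memLp_map_measure_iff hgX₁.1 measurable_fst.aemeasurable).1 hgX₁
  have hg₂A' : MemLp (fun p : (𝒳 × 𝒮) × ℝ => g₂A p.1) 2 (H 0) :=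
    (memLp_map_measure_iff hg₂A.1 measurable_fst.aemeasurable).1 hg₂A
  have hmapX : ∀ F : 𝒳 → ℝ, Measurable F →
      ∫ p, F p.1.1 ∂(H 0) = ∫ x, F x ∂(((H 0).map Prod.fst).map Prod.fst) := fun F hF => by
    have e1 := integral_map (μ := H 0) measurable_fst.aemeasurable
      (hF.comp measurable_fst).aestronglyMeasurable
    have e2 := integral_map (μ := (H 0).map Prod.fst) measurable_fst.aemeasurable
      hF.aestronglyMeasurable
    exact (e2.trans e1).symm
  have hmap₁ : ∀ F : 𝒳 × 𝒮 → ℝ, Measurable F →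
      ∫ p, F p.1 ∂(H 0) = ∫ x, F x ∂((H 0).map Prod.fst) := fun F hF =>
    (integral_map (μ := H 0) measurable_fst.aemeasurable hF.aestronglyMeasurable).symm
  have hind : ∀ (S : Set Ω) (_ : MeasurableSet S) (F : Ω → ℝ),
      ∫ ω in S, F ω * g ω ∂(O 0) = ∫ ω, S.indicator F ω * g ω ∂(O 0) := fun S hS F => by
    rw [← integral_indicator hS]
    refine integral_congr_ae (ae_of_all _ fun ω => ?_)
    by_cases hω : ω ∈ S <;> simp [hω]
  -- pairing with the scores of the selected laws
  have D₂ : ∀ F : (𝒳 × 𝒮) × ℝ → ℝ, Measurable F → MemLp F 2 (H 0) →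
      MemLp (S₂.indicator fun ω => F (π ω) / k₂ 0 (π ω).1) 2 (O 0) ∧
      ∫ p, F p / k₂ 0 p.1 * g₂ p ∂((H 0).withDensity fun p => ENNReal.ofReal (k₂ 0 p.1)) =
        ∫ ω, S₂.indicator (fun ω => F (π ω) / k₂ 0 (π ω).1) ω * g ω ∂(O 0) := by
    intro F hF hFL
    have hFk : Measurable fun p => F p / k₂ 0 p.1 := hF.div hk₂'
    have hL : MemLp (fun p => F p / k₂ 0 p.1) 2 (((O 0).restrict S₂).map π) := by
      rw [hH₂]
      exact IsQMD.memLp_withDensity_of_le (fun p => hkC₂ 0 p.1)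
        (memLp_div_of_le hFL hk₂' hc₂ fun p => hck₂ 0 p.1)
    refine ⟨(memLp_indicator_iff_restrict hS₂).2
      ((memLp_map_measure_iff hL.1 hπ.aemeasurable).1 hL), ?_⟩
    rw [← hind S₂ hS₂, ← hH₂]
    exact dual₂ _ hFk hL
  have D₁ : ∀ F : 𝒳 × 𝒮 → ℝ, Measurable F → MemLp F 2 ((H 0).map Prod.fst) →
      MemLp (S₁.indicator fun ω => F (π ω).1 / k₁ 0 (π ω).1.1) 2 (O 0) ∧
      ∫ a, F a / k₁ 0 a.1 * g₁ a ∂(((H 0).map Prod.fst).withDensity fun a =>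
          ENNReal.ofReal (k₁ 0 a.1)) =
        ∫ ω, S₁.indicator (fun ω => F (π ω).1 / k₁ 0 (π ω).1.1) ω * g ω ∂(O 0) := by
    intro F hF hFL
    have hFk : Measurable fun p => F p / k₁ 0 p.1 := hF.div hk₁'
    have hL : MemLp (fun p => F p / k₁ 0 p.1) 2 (((O 0).restrict S₁).map fun ω => (π ω).1) := by
      rw [hH₁]
      exact IsQMD.memLp_withDensity_of_le (fun p => hkC₁ 0 p.1)
        (memLp_div_of_le hFL hk₁' hc₁ fun p => hck₁ 0 p.1)
    refine ⟨(memLp_indicator_iff_restrict hS₁).2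
      ((memLp_map_measure_iff hL.1 hπ₁.aemeasurable).1 hL), ?_⟩
    rw [← hind S₁ hS₁, ← hH₁]
    exact dual₁ _ hFk hL
  -- The pairing of y with the score is computed term by term. Against functions of (x, s) the
  -- outcome may be replaced by M, and against functions of x by m. After moving to the observed
  -- law, g₂, g₁ and gX contribute y/k₂ on S₂, M/k₁ on S₁ and m, while g₁A and g₂A subtract m/k₁ on
  -- S₁ and M/k₂ on S₂.
  obtain ⟨L₂, T₂⟩ := D₂ Prod.snd measurable_snd hY
  obtain ⟨L₂A, T₂A⟩ := D₂ (fun p => M p.1) hM1 hM.memLp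
  obtain ⟨L₁, T₁⟩ := D₁ M hM.measurable hML
  obtain ⟨L₁A, T₁A⟩ := D₁ (fun a => m a.1) hm1 hmL1
  have LX : MemLp (fun ω => m (π ω).1.1) 2 (O 0) := by
    rw [← hHX] at hmL
    exact (memLp_map_measure_iff hmL.1 hπX.aemeasurable).1 hmL
  have T₂' : ∫ p, p.2 * g₂ p ∂(H 0) =
      ∫ ω, S₂.indicator (fun ω => (π ω).2 / k₂ 0 (π ω).1) ω * g ω ∂(O 0) := by
    rw [← T₂, IsRegression.integral_withDensity_ofReal hk₂' fun p => hc₂.le.trans (hck₂ 0 _)]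
    refine integral_congr_ae (ae_of_all _ fun p => ?_)
    have := (hc₂.trans_le (hck₂ 0 p.1)).ne'
    simp only
    field_simp
  have T₁' : ∫ p, p.2 * g₁ p.1 ∂(H 0) =
      ∫ ω, S₁.indicator (fun ω => M (π ω).1 / k₁ 0 (π ω).1.1) ω * g ω ∂(O 0) := by
    rw [← T₁, IsRegression.integral_withDensity_ofReal hk₁' fun p => hc₁.le.trans (hck₁ 0 _),
      hM.integral_mul g₁ h₁.measurable_score hg₁',
      hmap₁ (fun a => M a * g₁ a) (hM.measurable.mul h₁.measurable_score)]
    refine integral_congr_ae (ae_of_all _ fun p => ?_)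
    have := (hc₁.trans_le (hck₁ 0 p.1)).ne'
    simp only
    field_simp
  rw [hH₁] at dual₁A
  rw [hH₂] at dual₂A
  have T₂A' : ∫ p, p.2 * g₂A p.1 ∂(H 0) =
      ∫ ω, S₂.indicator (fun ω => M (π ω).1 / k₂ 0 (π ω).1) ω * g ω ∂(O 0) := by
    rw [← T₂A, ← dual₂A M hM.measurable hML, hM.integral_mul g₂A hg₂Am hg₂A',
      hmap₁ (fun a => M a * g₂A a) (hM.measurable.mul hg₂Am)]
  have T₁A' : ∫ p, p.2 * g₁A p.1.1 ∂(H 0) =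
      ∫ ω, S₁.indicator (fun ω => m (π ω).1.1 / k₁ 0 (π ω).1.1) ω * g ω ∂(O 0) := by
    rw [← T₁A, ← dual₁A m hm.measurable hmL, hm.integral_mul g₁A hg₁Am hg₁A',
      hmapX (fun a => m a * g₁A a) (hm.measurable.mul hg₁Am)]
  have TX : ∫ p, p.2 * gX p.1.1 ∂(H 0) = ∫ ω, m (π ω).1.1 * g ω ∂(O 0) := by
    rw [hm.integral_mul gX hX.measurable_score hgX',
      hmapX (fun a => m a * gX a) (hm.measurable.mul hX.measurable_score), ← hHX]
    refine dualX m hm.measurable ?_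
    rw [hHX]
    exact hmL
  have hgL := hO.score_memLp
  have i₂ := integrable_mul_of_memLp_two hY hg₂
  have i₁ := integrable_mul_of_memLp_two hY hg₁'
  have iX := integrable_mul_of_memLp_two hY hgX'
  have i₁A := integrable_mul_of_memLp_two hY hg₁A'
  have i₂A := integrable_mul_of_memLp_two hY hg₂A'
  have j₂ := integrable_mul_of_memLp_two L₂ hgL
  have j₂A := integrable_mul_of_memLp_two L₂A hgL
  have j₁ := integrable_mul_of_memLp_two L₁ hgL
  have j₁A := integrable_mul_of_memLp_two L₁A hgL
  have jX := integrable_mul_of_memLp_two LX hgL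
  have el : ∀ p : (𝒳 × 𝒮) × ℝ, p.2 * (g₂ p + (g₁ p.1 + gX p.1.1 - g₁A p.1.1) - g₂A p.1) =
      p.2 * g₂ p + p.2 * g₁ p.1 + p.2 * gX p.1.1 - p.2 * g₁A p.1.1 - p.2 * g₂A p.1 :=
    fun p => by ring
  have er : ∀ ω, (S₂.indicator (fun ω => ((π ω).2 - M (π ω).1) / k₂ 0 (π ω).1) ω +
        S₁.indicator (fun ω => (M (π ω).1 - m (π ω).1.1) / k₁ 0 (π ω).1.1) ω +
        m (π ω).1.1) * g ω =
      S₂.indicator (fun ω => (π ω).2 / k₂ 0 (π ω).1) ω * g ω +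
      S₁.indicator (fun ω => M (π ω).1 / k₁ 0 (π ω).1.1) ω * g ω +
      m (π ω).1.1 * g ω -
      S₁.indicator (fun ω => m (π ω).1.1 / k₁ 0 (π ω).1.1) ω * g ω -
      S₂.indicator (fun ω => M (π ω).1 / k₂ 0 (π ω).1) ω * g ω := fun ω => by
    by_cases h1 : ω ∈ S₁ <;> by_cases h2 : ω ∈ S₂ <;> simp [h1, h2] <;> ring
  simp only [el, er]
  rw [integral_add_add_sub_sub i₂ i₁ iX i₁A i₂A, integral_add_add_sub_sub j₂ j₁ jX j₁A j₂A,
    T₂', T₁', TX, T₁A', T₂A']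

/-- The derivative of the mean potential outcome along a submodel. -/
theorem hasDerivAt_integral_potY [StandardBorelSpace 𝒳] [StandardBorelSpace 𝒮]
    {path : ℝ → ProbabilityMeasure (FullData 𝒳 𝒮)} {e : ℝ → 𝒳 → ℝ}
    {r : ℝ → Bool → 𝒳 → 𝒮 → ℝ} {ε : ℝ} (hε : 0 < ε)
    (hid : ∀ γ, IsIdentified ε (path γ) (e γ) (r γ)) {ν : Measure (ObsData 𝒳 𝒮)}
    [IsFiniteMeasure ν] {u : ℝ → ObsData 𝒳 𝒮 → ℝ} {g : ObsData 𝒳 𝒮 → ℝ}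
    (hO : IsQMD ν (fun γ => obsLaw (path γ)) u g) {t : Bool}
    (hY : MemLp (potY t) 2 (path 0 : Measure (FullData 𝒳 𝒮)))
    {mS : Bool → 𝒳 → 𝒮 → ℝ} {m : Bool → 𝒳 → ℝ}
    (hM : IsRegression ((path 0 : Measure (FullData 𝒳 𝒮)).map (armData t)) Prod.snd Prod.fst
      fun a => mS t a.1 a.2)
    (hm : IsRegression ((path 0 : Measure (FullData 𝒳 𝒮)).map (armData t)) Prod.snd
      (fun a => a.1.1) (m t)) {C : ℝ≥0∞} (hC : C ≠ ∞)
    (hb : ∀ᶠ γ in 𝓝 (0 : ℝ),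
      ∫⁻ z, ENNReal.ofReal (potY t z ^ 2) ∂(path γ : Measure (FullData 𝒳 𝒮)) ≤ C) :
    HasDerivAt (fun γ => ∫ z, potY t z ∂(path γ : Measure (FullData 𝒳 𝒮)))
      (∫ w, armInfluence (e 0) (r 0) mS m t w * g w ∂(obsLaw (path 0))) 0 := by
  have hne : Nonempty (FullData 𝒳 𝒮) := nonempty_of_isProbabilityMeasure
    (path 0 : Measure (FullData 𝒳 𝒮))
  obtain ⟨z₀⟩ := hne
  have : Nonempty 𝒳 := ⟨covX z₀⟩
  have : Nonempty 𝒮 := ⟨potS t z₀⟩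
  have : Nonempty (ObsData 𝒳 𝒮) := ⟨obs z₀⟩
  have hb' : ∀ᶠ γ in 𝓝 (0 : ℝ),
      ∫⁻ p, ENNReal.ofReal (p.2 ^ 2) ∂((path γ : Measure (FullData 𝒳 𝒮)).map (armData t)) ≤ C := by
    filter_upwards [hb] with γ hγ
    rw [lintegral_map (measurable_snd.pow_const 2).ennreal_ofReal (measurable_armData t)]
    exact hγ
  have h := hasDerivAt_integral_of_selection hO measurable_obsXSY (measurableSet_obsArm t)
    (measurableSet_obsLabelled t) (H := fun γ =>
      (path γ : Measure (FullData 𝒳 𝒮)).map (armData t)) hε (mul_pos hε hε)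
    (fun γ => measurable_armPropensity (hid γ).measurable_e t)
    (fun γ => (hid γ).measurable_label t) (fun γ => (hid γ).le_armPropensity t)
    (fun γ => (hid γ).le_label hε t) (fun γ => (hid γ).armPropensity_le hε t)
    (fun γ => (hid γ).label_le hε t) (fun γ => (map_fst_map_fst_armData (path γ) t).symm)
    (fun γ => (hid γ).map_obsXS_eq t) (fun γ => (hid γ).map_obsXSY_eq t)
    (memLp_snd_map_armData hY) hM hm hC hb'
  have e1 : ∀ γ, ∫ p, p.2 ∂((path γ : Measure (FullData 𝒳 𝒮)).map (armData t)) =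
      ∫ z, potY t z ∂(path γ : Measure (FullData 𝒳 𝒮)) := fun γ =>
    integral_map (measurable_armData t).aemeasurable measurable_snd.aestronglyMeasurable
  simp only [e1] at h
  exact h

end SurrogateATE

/-! ### Pathwise differentiability of the average treatment effect -/

namespace SurrogateATE

variable {𝒳 𝒮 : Type*} [MeasurableSpace 𝒳] [MeasurableSpace 𝒮] [StandardBorelSpace 𝒳]
  [StandardBorelSpace 𝒮] {P : ProbabilityMeasure (FullData 𝒳 𝒮)} {e : 𝒳 → ℝ}
  {r mS : Bool → 𝒳 → 𝒮 → ℝ} {m : Bool → 𝒳 → ℝ} {ε : ℝ}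

/-- Terms of the arm that was not taken carry the factor zero, so ψ depends on the propensity scores
only through e(X) and r(T, X, S), where truncation changes nothing almost surely. -/
theorem psi_clamp_ae_eq (hε : 0 < ε) (hε' : ε < 1 / 2) (hP : P ∈ model 𝒳 𝒮 ε)
    (he : IsTreatmentPropensity P e) (hr : IsLabelPropensity P r) (δ : ℝ) :
    psi δ e r mS m =ᵐ[obsLaw P] psi δ (fun x => clamp ε (1 - ε) (e x))
      (fun t x s => clamp ε 1 (r t x s)) mS m := by
  have hem : Measurable fun w : ObsData 𝒳 𝒮 => e w.1 := he.1.comp measurable_fst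
  have hrm : Measurable fun w : ObsData 𝒳 𝒮 => r w.2.1 w.1 w.2.2.1 :=
    hr.1.comp (measurable_snd.fst.prodMk (measurable_fst.prodMk measurable_snd.snd.fst))
  have h : ∀ᵐ w ∂(obsLaw P), clamp ε (1 - ε) (e w.1) = e w.1 ∧
      clamp ε 1 (r w.2.1 w.1 w.2.2.1) = r w.2.1 w.1 w.2.2.1 := by
    have h1 : MeasurableSet {w : ObsData 𝒳 𝒮 | clamp ε (1 - ε) (e w.1) = e w.1 ∧
        clamp ε 1 (r w.2.1 w.1 w.2.2.1) = r w.2.1 w.1 w.2.2.1} :=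
      (measurableSet_eq_fun ((measurable_clamp _ _).comp hem) hem).inter
        (measurableSet_eq_fun ((measurable_clamp _ _).comp hrm) hrm)
    rw [obsLaw, ae_map_iff measurable_obs.aemeasurable h1]
    filter_upwards [clamp_treatmentPropensity_ae_eq hP he,
      ae_all_iff.2 (clamp_labelPropensity_ae_eq hε hε' hP hr)] with z h1 h2
    exact ⟨h1, h2 (treatT z)⟩
  filter_upwards [h] with w hw
  obtain ⟨x, t, s, ρ, y⟩ := w
  simp only at hw
  cases t <;> simp [psi, ind, hw.1, hw.2]

theorem psi_clamp_eq_armInfluence_ae (hε : 0 < ε) (hε' : ε < 1 / 2) (hP : P ∈ model 𝒳 𝒮 ε)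
    (he : IsTreatmentPropensity P e) (hr : IsLabelPropensity P r) (δ : ℝ) :
    psi δ e r mS m =ᵐ[obsLaw P] fun w =>
      armInfluence (fun x => clamp ε (1 - ε) (e x)) (fun t x s => clamp ε 1 (r t x s)) mS m true w -
      armInfluence (fun x => clamp ε (1 - ε) (e x)) (fun t x s => clamp ε 1 (r t x s)) mS m false w
      - δ := by
  filter_upwards [psi_clamp_ae_eq (mS := mS) (m := m) hε hε' hP he hr δ] with w hw
  rw [hw, psi_eq_armInfluence]

theorem memLp_psi (hε : 0 < ε) (hε' : ε < 1 / 2) (hP : P ∈ model 𝒳 𝒮 ε)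
    (he : IsTreatmentPropensity P e) (hr : IsLabelPropensity P r)
    (hmS : IsSurrogateRegression P mS) (hm : IsOutcomeRegression P m) (δ : ℝ) :
    MemLp (psi δ e r mS m) 2 (obsLaw P) := by
  have hid := isIdentified_clamp hε hε' hP he hr
  have hY := hP.2.2.2
  have := (measurable_obs (𝒳 := 𝒳) (𝒮 := 𝒮)).aemeasurable (μ := (P : Measure (FullData 𝒳 𝒮)))
  have : IsProbabilityMeasure (obsLaw P) := Measure.isProbabilityMeasure_map this
  have h := fun t => memLp_armInfluence hε hid (hY t) (hid.isRegression_surrogate hε hY hmS t)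
    (hid.isRegression_outcome hε hY hm t)
  refine MemLp.ae_eq (psi_clamp_eq_armInfluence_ae hε hε' hP he hr δ).symm
    (((h true).sub (h false)).sub (memLp_const δ))

/-- Every law in the model is identified, and at `P` one may take the truncations of any given
versions of the propensity scores. -/
theorem exists_isIdentified_path (hε : 0 < ε) (hε' : ε < 1 / 2)
    {path : ℝ → ProbabilityMeasure (FullData 𝒳 𝒮)} (hpath : ∀ γ, path γ ∈ model 𝒳 𝒮 ε)
    {e₀ : 𝒳 → ℝ} {r₀ : Bool → 𝒳 → 𝒮 → ℝ} (h₀ : IsIdentified ε (path 0) e₀ r₀) :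
    ∃ (e : ℝ → 𝒳 → ℝ) (r : ℝ → Bool → 𝒳 → 𝒮 → ℝ), (∀ γ, IsIdentified ε (path γ) (e γ)
        (r γ)) ∧ e 0 = e₀ ∧ r 0 = r₀ := by
  choose e r her using fun γ => exists_isIdentified hε hε' (hpath γ)
  refine ⟨Function.update e 0 e₀, Function.update r 0 r₀, fun γ => ?_, by simp, by simp⟩
  rcases eq_or_ne γ 0 with rfl | hγ
  · simpa using h₀
  · simpa [hγ] using her γ

/-- Pathwise differentiability of the average treatment effect. -/
theorem IsRegularSubmodel.hasDerivAt_ate (hε : 0 < ε) (hε' : ε < 1 / 2) (hP : P ∈ model 𝒳 𝒮 ε)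
    (he : IsTreatmentPropensity P e) (hr : IsLabelPropensity P r)
    (hmS : IsSurrogateRegression P mS) (hm : IsOutcomeRegression P m) (δ : ℝ)
    {M : Set (ProbabilityMeasure (FullData 𝒳 𝒮))} (hM : M ⊆ model 𝒳 𝒮 ε)
    {path : ℝ → ProbabilityMeasure (FullData 𝒳 𝒮)} {g : ObsData 𝒳 𝒮 → ℝ}
    (h : IsRegularSubmodel M P path g) :
    HasDerivAt (fun γ => ate (path γ)) (∫ w, psi δ e r mS m w * g w ∂(obsLaw P)) 0 := by
  obtain ⟨ν, u, g', hν, hg, hO⟩ := h.exists_isQMD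
  have hid := isIdentified_clamp hε hε' hP he hr
  have hmem : ∀ γ, path γ ∈ model 𝒳 𝒮 ε := fun γ => hM (h.mem γ)
  obtain ⟨C, hC⟩ := h.moment_bounded
  have hb : ∀ t, ∀ᶠ γ in 𝓝 (0 : ℝ),
      ∫⁻ z, ENNReal.ofReal (potY t z ^ 2) ∂(path γ : Measure (FullData 𝒳 𝒮)) ≤
        ENNReal.ofReal C := fun t => by
    filter_upwards [hC] with γ hγ
    rw [← ofReal_integral_eq_lintegral_ofReal ((hmem γ).2.2.2 t).integrable_sq
      (ae_of_all _ fun z => sq_nonneg _)]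
    exact ENNReal.ofReal_le_ofReal (hγ t)
  have hY := hP.2.2.2
  have hMr := hid.isRegression_surrogate hε hY hmS
  have hmr := hid.isRegression_outcome hε hY hm
  have h0 := h.zero
  obtain ⟨e', r', hid', he', hr'⟩ := exists_isIdentified_path hε hε' hmem (h0.symm ▸ hid)
  have hd := fun t => hasDerivAt_integral_potY (t := t) hε hid' hO (h0.symm ▸ hY t)
    (h0.symm ▸ hMr t) (h0.symm ▸ hmr t) ENNReal.ofReal_ne_top (hb t)
  rw [h0, he', hr'] at hd
  have hgL := hO.score_memLp
  rw [h0] at hgL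
  have hprob : ∀ γ, IsProbabilityMeasure (obsLaw (path γ)) := fun γ =>
    Measure.isProbabilityMeasure_map measurable_obs.aemeasurable
  -- Scores have mean zero: differentiate the constant total mass 1. Hence the constant δ in ψ does
  -- not affect the derivative.
  have hg0 : ∫ w, g' w ∂(obsLaw P) = 0 := by
    have h1 := hO.hasDerivAt_integral (f := fun _ => 1) measurable_const
      (C := 1) ENNReal.one_ne_top (by simp)
    simp only [integral_const, probReal_univ, smul_eq_mul, mul_one, one_mul, h0] at h1
    exact h1.unique (hasDerivAt_const 0 1)
  refine ((hd true).sub (hd false)).congr_deriv ?_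
  have hI := fun t => integrable_mul_of_memLp_two
    (memLp_armInfluence hε hid (hY t) (hMr t) (hmr t)) hgL
  have hgi : Integrable g' (obsLaw P) := by
    have := hprob 0
    rw [h0] at this
    exact hgL.integrable one_le_two
  have e1 := integral_sub ((hI true).sub (hI false)) (hgi.const_mul δ)
  simp only [Pi.sub_apply] at e1
  rw [integral_const_mul, hg0, mul_zero, sub_zero, integral_sub (hI true) (hI false)] at e1
  rw [← e1]
  refine integral_congr_ae ?_
  filter_upwards [psi_clamp_eq_armInfluence_ae (mS := mS) (m := m) hε hε' hP he hr δ, hg]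
    with w h1 h2
  rw [h1, h2]
  ring

end SurrogateATE

/-! ### Full-data laws with prescribed arms and propensity scores -/

namespace SurrogateATE

section Coupling

variable {A B : Type*} [MeasurableSpace A] [MeasurableSpace B] [StandardBorelSpace B] [Nonempty B]

/-- Two laws with the same first marginal have a coupling which is conditionally independent given
the first component. -/
theorem exists_coupling {ρ ρ' : Measure (A × B)} [IsProbabilityMeasure ρ] [IsProbabilityMeasure ρ']
    (h : ρ.map Prod.fst = ρ'.map Prod.fst) :
    ∃ Q : Measure (A × B × B), IsProbabilityMeasure Q ∧
      Q.map (fun v => (v.1, v.2.1)) = ρ ∧ Q.map (fun v => (v.1, v.2.2)) = ρ' := by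
  have hf : ρ.fst = ρ'.fst := h
  refine ⟨ρ.fst ⊗ₘ (ρ.condKernel ×ₖ ρ'.condKernel), inferInstance, ?_, ?_⟩
  · have e : (fun v : A × B × B => (v.1, v.2.1)) = Prod.map id Prod.fst := rfl
    rw [e, ← Measure.compProd_map measurable_fst, ← Kernel.fst_eq, Kernel.fst_prod]
    exact ρ.disintegrate _
  · have e : (fun v : A × B × B => (v.1, v.2.2)) = Prod.map id Prod.snd := rfl
    rw [e, ← Measure.compProd_map measurable_snd, ← Kernel.snd_eq, Kernel.snd_prod, hf]
    exact ρ'.disintegrate _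

end Coupling

section Assignment

/-- The covariates and the potential variables of a unit. -/
abbrev PotData (𝒳 𝒮 : Type*) := 𝒳 × (Bool → 𝒮) × (Bool → ℝ)

variable {𝒳 𝒮 : Type*}

/-- The covariates and the potential variables under the treatment `t`. -/
def potArm (t : Bool) (v : PotData 𝒳 𝒮) : (𝒳 × 𝒮) × ℝ := ((v.1, v.2.1 t), v.2.2 t)

/-- A unit with the treatment and the labelling indicator `i`. -/
def assign (i : Bool × Bool) (v : PotData 𝒳 𝒮) : FullData 𝒳 𝒮 := (v.1, i.1, v.2.1, v.2.2, i.2)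

/-- The part of a unit which is not affected by the treatment and the labelling. -/
def potData (z : FullData 𝒳 𝒮) : PotData 𝒳 𝒮 := (z.1, z.2.2.1, z.2.2.2.1)

/-- The probability of the treatment and the labelling indicator `i` for given potential
variables. -/
noncomputable def assignProb (e : 𝒳 → ℝ) (r : Bool → 𝒳 → 𝒮 → ℝ) (i : Bool × Bool)
    (v : PotData 𝒳 𝒮) : ℝ :=
  armPropensity e i.1 v.1 * if i.2 then r i.1 v.1 (v.2.1 i.1) else 1 - r i.1 v.1 (v.2.1 i.1)

variable [MeasurableSpace 𝒳] [MeasurableSpace 𝒮]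

theorem measurable_potArm (t : Bool) : Measurable (potArm t : PotData 𝒳 𝒮 → _) :=
  (measurable_fst.prodMk ((measurable_pi_apply t).comp measurable_snd.fst)).prodMk
    ((measurable_pi_apply t).comp measurable_snd.snd)

theorem measurable_assign (i : Bool × Bool) : Measurable (assign i : PotData 𝒳 𝒮 → _) := by
  unfold assign; fun_prop

theorem measurable_potData : Measurable (potData : FullData 𝒳 𝒮 → _) := by
  unfold potData; fun_prop

/-- The prescribed arms constrain each other only through the law of X, so (S(1), Y(1)) and (S(0),
Y(0)) may be taken conditionally independent given X. -/
theorem exists_potData_law [StandardBorelSpace 𝒮] {H : Bool → Measure ((𝒳 × 𝒮) × ℝ)}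
    (hH : ∀ t, IsProbabilityMeasure (H t))
    (hX : (H true).map (fun a => a.1.1) = (H false).map fun a => a.1.1) :
    ∃ V : Measure (PotData 𝒳 𝒮), IsProbabilityMeasure V ∧ ∀ t, V.map (potArm t) = H t := by
  have : Nonempty ((𝒳 × 𝒮) × ℝ) := nonempty_of_isProbabilityMeasure (H true)
  have : Nonempty 𝒮 := ⟨this.some.1.2⟩
  have hα : Measurable fun a : (𝒳 × 𝒮) × ℝ => (a.1.1, a.1.2, a.2) := by fun_prop
  have hα' : Measurable fun b : 𝒳 × 𝒮 × ℝ => ((b.1, b.2.1), b.2.2) := by fun_prop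
  have hprob : ∀ t, IsProbabilityMeasure ((H t).map fun a => (a.1.1, a.1.2, a.2)) := fun t =>
    Measure.isProbabilityMeasure_map hα.aemeasurable
  have hfst : ∀ t, ((H t).map fun a => (a.1.1, a.1.2, a.2)).map Prod.fst =
      (H t).map fun a => a.1.1 := fun t => by
    rw [Measure.map_map measurable_fst hα]; rfl
  have hback : ∀ t, ((H t).map fun a => (a.1.1, a.1.2, a.2)).map
      (fun b => ((b.1, b.2.1), b.2.2)) = H t := fun t => by
    rw [Measure.map_map hα' hα]
    exact Measure.map_id
  obtain ⟨Q, hQ, h1, h0⟩ := exists_coupling (ρ := (H true).map fun a => (a.1.1, a.1.2, a.2))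
    (ρ' := (H false).map fun a => (a.1.1, a.1.2, a.2)) (by rw [hfst, hfst, hX])
  set j : 𝒳 × (𝒮 × ℝ) × 𝒮 × ℝ → PotData 𝒳 𝒮 := fun q =>
    (q.1, fun t => if t = true then q.2.1.1 else q.2.2.1,
      fun t => if t = true then q.2.1.2 else q.2.2.2) with hj
  have hjm : Measurable j := by
    refine measurable_fst.prodMk (Measurable.prodMk (measurable_pi_lambda _ fun t => ?_)
      (measurable_pi_lambda _ fun t => ?_)) <;> cases t <;>
      simp only [if_true, if_false, Bool.false_eq_true] <;> fun_prop
  refine ⟨Q.map j, Measure.isProbabilityMeasure_map hjm.aemeasurable, fun t => ?_⟩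
  rw [Measure.map_map (measurable_potArm t) hjm, ← hback t]
  cases t
  · rw [← h0, Measure.map_map hα' (by fun_prop)]; rfl
  · rw [← h1, Measure.map_map hα' (by fun_prop)]; rfl

/-- The law of a unit with potential variables drawn from `V`, when treatment and labelling are
assigned with the propensity scores `e` and `r`. -/
noncomputable def assignLaw (V : Measure (PotData 𝒳 𝒮)) (e : 𝒳 → ℝ) (r : Bool → 𝒳 → 𝒮 → ℝ) :
    Measure (FullData 𝒳 𝒮) :=
  ∑ i : Bool × Bool, (V.withDensity fun v => ENNReal.ofReal (assignProb e r i v)).map (assign i)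

variable {V : Measure (PotData 𝒳 𝒮)} {e : 𝒳 → ℝ} {r : Bool → 𝒳 → 𝒮 → ℝ} {ε : ℝ}

/-- The four summands of `assignLaw` live on the four values of (T, R), so restricting to I selects
the corresponding ones. -/
theorem map_potData_restrict_assignLaw (I : Finset (Bool × Bool)) :
    ((assignLaw V e r).restrict {z | (treatT z, labelR z) ∈ I}).map potData =
      ∑ i ∈ I, V.withDensity fun v => ENNReal.ofReal (assignProb e r i v) := by
  have hI : MeasurableSet {z : FullData 𝒳 𝒮 | (treatT z, labelR z) ∈ I} :=
    (measurable_treatT.prodMk measurable_labelR) I.measurableSet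
  ext s hs
  rw [Measure.map_apply measurable_potData hs,
    Measure.restrict_apply (measurable_potData hs), assignLaw]
  simp only [Measure.coe_finsetSum, Finset.sum_apply]
  rw [← Finset.sum_subset (Finset.subset_univ I)]
  · refine Finset.sum_congr rfl fun i hi => ?_
    rw [Measure.map_apply (measurable_assign i) ((measurable_potData hs).inter hI)]
    congr 1
    ext v
    simp only [Set.preimage_inter, Set.mem_inter_iff, Set.mem_preimage, Set.mem_ofPred_eq]
    exact and_iff_left (show (i.1, i.2) ∈ I from hi)
  · intro i _ hi
    rw [Measure.map_apply (measurable_assign i) ((measurable_potData hs).inter hI)]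
    convert measure_empty (μ := V.withDensity fun v => ENNReal.ofReal (assignProb e r i v))
    rw [Set.eq_empty_iff_forall_notMem]
    exact fun v hv => hi hv.2

/-- Assignment uses only X and S(T). Summing over R (r + (1 - r) = 1) leaves the density e_t on {T =
t}, and summing over T (e + (1 - e) = 1) returns V; the identities for the arms are images of these.
-/
theorem isIdentified_assignLaw (hε : 0 < ε) (he : Measurable e)
    (hr : Measurable fun p : Bool × 𝒳 × 𝒮 => r p.1 p.2.1 p.2.2) (he0 : ∀ x, ε ≤ e x)
    (he1 : ∀ x, e x ≤ 1 - ε) (hr0 : ∀ t x s, ε ≤ r t x s) (hr1 : ∀ t x s, r t x s ≤ 1)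
    [IsProbabilityMeasure V] :
    ∃ P : ProbabilityMeasure (FullData 𝒳 𝒮), IsIdentified ε P e r ∧
      ∀ t, (P : Measure (FullData 𝒳 𝒮)).map (armData t) = V.map (potArm t) := by
  have hp0 := armPropensity_nonneg (fun x => hε.le.trans (he0 x))
    (fun x => (he1 x).trans (by linarith))
  have hpm : ∀ t, Measurable fun v : PotData 𝒳 𝒮 => armPropensity e t v.1 := fun t =>
    (measurable_armPropensity he t).comp measurable_fst
  have hrm : ∀ t, Measurable fun v : PotData 𝒳 𝒮 => r t v.1 (v.2.1 t) := fun t =>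
    hr.comp (measurable_const.prodMk (measurable_fst.prodMk
      ((measurable_pi_apply t).comp measurable_snd.fst)))
  have hwm : ∀ i, Measurable fun v : PotData 𝒳 𝒮 => ENNReal.ofReal (assignProb e r i v) := by
    rintro ⟨t, ρ⟩
    refine ((hpm t).mul ?_).ennreal_ofReal
    cases ρ
    · exact measurable_const.sub (hrm t)
    · exact hrm t
  have hT : ∀ t, ((assignLaw V e r).restrict {z | treatT z = t}).map potData =
      V.withDensity fun v => ENNReal.ofReal (armPropensity e t v.1) := fun t => by
    have h := map_potData_restrict_assignLaw (V := V) (e := e) (r := r) {(t, true), (t, false)}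
    have hs : {z : FullData 𝒳 𝒮 | (treatT z, labelR z) ∈
        ({(t, true), (t, false)} : Finset (Bool × Bool))} = {z | treatT z = t} := by
      ext z
      cases hz : labelR z <;> simp [hz]
    rw [hs, Finset.sum_pair (by simp), ← withDensity_add_left (hwm _)] at h
    rw [h]
    congr 1
    ext v
    rw [Pi.add_apply, ← ENNReal.ofReal_add]
    · simp only [assignProb, if_true, Bool.false_eq_true, if_false]
      congr 1
      ring
    · exact mul_nonneg (hp0 _ _) (by simpa using hε.le.trans (hr0 _ _ _))
    · exact mul_nonneg (hp0 _ _) (by simpa using hr1 _ _ _)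
  have hL : ∀ t, ((assignLaw V e r).restrict {z | treatT z = t ∧ labelR z = true}).map potData =
      V.withDensity fun v => ENNReal.ofReal (armPropensity e t v.1 * r t v.1 (v.2.1 t)) :=
      fun t => by
    have h := map_potData_restrict_assignLaw (V := V) (e := e) (r := r) {(t, true)}
    have hs : {z : FullData 𝒳 𝒮 | (treatT z, labelR z) ∈ ({(t, true)} : Finset (Bool × Bool))} =
        {z | treatT z = t ∧ labelR z = true} := by
      ext z
      simp
    rw [hs, Finset.sum_singleton] at h
    rw [h]
    simp [assignProb]
  have hV : (assignLaw V e r).map potData = V := by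
    have hd : (assignLaw V e r).restrict {z | treatT z = true} +
        (assignLaw V e r).restrict {z | treatT z = false} = assignLaw V e r := by
      have := Measure.restrict_add_restrict_compl (μ := assignLaw V e r)
        (measurableSet_treatT_eq (𝒳 := 𝒳) (𝒮 := 𝒮) true)
      convert this using 3
      ext z
      simp
    rw [← hd, Measure.map_add _ _ measurable_potData, hT, hT,
      ← withDensity_add_left (hpm true).ennreal_ofReal]
    conv_rhs => rw [← withDensity_one (μ := V)]
    congr 1
    ext v
    rw [Pi.add_apply, ← ENNReal.ofReal_add (hp0 _ _) (hp0 _ _)]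
    simp [armPropensity]
  have hprob : IsProbabilityMeasure (assignLaw V e r) := by
    constructor
    have h1 : (assignLaw V e r).map potData Set.univ = 1 := by
      rw [hV]
      exact measure_univ
    rwa [Measure.map_apply measurable_potData MeasurableSet.univ, Set.preimage_univ] at h1
  have harm : ∀ (t : Bool) (μ : Measure (FullData 𝒳 𝒮)),
      μ.map (armData t) = (μ.map potData).map (potArm t) := fun t μ => by
    rw [Measure.map_map (measurable_potArm t) measurable_potData]
    rfl
  have hpa : ∀ t, Measurable fun a : (𝒳 × 𝒮) × ℝ => ENNReal.ofReal (armPropensity e t a.1.1) :=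
    fun t => ((measurable_armPropensity he t).comp measurable_fst.fst).ennreal_ofReal
  have hra : ∀ t, Measurable fun a : (𝒳 × 𝒮) × ℝ =>
      ENNReal.ofReal (armPropensity e t a.1.1 * r t a.1.1 a.1.2) := fun t =>
    (((measurable_armPropensity he t).comp measurable_fst.fst).mul
      (hr.comp (measurable_const.prodMk measurable_fst))).ennreal_ofReal
  refine ⟨⟨assignLaw V e r, hprob⟩, ⟨he, hr, he0, he1, hr0, hr1, fun t => ?_, fun t => ?_⟩,
    fun t => ?_⟩
  · simp only [ProbabilityMeasure.coe_mk]
    rw [harm, harm t (assignLaw V e r), hT, hV,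
      ← map_withDensity_comp (measurable_potArm t) (hpa t)]
    rfl
  · simp only [ProbabilityMeasure.coe_mk]
    rw [harm, harm t (assignLaw V e r), hL, hV,
      ← map_withDensity_comp (measurable_potArm t) (hra t)]
    rfl
  · simp only [ProbabilityMeasure.coe_mk]
    rw [harm, hV]

/-- Laws of the two arms with the same covariate law and arbitrary propensity scores come from a
law of the full data. -/
theorem exists_isIdentified_of_arms [StandardBorelSpace 𝒮] {H : Bool → Measure ((𝒳 × 𝒮) × ℝ)}
    (hH : ∀ t, IsProbabilityMeasure (H t))
    (hX : (H true).map (fun a => a.1.1) = (H false).map fun a => a.1.1)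
    {P : ProbabilityMeasure (FullData 𝒳 𝒮)} (hε : 0 < ε) (h : IsIdentified ε P e r) :
    ∃ P' : ProbabilityMeasure (FullData 𝒳 𝒮), IsIdentified ε P' e r ∧
      ∀ t, (P' : Measure (FullData 𝒳 𝒮)).map (armData t) = H t := by
  obtain ⟨V, hV, hVH⟩ := exists_potData_law hH hX
  obtain ⟨P', h1, h2⟩ := isIdentified_assignLaw (V := V) hε h.measurable_e h.measurable_r h.le_e
    h.e_le h.le_r h.r_le
  exact ⟨P', h1, fun t => (h2 t).trans (hVH t)⟩

end Assignment

end SurrogateATE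

/-! ### From identification back to the model and to the observed law -/

namespace SurrogateATE

theorem withDensity_comm {Ω : Type*} [MeasurableSpace Ω] {μ : Measure Ω} {f g : Ω → ℝ≥0∞}
    (hf : Measurable f) (hg : Measurable g) :
    (μ.withDensity f).withDensity g = (μ.withDensity g).withDensity f := by
  rw [← withDensity_mul _ hf hg, ← withDensity_mul _ hg hf, mul_comm]

variable {𝒳 𝒮 : Type*} [MeasurableSpace 𝒳] [MeasurableSpace 𝒮]
  {P : ProbabilityMeasure (FullData 𝒳 𝒮)} {e : 𝒳 → ℝ} {r : Bool → 𝒳 → 𝒮 → ℝ} {ε : ℝ}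

namespace IsIdentified

theorem isTreatmentPropensity (hε : 0 < ε) (h : IsIdentified ε P e r) :
    IsTreatmentPropensity P e := by
  rw [isTreatmentPropensity_iff h.measurable_e (fun x => hε.le.trans (h.le_e x))
    (fun x => (h.e_le x).trans (by linarith))]
  refine IsSuccessProbability.comp (φ := armData true) (θ := fun a => a.1.1)
    (measurable_armData true) measurable_fst.fst h.measurable_e ?_
  have := h.map_arm true
  exact this

theorem isSuccessProbability_label (hε : 0 < ε) (h : IsIdentified ε P e r) (t : Bool) :
    IsSuccessProbability ((P : Measure (FullData 𝒳 𝒮)).restrict {z | treatT z = t}) labelR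
      (armData t) fun a => r t a.1.1 a.1.2 := by
  have hs : {z : FullData 𝒳 𝒮 | labelR z = true} ∩ {z | treatT z = t} =
      {z | treatT z = t ∧ labelR z = true} := by
    ext z
    exact and_comm
  have hp : Measurable fun a : (𝒳 × 𝒮) × ℝ => armPropensity e t a.1.1 :=
    (measurable_armPropensity h.measurable_e t).comp measurable_fst.fst
  have hr : Measurable fun a : (𝒳 × 𝒮) × ℝ => r t a.1.1 a.1.2 :=
    h.measurable_r.comp (measurable_const.prodMk measurable_fst)
  rw [IsSuccessProbability, Measure.restrict_restrict (measurableSet_labelR_eq true), hs,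
    h.map_label, h.map_arm, ← withDensity_mul _ hp.ennreal_ofReal hr.ennreal_ofReal]
  congr 1
  ext a
  rw [Pi.mul_apply, ENNReal.ofReal_mul (hε.le.trans (h.le_armPropensity t _))]

theorem isLabelPropensity [StandardBorelSpace 𝒳] [StandardBorelSpace 𝒮] (hε : 0 < ε)
    (h : IsIdentified ε P e r) :
    IsLabelPropensity P r := by
  rw [isLabelPropensity_iff h.measurable_r (fun t x s => hε.le.trans (h.le_r t x s)) h.r_le]
  intro t
  exact IsSuccessProbability.comp (φ := armData t) (θ := fun a => a.1)
    (q := fun a : 𝒳 × 𝒮 => r t a.1 a.2)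
    (measurable_armData t) measurable_fst (h.measurable_r.comp (measurable_const.prodMk
      measurable_id)) (h.isSuccessProbability_label hε t)

/-- The identities give success probabilities given (X, S(t), Y(t)) that depend only on X,
respectively on (X, S(t)); this is conditional independence. -/
theorem mem_model [StandardBorelSpace 𝒳] [StandardBorelSpace 𝒮] (hε : 0 < ε)
    (h : IsIdentified ε P e r) (hY : ∀ t, MemLp (potY t) 2 (P : Measure (FullData 𝒳 𝒮))) :
    P ∈ model 𝒳 𝒮 ε := by
  have hT := h.isTreatmentPropensity hε
  have hL := h.isLabelPropensity hε
  have he0 : ∀ x, 0 ≤ e x := fun x => hε.le.trans (h.le_e x)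
  have he1 : ∀ x, e x ≤ 1 := fun x => (h.e_le x).trans (by linarith)
  refine ⟨fun t => ?_, ?_, ⟨⟨e, hT, ae_of_all _ fun z => ⟨h.le_e _, h.e_le _⟩⟩,
    ⟨r, hL, fun t => ae_of_all _ fun z => ⟨h.le_r _ _ _, h.r_le _ _ _⟩⟩⟩, hY⟩
  · have hb : Measurable fun z : FullData 𝒳 𝒮 => treatT z == t :=
      (measurable_of_finite (· == t)).comp measurable_treatT
    have hg : Measurable fun z : FullData 𝒳 𝒮 => (potY t z, potS t z) :=
      (measurable_potY t).prodMk (measurable_potS t)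
    have h1 := isSuccessProbability_armPropensity h.measurable_e he0 he1
      ((isTreatmentPropensity_iff h.measurable_e he0 he1).1 hT) t
    have hp := measurable_armPropensity h.measurable_e t
    have h2 : IsSuccessProbability (P : Measure (FullData 𝒳 𝒮)) (fun z => treatT z == t)
        (armData t) fun a => armPropensity e t a.1.1 := by
      rw [IsSuccessProbability, setOf_treatT_beq]
      exact h.map_arm t
    have hθ : Measurable fun a : (𝒳 × 𝒮) × ℝ => (a.1.1, a.2, a.1.2) := by fun_prop
    have h3 := IsSuccessProbability.comp (q := fun x : 𝒳 × ℝ × 𝒮 => armPropensity e t x.1)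
      (measurable_armData t) hθ (hp.comp measurable_fst) h2
    have h4 := (condIndepFun_iff_isSuccessProbability hb measurable_covX hg hp
      (armPropensity_nonneg he0 he1 t) (armPropensity_le_one he0 he1 t) h1).2 h3
    -- Independence is so far known for the indicator of T = t; comparing that indicator with t once
    -- more recovers T, for either value of t.
    have h5 := h4.comp measurable_id (measurable_of_finite (· == t))
    have e5 : (· == t) ∘ (fun z : FullData 𝒳 𝒮 => treatT z == t) = treatT := by
      funext z
      cases t <;> simp
    rw [e5] at h5
    exact h5
  · rw [missingAtRandom_iff h.measurable_r (fun t x s => hε.le.trans (h.le_r t x s)) h.r_le hL]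
    intro t
    have h1 := h.isSuccessProbability_label hε t
    rw [IsSuccessProbability, Measure.restrict_restrict (measurableSet_labelR_eq true)] at h1
    rw [← h1]
    congr 2
    ext z
    exact and_comm

/-- The labelled and unlabelled parts add up to arm t, and the labelled part, being a finite
measure, can be cancelled. -/
theorem map_unlabel (hε : 0 < ε) (h : IsIdentified ε P e r) (t : Bool) :
    ((P : Measure (FullData 𝒳 𝒮)).restrict {z | treatT z = t ∧ labelR z = false}).map
        (armData t) =
      ((P : Measure (FullData 𝒳 𝒮)).map (armData t)).withDensity fun a =>
        ENNReal.ofReal (armPropensity e t a.1.1 * (1 - r t a.1.1 a.1.2)) := by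
  have hsplit : (P : Measure (FullData 𝒳 𝒮)).restrict {z | treatT z = t ∧ labelR z = true} +
      (P : Measure (FullData 𝒳 𝒮)).restrict {z | treatT z = t ∧ labelR z = false} =
      (P : Measure (FullData 𝒳 𝒮)).restrict {z | treatT z = t} := by
    have h1 : {z : FullData 𝒳 𝒮 | treatT z = t ∧ labelR z = true} =
        {z | treatT z = t} ∩ {z | labelR z = true} := rfl
    have h2 : {z : FullData 𝒳 𝒮 | treatT z = t ∧ labelR z = false} =
        {z | treatT z = t} \ {z | labelR z = true} := by
      ext z
      simp
    rw [h1, h2]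
    exact Measure.restrict_inter_add_sdiff _ (measurableSet_labelR_eq true)
  have hl : Measurable fun a : (𝒳 × 𝒮) × ℝ => armPropensity e t a.1.1 * r t a.1.1 a.1.2 :=
    (h.measurable_label t).comp measurable_fst
  have h3 := congrArg (fun μ : Measure (FullData 𝒳 𝒮) => μ.map (armData t)) hsplit
  simp only [Measure.map_add _ _ (measurable_armData t), h.map_arm, h.map_label] at h3
  have h4 : ((P : Measure (FullData 𝒳 𝒮)).map (armData t)).withDensity (fun a =>
      ENNReal.ofReal (armPropensity e t a.1.1)) =
      ((P : Measure (FullData 𝒳 𝒮)).map (armData t)).withDensity (fun a =>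
        ENNReal.ofReal (armPropensity e t a.1.1 * r t a.1.1 a.1.2)) +
      ((P : Measure (FullData 𝒳 𝒮)).map (armData t)).withDensity fun a =>
        ENNReal.ofReal (armPropensity e t a.1.1 * (1 - r t a.1.1 a.1.2)) := by
    rw [← withDensity_add_left hl.ennreal_ofReal]
    congr 1
    ext a
    have h0 := hε.le.trans (h.le_armPropensity t a.1.1)
    rw [Pi.add_apply, ← ENNReal.ofReal_add (mul_nonneg h0 (hε.le.trans (h.le_r _ _ _)))
      (mul_nonneg h0 (sub_nonneg.2 (h.r_le _ _ _)))]
    congr 1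
    ring
  have hfin : IsFiniteMeasure (((P : Measure (FullData 𝒳 𝒮)).map (armData t)).withDensity
      fun a => ENNReal.ofReal (armPropensity e t a.1.1 * r t a.1.1 a.1.2)) := by
    rw [← h.map_label]
    infer_instance
  rw [h4] at h3
  ext s hs
  have h5 := congrArg (fun μ : Measure ((𝒳 × 𝒮) × ℝ) => μ s) h3
  simp only [Measure.add_apply] at h5
  exact (ENNReal.add_right_inj (measure_ne_top _ _)).1 h5

end IsIdentified

/-- The observation of a labelled unit in arm `t`. -/
def obsOfLabelled (t : Bool) (p : (𝒳 × 𝒮) × ℝ) : ObsData 𝒳 𝒮 := (p.1.1, t, p.1.2, true, p.2)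

/-- The observation of an unlabelled unit in arm `t`. -/
def obsOfUnlabelled (t : Bool) (a : 𝒳 × 𝒮) : ObsData 𝒳 𝒮 := (a.1, t, a.2, false, 0)

theorem measurable_obsOfLabelled (t : Bool) :
    Measurable (obsOfLabelled t : (𝒳 × 𝒮) × ℝ → _) := by
  unfold obsOfLabelled; fun_prop

theorem measurable_obsOfUnlabelled (t : Bool) :
    Measurable (obsOfUnlabelled t : 𝒳 × 𝒮 → _) := by
  unfold obsOfUnlabelled; fun_prop

/-- The law of the observed data in terms of the laws of the arms. -/
theorem IsIdentified.obsLaw_eq (hε : 0 < ε) (h : IsIdentified ε P e r) :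
    obsLaw P = ∑ t : Bool, ((((P : Measure (FullData 𝒳 𝒮)).map (armData t)).withDensity fun p =>
        ENNReal.ofReal (armPropensity e t p.1.1 * r t p.1.1 p.1.2)).map (obsOfLabelled t) +
      ((((P : Measure (FullData 𝒳 𝒮)).map (armData t)).map Prod.fst).withDensity fun a =>
        ENNReal.ofReal (armPropensity e t a.1 * (1 - r t a.1 a.2))).map (obsOfUnlabelled t)) := by
  set Q := (P : Measure (FullData 𝒳 𝒮)) with hQ
  have hm1 : ∀ t, Measurable fun a : 𝒳 × 𝒮 =>
      ENNReal.ofReal (armPropensity e t a.1 * (1 - r t a.1 a.2)) := fun t =>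
    (((measurable_armPropensity h.measurable_e t).comp measurable_fst).mul
      (measurable_const.sub (h.measurable_r.comp
        (measurable_const.prodMk measurable_id)))).ennreal_ofReal
  have hs : ∀ t ρ, MeasurableSet {z : FullData 𝒳 𝒮 | treatT z = t ∧ labelR z = ρ} := fun t ρ =>
    (measurableSet_treatT_eq t).inter (measurableSet_labelR_eq ρ)
  have hL : ∀ t, (Q.restrict {z | treatT z = t ∧ labelR z = true}).map obs =
      ((Q.map (armData t)).withDensity fun p =>
        ENNReal.ofReal (armPropensity e t p.1.1 * r t p.1.1 p.1.2)).map (obsOfLabelled t) := by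
    intro t
    rw [← h.map_label, Measure.map_map (measurable_obsOfLabelled t) (measurable_armData t)]
    refine Measure.map_congr ((ae_restrict_iff' (hs t true)).2 (ae_of_all _ fun z hz => ?_))
    simp [obs, obsOfLabelled, armData, surS, outY, hz.1, hz.2]
  have hU : ∀ t, (Q.restrict {z | treatT z = t ∧ labelR z = false}).map obs =
      (((Q.map (armData t)).map Prod.fst).withDensity fun a =>
        ENNReal.ofReal (armPropensity e t a.1 * (1 - r t a.1 a.2))).map (obsOfUnlabelled t) := by
    intro t
    rw [← map_withDensity_comp measurable_fst (hm1 t), ← h.map_unlabel hε,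
      Measure.map_map measurable_fst (measurable_armData t),
      Measure.map_map (measurable_obsOfUnlabelled t) (measurable_fst.comp (measurable_armData t))]
    refine Measure.map_congr ((ae_restrict_iff' (hs t false)).2 (ae_of_all _ fun z hz => ?_))
    simp [obs, obsOfUnlabelled, armData, surS, hz.1, hz.2]
  have hsplit : Q = ∑ t : Bool, (Q.restrict {z | treatT z = t ∧ labelR z = true} +
      Q.restrict {z | treatT z = t ∧ labelR z = false}) := by
    have h1 : ∀ t, Q.restrict {z | treatT z = t ∧ labelR z = true} +
        Q.restrict {z | treatT z = t ∧ labelR z = false} = Q.restrict {z | treatT z = t} := by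
      intro t
      have h2 : {z : FullData 𝒳 𝒮 | treatT z = t ∧ labelR z = false} =
          {z | treatT z = t} \ {z | labelR z = true} := by
        ext z
        simp
      rw [h2]
      exact Measure.restrict_inter_add_sdiff _ (measurableSet_labelR_eq true)
    simp only [h1, Fintype.sum_bool]
    have := Measure.restrict_add_restrict_compl (μ := Q)
      (measurableSet_treatT_eq (𝒳 := 𝒳) (𝒮 := 𝒮) true)
    conv_lhs => rw [← this]
    congr 2
    ext z
    simp
  simp only [← hL, ← hU, ← Measure.map_add _ _ measurable_obs, Fintype.sum_bool]
  rw [obsLaw, ← hQ]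
  conv_lhs => rw [hsplit]
  rw [Fintype.sum_bool]

/-- If the arms are tilted and the propensity scores do not change, then the law of the observed
data is tilted. -/
theorem IsIdentified.obsLaw_eq_withDensity (hε : 0 < ε) (h : IsIdentified ε P e r)
    {P' : ProbabilityMeasure (FullData 𝒳 𝒮)} (h' : IsIdentified ε P' e r)
    {G : ObsData 𝒳 𝒮 → ℝ≥0∞} (hG : Measurable G)
    (hL : ∀ t, (P' : Measure (FullData 𝒳 𝒮)).map (armData t) =
      ((P : Measure (FullData 𝒳 𝒮)).map (armData t)).withDensity fun p => G (obsOfLabelled t p))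
    (hU : ∀ t, ((P' : Measure (FullData 𝒳 𝒮)).map (armData t)).map Prod.fst =
      (((P : Measure (FullData 𝒳 𝒮)).map (armData t)).map Prod.fst).withDensity fun a =>
        G (obsOfUnlabelled t a)) :
    obsLaw P' = (obsLaw P).withDensity G := by
  have hm1 : ∀ t, Measurable fun a : 𝒳 × 𝒮 =>
      ENNReal.ofReal (armPropensity e t a.1 * (1 - r t a.1 a.2)) := fun t =>
    (((measurable_armPropensity h.measurable_e t).comp measurable_fst).mul
      (measurable_const.sub (h.measurable_r.comp
        (measurable_const.prodMk measurable_id)))).ennreal_ofReal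
  have hl : ∀ t, Measurable fun a : (𝒳 × 𝒮) × ℝ =>
      ENNReal.ofReal (armPropensity e t a.1.1 * r t a.1.1 a.1.2) := fun t =>
    ((h.measurable_label t).comp measurable_fst).ennreal_ofReal
  rw [h.obsLaw_eq hε, h'.obsLaw_eq hε]
  simp only [Fintype.sum_bool, withDensity_add_measure, hU]
  have hGL : ∀ t, Measurable fun p => G (obsOfLabelled t p) := fun t =>
    hG.comp (measurable_obsOfLabelled t)
  have hGU : ∀ t, Measurable fun p => G (obsOfUnlabelled t p) := fun t =>
    hG.comp (measurable_obsOfUnlabelled t)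
  simp only [hL]
  simp only [withDensity_comm (hGL _) (hl _), withDensity_comm (hGU _) (hm1 _),
    map_withDensity_comp (measurable_obsOfLabelled _) hG,
    map_withDensity_comp (measurable_obsOfUnlabelled _) hG]

end SurrogateATE

/-! ### Bounded tilts of the two arms -/

namespace SurrogateATE

section General

variable {Ω A : Type*} [MeasurableSpace Ω] [MeasurableSpace A] {μ : Measure Ω} {f : Ω → ℝ}
  {φ : Ω → A} {M : A → ℝ}

theorem IsRegression.affine (hM : IsRegression μ f φ M) (hf : MemLp f 2 μ) {h : A → ℝ}
    (hh : Measurable h) (hhL : MemLp (fun ω => h (φ ω)) 2 μ) (c : ℝ) :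
    IsRegression μ (fun ω => h (φ ω) + c * f ω) φ fun a => h a + c * M a := by
  refine ⟨hh.add (hM.measurable.const_mul c), hhL.add (hM.memLp.const_mul c), fun k hk hkL => ?_⟩
  have i1 := integrable_mul_of_memLp_two hhL hkL
  have i2 := (integrable_mul_of_memLp_two hf hkL).const_mul c
  have i3 := (integrable_mul_of_memLp_two hM.memLp hkL).const_mul c
  have e1 : ∀ ω, (h (φ ω) + c * f ω) * k (φ ω) = h (φ ω) * k (φ ω) + c * (f ω * k (φ ω)) :=
    fun ω => by ring
  have e2 : ∀ ω, (h (φ ω) + c * M (φ ω)) * k (φ ω) =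
      h (φ ω) * k (φ ω) + c * (M (φ ω) * k (φ ω)) := fun ω => by ring
  simp only [e1, e2]
  rw [integral_add i1 i2, integral_add i1 i3, integral_const_mul, integral_const_mul,
    hM.integral_mul k hk hkL]

/-- The image of a density is its regression. -/
theorem IsRegression.map_withDensity [IsFiniteMeasure μ] (hM : IsRegression μ f φ M)
    (hf : Integrable f μ) (hφ : Measurable φ) (hf0 : ∀ ω, 0 ≤ f ω) (hM0 : ∀ a, 0 ≤ M a) :
    (μ.withDensity fun ω => ENNReal.ofReal (f ω)).map φ =
      (μ.map φ).withDensity fun a => ENNReal.ofReal (M a) := by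
  ext s hs
  rw [Measure.map_apply hφ hs, withDensity_apply _ (hφ hs), withDensity_apply _ hs,
    setLIntegral_map hs hM.measurable.ennreal_ofReal hφ,
    ← ofReal_integral_eq_lintegral_ofReal hf.integrableOn (ae_of_all _ hf0),
    ← ofReal_integral_eq_lintegral_ofReal (hM.memLp.integrable one_le_two).integrableOn
      (ae_of_all _ fun ω => hM0 _)]
  congr 1
  have hk : Measurable (s.indicator fun _ : A => (1 : ℝ)) := measurable_const.indicator hs
  have h := hM.integral_mul _ hk (MemLp.of_bound (hk.comp hφ).aestronglyMeasurable 1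
    (ae_of_all _ fun ω => by by_cases hω : φ ω ∈ s <;> simp [hω]))
  have e : ∀ F : Ω → ℝ, ∫ ω, F ω * s.indicator (fun _ => (1 : ℝ)) (φ ω) ∂μ =
      ∫ ω in φ ⁻¹' s, F ω ∂μ := fun F => by
    rw [← integral_indicator (hφ hs)]
    refine integral_congr_ae (ae_of_all _ fun ω => ?_)
    by_cases hω : φ ω ∈ s <;> simp [hω]
  rwa [e, e] at h

/-- With s = √(1 + x) the left side is (s - 1)²/2, and x = (s - 1)(s + 1) with s + 1 ≥ 1. -/
theorem abs_sqrt_one_add_sub_le {x : ℝ} (hx : -1 ≤ x) : |√(1 + x) - 1 - x / 2| ≤ x ^ 2 / 2 := by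
  have h0 : 0 ≤ 1 + x := by linarith
  have h1 := Real.sq_sqrt h0
  have h2 := Real.sqrt_nonneg (1 + x)
  set s := √(1 + x)
  have e1 : s - 1 - x / 2 = -((s - 1) ^ 2 / 2) := by nlinarith
  have e2 : x ^ 2 = (s - 1) ^ 2 * (s + 1) ^ 2 := by
    have : x = (s - 1) * (s + 1) := by nlinarith
    rw [this]
    ring
  rw [e1, abs_neg, abs_of_nonneg (by positivity), e2]
  have h3 : 1 ≤ (s + 1) ^ 2 := by nlinarith
  nlinarith [sq_nonneg (s - 1)]

end General

variable {𝒳 𝒮 : Type*} [MeasurableSpace 𝒳] [MeasurableSpace 𝒮]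
  {P : ProbabilityMeasure (FullData 𝒳 𝒮)} {e : 𝒳 → ℝ} {r : Bool → 𝒳 → 𝒮 → ℝ} {ε : ℝ}

/-- Bounded directions in which the law of the covariates and the conditional laws of the arms
given the covariates can be perturbed; `b` is the regression of `β` on the surrogates. -/
structure IsTilt (P : ProbabilityMeasure (FullData 𝒳 𝒮)) (a : 𝒳 → ℝ)
    (β : Bool → (𝒳 × 𝒮) × ℝ → ℝ) (b : Bool → 𝒳 × 𝒮 → ℝ) (B : ℝ) : Prop where
  measurable_a : Measurable a
  measurable_β : ∀ t, Measurable (β t)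
  bound_a : ∀ x, |a x| ≤ B
  bound_β : ∀ t p, |a p.1.1 + β t p| ≤ B
  bound_b : ∀ t p, |a p.1 + b t p| ≤ B
  integral_a : ∫ z, a (covX z) ∂(P : Measure (FullData 𝒳 𝒮)) = 0
  regression_X : ∀ t, IsRegression ((P : Measure (FullData 𝒳 𝒮)).map (armData t)) (β t)
    (fun p => p.1.1) fun _ => 0
  regression_XS : ∀ t, IsRegression ((P : Measure (FullData 𝒳 𝒮)).map (armData t)) (β t)
    Prod.fst (b t)

/-- The score of a perturbation. -/
noncomputable def tiltScore (a : 𝒳 → ℝ) (β : Bool → (𝒳 × 𝒮) × ℝ → ℝ) (b : Bool → 𝒳 × 𝒮 → ℝ)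
    (w : ObsData 𝒳 𝒮) : ℝ :=
  a w.1 + if w.2.2.2.1 = true then β w.2.1 (obsXSY w) else b w.2.1 (obsXS w)

namespace IsTilt

variable {a : 𝒳 → ℝ} {β : Bool → (𝒳 × 𝒮) × ℝ → ℝ} {b : Bool → 𝒳 × 𝒮 → ℝ} {B : ℝ}

theorem measurable_tiltScore (h : IsTilt P a β b B) : Measurable (tiltScore a β b) := by
  have hβ : Measurable fun q : Bool × (𝒳 × 𝒮) × ℝ => β q.1 q.2 :=
    measurable_from_prod_countable_right h.measurable_β
  have hb : Measurable fun q : Bool × 𝒳 × 𝒮 => b q.1 q.2 :=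
    measurable_from_prod_countable_right fun t => (h.regression_XS t).measurable
  exact (h.measurable_a.comp measurable_fst).add (Measurable.ite
    (measurable_snd.snd.snd.fst (measurableSet_singleton true))
    (hβ.comp (measurable_snd.fst.prodMk measurable_obsXSY))
    (hb.comp (measurable_snd.fst.prodMk measurable_obsXS)))

theorem abs_tiltScore_le (h : IsTilt P a β b B) (w : ObsData 𝒳 𝒮) : |tiltScore a β b w| ≤ B := by
  unfold tiltScore
  split_ifs
  · exact h.bound_β w.2.1 (obsXSY w)
  · exact h.bound_b w.2.1 (obsXS w)

theorem abs_mul_le {γ y B : ℝ} (hγ : |γ| * B ≤ 1 / 2) (hy : |y| ≤ B) : |γ * y| ≤ 1 / 2 := by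
  rw [abs_mul]
  exact (mul_le_mul_of_nonneg_left hy (abs_nonneg γ)).trans hγ

theorem one_add_nonneg {γ y B : ℝ} (hγ : |γ| * B ≤ 1 / 2) (hy : |y| ≤ B) : 0 ≤ 1 + γ * y := by
  have := abs_le.1 (abs_mul_le hγ hy)
  linarith

theorem one_add_le {γ y B : ℝ} (hγ : |γ| * B ≤ 1 / 2) (hy : |y| ≤ B) : 1 + γ * y ≤ 2 := by
  have := abs_le.1 (abs_mul_le hγ hy)
  linarith

theorem memLp_β (h : IsTilt P a β b B) (t : Bool) :
    MemLp (β t) 2 ((P : Measure (FullData 𝒳 𝒮)).map (armData t)) := by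
  have : IsProbabilityMeasure ((P : Measure (FullData 𝒳 𝒮)).map (armData t)) :=
    Measure.isProbabilityMeasure_map (measurable_armData t).aemeasurable
  refine MemLp.of_bound (h.measurable_β t).aestronglyMeasurable (B + B) (ae_of_all _ fun p => ?_)
  have h1 := h.bound_β t p
  have h2 := h.bound_a p.1.1
  rw [Real.norm_eq_abs]
  have : β t p = (a p.1.1 + β t p) - a p.1.1 := by ring
  rw [this]
  exact (abs_sub _ _).trans (add_le_add h1 h2)

/-- The perturbed law of an arm. -/
noncomputable def tiltedArm (P : ProbabilityMeasure (FullData 𝒳 𝒮)) (a : 𝒳 → ℝ)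
    (β : Bool → (𝒳 × 𝒮) × ℝ → ℝ) (γ : ℝ) (t : Bool) : Measure ((𝒳 × 𝒮) × ℝ) :=
  ((P : Measure (FullData 𝒳 𝒮)).map (armData t)).withDensity fun p =>
    ENNReal.ofReal (1 + γ * (a p.1.1 + β t p))

/-- Forgetting part of an arm replaces its density by the regression on what is kept. The map ξ says
that X is kept, so a is unaffected and only β is averaged; the cases needed are X and (X, S). -/
theorem map_tiltedArm {A : Type*} [MeasurableSpace A] (h : IsTilt P a β b B) {γ : ℝ}
    (hγ : |γ| * B ≤ 1 / 2) (t : Bool)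
    {φ : (𝒳 × 𝒮) × ℝ → A} (hφ : Measurable φ) {ξ : A → 𝒳} (hξ : Measurable ξ)
    (hξφ : ∀ p, ξ (φ p) = p.1.1) {M : A → ℝ}
    (hM : IsRegression ((P : Measure (FullData 𝒳 𝒮)).map (armData t)) (β t) φ M)
    (hMB : ∀ q, |a (ξ q) + M q| ≤ B) :
    (tiltedArm P a β γ t).map φ =
      (((P : Measure (FullData 𝒳 𝒮)).map (armData t)).map φ).withDensity fun q =>
        ENNReal.ofReal (1 + γ * (a (ξ q) + M q)) := by
  have : IsProbabilityMeasure ((P : Measure (FullData 𝒳 𝒮)).map (armData t)) :=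
    Measure.isProbabilityMeasure_map (measurable_armData t).aemeasurable
  have hk : Measurable fun q => 1 + γ * a (ξ q) :=
    measurable_const.add ((h.measurable_a.comp hξ).const_mul γ)
  have hkL : MemLp (fun p => 1 + γ * a (ξ (φ p))) 2
      ((P : Measure (FullData 𝒳 𝒮)).map (armData t)) := by
    refine MemLp.of_bound (hk.comp hφ).aestronglyMeasurable 2 (ae_of_all _ fun p => ?_)
    rw [Real.norm_of_nonneg (one_add_nonneg hγ (h.bound_a _))]
    exact one_add_le hγ (h.bound_a _)
  have h1 := hM.affine (h.memLp_β t) hk hkL γ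
  have h2 := h1.map_withDensity ((hkL.add ((h.memLp_β t).const_mul γ)).integrable one_le_two) hφ
    (fun p => by
      have := one_add_nonneg hγ (h.bound_β t p)
      rw [hξφ]
      linarith)
    (fun q => by
      have := one_add_nonneg hγ (hMB q)
      linarith)
  have e1 : ∀ p, 1 + γ * (a p.1.1 + β t p) = 1 + γ * a (ξ (φ p)) + γ * β t p := fun p => by
    rw [hξφ]
    ring
  have e2 : ∀ q, 1 + γ * (a (ξ q) + M q) = 1 + γ * a (ξ q) + γ * M q := fun q => by ring
  simp only [tiltedArm, e1, e2]
  exact h2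

/-- Because β t is centred given X, the result does not depend on t: the two tilted arms have a
common covariate law and can be coupled. -/
theorem map_fst_fst_tiltedArm (h : IsTilt P a β b B) {γ : ℝ} (hγ : |γ| * B ≤ 1 / 2) (t : Bool) :
    (tiltedArm P a β γ t).map (fun p => p.1.1) =
      ((P : Measure (FullData 𝒳 𝒮)).map covX).withDensity fun x =>
        ENNReal.ofReal (1 + γ * a x) := by
  rw [h.map_tiltedArm hγ t measurable_fst.fst measurable_id (fun _ => rfl) (h.regression_X t)
    (fun q => by simpa using h.bound_a q), Measure.map_map measurable_fst.fst
        (measurable_armData t)]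
  simp only [add_zero, id]
  rfl

theorem isProbabilityMeasure_tiltedArm (h : IsTilt P a β b B) {γ : ℝ} (hγ : |γ| * B ≤ 1 / 2)
    (t : Bool) : IsProbabilityMeasure (tiltedArm P a β γ t) := by
  constructor
  have hm : Measurable fun x => 1 + γ * a x := measurable_const.add (h.measurable_a.const_mul γ)
  have ha : Integrable (fun z => a (covX z)) (P : Measure (FullData 𝒳 𝒮)) :=
    Integrable.of_bound (h.measurable_a.comp measurable_covX).aestronglyMeasurable B
      (ae_of_all _ fun z => h.bound_a _)
  have h1 : (tiltedArm P a β γ t).map (fun p => p.1.1) Set.univ = 1 := by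
    have hi : Integrable (fun z => 1 + γ * a (covX z)) (P : Measure (FullData 𝒳 𝒮)) :=
      (integrable_const 1).add (ha.const_mul γ)
    rw [h.map_fst_fst_tiltedArm hγ, withDensity_apply _ MeasurableSet.univ, setLIntegral_univ,
      lintegral_map hm.ennreal_ofReal measurable_covX, ← ofReal_integral_eq_lintegral_ofReal hi
      (ae_of_all _ fun z => one_add_nonneg hγ (h.bound_a _))]
    have e1 := integral_add (integrable_const (1 : ℝ)) (ha.const_mul γ)
    rw [e1, integral_const_mul, h.integral_a]
    simp
  rwa [Measure.map_apply measurable_fst.fst MeasurableSet.univ, Set.preimage_univ] at h1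

/-- The perturbed laws of the arms come from a law with the same propensity scores. -/
theorem exists_tilted [StandardBorelSpace 𝒮] (hε : 0 < ε) (hid : IsIdentified ε P e r)
    (h : IsTilt P a β b B) {γ : ℝ} (hγ : |γ| * B ≤ 1 / 2) :
    ∃ P' : ProbabilityMeasure (FullData 𝒳 𝒮), IsIdentified ε P' e r ∧
      (∀ t, (P' : Measure (FullData 𝒳 𝒮)).map (armData t) = tiltedArm P a β γ t) ∧
      obsLaw P' = (obsLaw P).withDensity fun w => ENNReal.ofReal (1 + γ * tiltScore a β b w) := by
  obtain ⟨P', h1, h2⟩ := exists_isIdentified_of_arms (h.isProbabilityMeasure_tiltedArm hγ)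
    (by rw [h.map_fst_fst_tiltedArm hγ, h.map_fst_fst_tiltedArm hγ]) hε hid
  refine ⟨P', h1, h2, hid.obsLaw_eq_withDensity hε h1
    (measurable_const.add (h.measurable_tiltScore.const_mul γ)).ennreal_ofReal (fun t => ?_)
    fun t => ?_⟩
  · rw [h2]
    rfl
  · rw [h2, h.map_tiltedArm hγ t measurable_fst measurable_fst (fun _ => rfl)
      (h.regression_XS t) (h.bound_b t)]
    rfl

/-- For |γ| B ≤ 1/2 the tilt is at most 2. This yields both square integrability and the uniform
moment bound along the path. -/
theorem lintegral_sq_tiltedArm_le (h : IsTilt P a β b B) {γ : ℝ} (hγ : |γ| * B ≤ 1 / 2) (t : Bool)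
    {P' : ProbabilityMeasure (FullData 𝒳 𝒮)}
    (hP' : (P' : Measure (FullData 𝒳 𝒮)).map (armData t) = tiltedArm P a β γ t) :
    ∫⁻ z, ENNReal.ofReal (potY t z ^ 2) ∂(P' : Measure (FullData 𝒳 𝒮)) ≤
      2 * ∫⁻ z, ENNReal.ofReal (potY t z ^ 2) ∂(P : Measure (FullData 𝒳 𝒮)) := by
  have hm : Measurable fun p : (𝒳 × 𝒮) × ℝ => ENNReal.ofReal (p.2 ^ 2) :=
    (measurable_snd.pow_const 2).ennreal_ofReal
  have hd : Measurable fun p : (𝒳 × 𝒮) × ℝ => ENNReal.ofReal (1 + γ * (a p.1.1 + β t p)) :=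
    (measurable_const.add (((h.measurable_a.comp measurable_fst.fst).add
      (h.measurable_β t)).const_mul γ)).ennreal_ofReal
  have e1 : ∀ Q : ProbabilityMeasure (FullData 𝒳 𝒮),
      ∫⁻ z, ENNReal.ofReal (potY t z ^ 2) ∂(Q : Measure (FullData 𝒳 𝒮)) =
        ∫⁻ p, ENNReal.ofReal (p.2 ^ 2) ∂((Q : Measure (FullData 𝒳 𝒮)).map (armData t)) := fun Q =>
    (lintegral_map hm (measurable_armData t)).symm
  rw [e1, e1, hP', tiltedArm, lintegral_withDensity_eq_lintegral_mul _ hd hm,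
    ← lintegral_const_mul' _ _ (by simp)]
  refine lintegral_mono fun p => ?_
  rw [Pi.mul_apply]
  refine mul_le_mul_left ?_ _
  rw [← ENNReal.ofReal_ofNat]
  exact ENNReal.ofReal_le_ofReal (one_add_le hγ (h.bound_β t p))

end IsTilt

end SurrogateATE

/-! ### Regular submodels from bounded tilts -/

namespace SurrogateATE

variable {𝒳 𝒮 : Type*} [MeasurableSpace 𝒳] [MeasurableSpace 𝒮] [StandardBorelSpace 𝒳]
  [StandardBorelSpace 𝒮] {P : ProbabilityMeasure (FullData 𝒳 𝒮)} {e : 𝒳 → ℝ}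
  {r : Bool → 𝒳 → 𝒮 → ℝ} {ε : ℝ}

/-- A law with the propensity scores of `P` and arms which are absolutely continuous with respect
to those of `P` belongs to the same submodels as `P`. -/
theorem mem_modelWith_of_isIdentified (hε : 0 < ε) (hε' : ε < 1 / 2) (hP : P ∈ model 𝒳 𝒮 ε)
    (he : IsTreatmentPropensity P e) (hr : IsLabelPropensity P r) (knownE knownR : Prop)
    {P' : ProbabilityMeasure (FullData 𝒳 𝒮)}
    (h' : IsIdentified ε P' (fun x => clamp ε (1 - ε) (e x)) fun t x s => clamp ε 1 (r t x s))
    (hac : ∀ t, (P' : Measure (FullData 𝒳 𝒮)).map (armData t) ≪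
      (P : Measure (FullData 𝒳 𝒮)).map (armData t))
    (hY : ∀ t, MemLp (potY t) 2 (P' : Measure (FullData 𝒳 𝒮))) :
    P' ∈ modelWith ε knownE knownR e r := by
  -- P' is identified through truncated scores, while the submodel fixes e and r themselves. They
  -- agree almost surely under P, and absolute continuity of the arms carries this over to P'.
  have hae : ∀ (t : Bool) (p : (𝒳 × 𝒮) × ℝ → Prop), MeasurableSet {a | p a} →
      (∀ᵐ z ∂(P : Measure (FullData 𝒳 𝒮)), p (armData t z)) →
      ∀ᵐ z ∂(P' : Measure (FullData 𝒳 𝒮)), p (armData t z) := fun t p hp h =>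
    ae_of_ae_map (measurable_armData t).aemeasurable
      ((hac t).ae_le ((ae_map_iff (measurable_armData t).aemeasurable hp).2 h))
  have hrt : ∀ t, Measurable fun a : (𝒳 × 𝒮) × ℝ => r t a.1.1 a.1.2 := fun t =>
    hr.1.comp (measurable_const.prodMk measurable_fst)
  have het : Measurable fun a : (𝒳 × 𝒮) × ℝ => e a.1.1 := he.1.comp measurable_fst.fst
  refine ⟨h'.mem_model hε hY, fun _ => ?_, fun _ => ?_⟩
  · refine (h'.isTreatmentPropensity hε).congr_ae he.1 ?_
    exact hae true (fun a => e a.1.1 = clamp ε (1 - ε) (e a.1.1))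
      (measurableSet_eq_fun het ((measurable_clamp _ _).comp het))
      ((clamp_treatmentPropensity_ae_eq hP he).mono fun z hz => hz.symm)
  · refine (h'.isLabelPropensity hε).congr_ae hr.1 fun t => ?_
    exact hae t (fun a => r t a.1.1 a.1.2 = clamp ε 1 (r t a.1.1 a.1.2))
      (measurableSet_eq_fun (hrt t) ((measurable_clamp _ _).comp (hrt t)))
      ((clamp_labelPropensity_ae_eq hε hε' hP hr t).mono fun z hz => hz.symm)

namespace IsTilt

variable {a : 𝒳 → ℝ} {β : Bool → (𝒳 × 𝒮) × ℝ → ℝ} {b : Bool → 𝒳 × 𝒮 → ℝ} {B : ℝ}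

/-- The tilted laws have density 1 + γ · score with respect to the observed law of P, and the Taylor
bound for the square root gives the quadratic mean expansion. One path serves every version of the
score, since elements of the tangent set are classes in L². -/
theorem exists_isRegularSubmodel (hε : 0 < ε) (hε' : ε < 1 / 2) (hP : P ∈ model 𝒳 𝒮 ε)
    (he : IsTreatmentPropensity P e) (hr : IsLabelPropensity P r) (knownE knownR : Prop)
    (h : IsTilt P a β b B) :
    ∃ path, ∀ g, g =ᵐ[obsLaw P] tiltScore a β b →
      IsRegularSubmodel (modelWith ε knownE knownR e r) P path g := by
  have hid := isIdentified_clamp hε hε' hP he hr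
  have hprob : IsProbabilityMeasure (obsLaw P) :=
    Measure.isProbabilityMeasure_map measurable_obs.aemeasurable
  have hex : ∀ γ : ℝ, ∃ P', P' ∈ modelWith ε knownE knownR e r ∧ (γ = 0 → P' = P) ∧
      obsLaw P' = (obsLaw P).withDensity (fun w => ENNReal.ofReal
        (if |γ| * B ≤ 1 / 2 then 1 + γ * tiltScore a β b w else 1)) ∧
      ∀ t, ∫⁻ z, ENNReal.ofReal (potY t z ^ 2) ∂(P' : Measure (FullData 𝒳 𝒮)) ≤
        2 * ∫⁻ z, ENNReal.ofReal (potY t z ^ 2) ∂(P : Measure (FullData 𝒳 𝒮)) := by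
    intro γ
    -- For large γ the tilt need not be a density, and at γ = 0 the construction may return another
    -- full-data law with the arms of P; in both cases P itself is used.
    by_cases hγ : γ ≠ 0 ∧ |γ| * B ≤ 1 / 2
    · obtain ⟨P', h1, h2, h3⟩ := h.exists_tilted hε hid hγ.2
      have hle := fun t => h.lintegral_sq_tiltedArm_le hγ.2 t (h2 t)
      refine ⟨P', mem_modelWith_of_isIdentified hε hε' hP he hr knownE knownR h1 (fun t => ?_)
        (fun t => ?_), fun h0 => absurd h0 hγ.1, ?_, hle⟩
      · rw [h2]
        exact withDensity_absolutelyContinuous _ _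
      · refine memLp_two_of_lintegral_lt_top (measurable_potY t).aestronglyMeasurable
          ((hle t).trans_lt (ENNReal.mul_lt_top (by simp) ?_))
        rw [← eLpNorm_two_sq]
        exact ENNReal.pow_lt_top (hP.2.2.2 t).2
      · simp only [hγ.2, if_true]
        exact h3
    · refine ⟨P, ⟨hP, fun _ => he, fun _ => hr⟩, fun _ => rfl, ?_, fun t => ?_⟩
      · have : ∀ w, ENNReal.ofReal (if |γ| * B ≤ 1 / 2 then 1 + γ * tiltScore a β b w else 1) =
          1 := by
          intro w
          by_cases h0 : γ = 0
          · simp [h0]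
          · have : ¬ |γ| * B ≤ 1 / 2 := fun h => hγ ⟨h0, h⟩
            rw [if_neg this, ENNReal.ofReal_one]
        simp only [this]
        exact withDensity_one.symm
      · rw [two_mul]
        exact le_self_add
  choose path hmem hzero hlaw hmom using hex
  refine ⟨path, fun g hg => ⟨hmem, hzero 0 rfl, ?_, ?_, ?_⟩⟩
  · exact (MemLp.of_bound h.measurable_tiltScore.aestronglyMeasurable B
      (ae_of_all _ fun w => h.abs_tiltScore_le w)).ae_eq hg.symm
  · refine ⟨obsLaw P, fun γ w => if |γ| * B ≤ 1 / 2 then 1 + γ * tiltScore a β b w else 1,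
      inferInstance, fun γ => ?_, fun γ w => ?_, hlaw, ?_⟩
    · exact Measurable.ite (MeasurableSet.const _)
        (measurable_const.add (h.measurable_tiltScore.const_mul γ)) measurable_const
    · beta_reduce
      split_ifs with hγ
      · exact one_add_nonneg hγ (h.abs_tiltScore_le w)
      · exact zero_le_one
    -- The square root error is at most (γ y)²/2 with |y| ≤ B; division by |γ| leaves |γ| B²/2.
    · have hB : Tendsto (fun γ : ℝ => ENNReal.ofReal ((γ * B ^ 2 / 2) ^ 2)) (𝓝[≠] 0) (𝓝 0) := by
        have h1 : Continuous fun γ : ℝ => ENNReal.ofReal ((γ * B ^ 2 / 2) ^ 2) :=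
          ENNReal.continuous_ofReal.comp (by fun_prop)
        have h2 := h1.tendsto 0
        simp only [zero_mul, zero_div, ne_eq, OfNat.ofNat_ne_zero, not_false_eq_true, zero_pow,
          ENNReal.ofReal_zero] at h2
        exact h2.mono_left nhdsWithin_le_nhds
      refine tendsto_of_tendsto_of_tendsto_of_le_of_le' tendsto_const_nhds hB
        (Eventually.of_forall fun _ => zero_le) ?_
      have hsmall : ∀ᶠ γ : ℝ in 𝓝[≠] 0, |γ| * B ≤ 1 / 2 := by
        have h1 : Continuous fun γ : ℝ => |γ| * B := by fun_prop
        have h2 : ∀ᶠ γ : ℝ in 𝓝 0, |γ| * B < 1 / 2 :=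
          h1.tendsto 0 (Iio_mem_nhds (by simp))
        exact (h2.filter_mono nhdsWithin_le_nhds).mono fun _ h => h.le
      filter_upwards [hsmall, self_mem_nhdsWithin] with γ hγ hγ0
      have hγ0' : γ ≠ 0 := hγ0
      have hle : ∀ᵐ w ∂(obsLaw P), ENNReal.ofReal
          (((√(if |γ| * B ≤ 1 / 2 then 1 + γ * tiltScore a β b w else 1) -
            √(if |(0 : ℝ)| * B ≤ 1 / 2 then 1 + 0 * tiltScore a β b w else 1)) / γ -
            g w / 2 * √(if |(0 : ℝ)| * B ≤ 1 / 2 then 1 + 0 * tiltScore a β b w else 1)) ^ 2) ≤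
          ENNReal.ofReal ((γ * B ^ 2 / 2) ^ 2) := by
        filter_upwards [hg] with w hw
        refine ENNReal.ofReal_le_ofReal ?_
        have hb := h.abs_tiltScore_le w
        rw [hw]
        set y := tiltScore a β b w
        simp only [hγ, if_true, zero_mul, add_zero, ite_self, Real.sqrt_one, mul_one]
        have hx := abs_le.1 (abs_mul_le hγ hb)
        have h1 := abs_sqrt_one_add_sub_le (x := γ * y) (by linarith)
        have e1 : (√(1 + γ * y) - 1) / γ - y / 2 = (√(1 + γ * y) - 1 - γ * y / 2) / γ := by
          field_simp
        have h2 : y ^ 2 ≤ B ^ 2 := sq_le_sq' (abs_le.1 hb).1 (abs_le.1 hb).2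
        rw [e1, ← sq_abs, ← sq_abs (γ * B ^ 2 / 2)]
        refine pow_le_pow_left₀ (abs_nonneg _) ?_ 2
        rw [abs_div, div_le_iff₀ (abs_pos.2 hγ0')]
        refine h1.trans ?_
        rw [abs_div, abs_mul, abs_of_nonneg (sq_nonneg B), abs_of_pos (zero_lt_two' ℝ), mul_pow,
          ← sq_abs γ]
        nlinarith [mul_le_mul_of_nonneg_left h2 (sq_nonneg |γ|)]
      refine (lintegral_mono_ae hle).trans ?_
      simp
  -- The sum over the two arms bounds either of them, giving a constant independent of t.
  · refine ⟨∑ t : Bool, 2 * ∫ z, potY t z ^ 2 ∂(P : Measure (FullData 𝒳 𝒮)),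
      Eventually.of_forall fun γ t => ?_⟩
    have hY := fun t => (hP.2.2.2 t).integrable_sq
    have h1 := hmom γ t
    rw [← ofReal_integral_eq_lintegral_ofReal ((hmem γ).1.2.2.2 t).integrable_sq
        (ae_of_all _ fun z => sq_nonneg _),
      ← ofReal_integral_eq_lintegral_ofReal (hY t) (ae_of_all _ fun z => sq_nonneg _),
      ← ENNReal.ofReal_ofNat, ← ENNReal.ofReal_mul (by norm_num)] at h1
    have h0 : ∀ t, 0 ≤ 2 * ∫ z, potY t z ^ 2 ∂(P : Measure (FullData 𝒳 𝒮)) := fun t =>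
      mul_nonneg zero_le_two (integral_nonneg fun z => sq_nonneg _)
    exact ((ENNReal.ofReal_le_ofReal_iff (h0 t)).1 h1).trans
      (Finset.single_le_sum (f := fun t => 2 * ∫ z, potY t z ^ 2 ∂(P : Measure (FullData 𝒳 𝒮)))
        (fun t _ => h0 t) (Finset.mem_univ t))

end IsTilt

end SurrogateATE

/-! ### Approximating square-integrable directions by bounded ones -/

namespace SurrogateATE

section General

variable {Ω A : Type*} [MeasurableSpace Ω] [MeasurableSpace A] {μ : Measure Ω} {f : Ω → ℝ}
  {φ : Ω → A} {M : A → ℝ}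

theorem abs_clamp_neg_le {K : ℝ} (hK : 0 ≤ K) (y : ℝ) : |clamp (-K) K y| ≤ K :=
  abs_le.2 ⟨le_clamp _ _ _, clamp_le (by linarith) _⟩

theorem abs_clamp_neg_sub_le {K : ℝ} (hK : 0 ≤ K) (y : ℝ) : |clamp (-K) K y - y| ≤ |y| := by
  unfold clamp
  rcases max_cases (-K) (min y K) with h | h <;> rcases min_cases y K with h' | h' <;>
    rcases abs_cases y with h'' | h'' <;> rw [abs_le] <;> constructor <;> linarith [h.1, h'.1]

theorem tendsto_clamp_neg_sub (y : ℝ) :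
    Tendsto (fun n : ℕ => clamp (-(n : ℝ)) n y - y) atTop (𝓝 0) := by
  obtain ⟨N, hN⟩ := exists_nat_ge |y|
  refine tendsto_const_nhds.congr' ?_
  filter_upwards [eventually_ge_atTop N] with n hn
  have h1 : |y| ≤ n := hN.trans (by exact_mod_cast hn)
  rw [clamp_eq (abs_le.1 h1).1 (abs_le.1 h1).2, sub_self]

namespace IsRegression

/-- The conditional expectation factors through φ and inherits the bound almost surely; clamping the
factor makes the bound hold everywhere. -/
theorem exists_bounded [IsFiniteMeasure μ] (hf : Measurable f) {K : ℝ} (hK : 0 ≤ K)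
    (hfK : ∀ ω, |f ω| ≤ K) (hφ : Measurable φ) :
    ∃ M : A → ℝ, IsRegression μ f φ M ∧ ∀ a, |M a| ≤ K := by
  have hfL : MemLp f 2 μ := MemLp.of_bound hf.aestronglyMeasurable K (ae_of_all _ hfK)
  obtain ⟨M, hM, hMeq⟩ := (stronglyMeasurable_condExp (μ := μ) (f := f)
    (m := MeasurableSpace.comap φ inferInstance)).measurable.exists_eq_measurable_comp
  have hb := ae_bdd_abs_condExp_of_ae_bdd_abs (m := MeasurableSpace.comap φ inferInstance)
    (R := K) (ae_of_all μ hfK)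
  have hm := (measurable_clamp (-K) K).comp hM
  refine ⟨fun a => clamp (-K) K (M a), isRegression_of_condExp hfL hφ hm ?_,
    fun a => abs_clamp_neg_le hK _⟩
  filter_upwards [hb] with ω hω
  rw [hMeq] at hω ⊢
  exact (clamp_eq (abs_le.1 hω).1 (abs_le.1 hω).2).symm

/-- A projection is a contraction: test against M itself and apply Cauchy–Schwarz. -/
theorem eLpNorm_le (h : IsRegression μ f φ M) (hf : MemLp f 2 μ) :
    eLpNorm (fun ω => M (φ ω)) 2 μ ≤ eLpNorm f 2 μ := by
  have h1 := h.integral_mul M h.measurable h.memLp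
  have h2 := sq_integral_mul_le hf h.memLp
  have e1 : ∫ ω, M (φ ω) * M (φ ω) ∂μ = ∫ ω, M (φ ω) ^ 2 ∂μ := by simp only [sq]
  rw [h1, e1] at h2
  have h3 : ∫ ω, M (φ ω) ^ 2 ∂μ ≤ ∫ ω, f ω ^ 2 ∂μ := by
    have h0 : 0 ≤ ∫ ω, M (φ ω) ^ 2 ∂μ := integral_nonneg fun ω => sq_nonneg _
    rcases h0.eq_or_lt with h0 | h0
    · rw [← h0]
      exact integral_nonneg fun ω => sq_nonneg _
    · nlinarith
  rw [← toReal_eLpNorm_two_sq h.memLp.1, ← toReal_eLpNorm_two_sq hf.1] at h3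
  exact (ENNReal.toReal_le_toReal h.memLp.2.ne hf.2.ne).1
    ((sq_le_sq₀ ENNReal.toReal_nonneg ENNReal.toReal_nonneg).1 h3)

theorem self {h : A → ℝ} (hh : Measurable h) (hhL : MemLp (fun ω => h (φ ω)) 2 μ) :
    IsRegression μ (fun ω => h (φ ω)) φ h :=
  ⟨hh, hhL, fun _ _ _ => rfl⟩

theorem sub {f' : Ω → ℝ} {M' : A → ℝ} (h : IsRegression μ f φ M) (h' : IsRegression μ f' φ M')
    (hf : MemLp f 2 μ) (hf' : MemLp f' 2 μ) :
    IsRegression μ (fun ω => f ω - f' ω) φ fun a => M a - M' a := by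
  refine ⟨h.measurable.sub h'.measurable, h.memLp.sub h'.memLp, fun k hk hkL => ?_⟩
  simp only [sub_mul]
  rw [integral_sub (integrable_mul_of_memLp_two hf hkL) (integrable_mul_of_memLp_two hf' hkL),
    integral_sub (integrable_mul_of_memLp_two h.memLp hkL)
      (integrable_mul_of_memLp_two h'.memLp hkL), h.integral_mul k hk hkL,
    h'.integral_mul k hk hkL]

/-- A square-integrable function which is centred given `φ` is a limit of bounded functions which
are centred given `φ`. -/
theorem exists_bounded_approx [IsFiniteMeasure μ] (hf : Measurable f) (hfL : MemLp f 2 μ)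
    (hφ : Measurable φ) (h : IsRegression μ f φ fun _ => 0) :
    ∃ F : ℕ → Ω → ℝ, (∀ n, Measurable (F n)) ∧ (∀ n ω, |F n ω| ≤ 2 * n) ∧
      (∀ n, IsRegression μ (F n) φ fun _ => 0) ∧
      Tendsto (fun n => eLpNorm (fun ω => F n ω - f ω) 2 μ) atTop (𝓝 0) := by
  set c : ℕ → Ω → ℝ := fun n ω => clamp (-(n : ℝ)) n (f ω) with hc
  have hcm : ∀ n, Measurable (c n) := fun n => (measurable_clamp _ _).comp hf
  have hcb : ∀ n ω, |c n ω| ≤ n := fun n ω => abs_clamp_neg_le n.cast_nonneg _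
  have hcL : ∀ n, MemLp (c n) 2 μ := fun n =>
    MemLp.of_bound (hcm n).aestronglyMeasurable n (ae_of_all _ (hcb n))
  have hct : Tendsto (fun n => eLpNorm (fun ω => c n ω - f ω) 2 μ) atTop (𝓝 0) :=
    tendsto_eLpNorm_two_zero_of_dominated (fun n => ((hcm n).sub hf).aestronglyMeasurable) hfL
      (fun n => ae_of_all _ fun ω => abs_clamp_neg_sub_le n.cast_nonneg _)
      (ae_of_all _ fun ω => tendsto_clamp_neg_sub (f ω))
  -- Truncation destroys the centring given φ; subtracting the regression restores it and at most
  -- doubles the bound.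
  choose M hM hMb using fun n => exists_bounded (μ := μ) (hcm n) n.cast_nonneg (hcb n) hφ
  have hMφ : ∀ n, Measurable fun ω => M n (φ ω) := fun n => (hM n).measurable.comp hφ
  refine ⟨fun n ω => c n ω - M n (φ ω), fun n => (hcm n).sub (hMφ n), fun n ω => ?_, fun n => ?_,
    ?_⟩
  · have := (abs_sub (c n ω) (M n (φ ω))).trans (add_le_add (hcb n ω) (hMb n _))
    linarith
  · have := (hM n).sub (self (hM n).measurable (hM n).memLp) (hcL n) (hM n).memLp
    simpa only [sub_self] using this
  · have hle : ∀ n, eLpNorm (fun ω => c n ω - M n (φ ω) - f ω) 2 μ ≤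
        eLpNorm (fun ω => c n ω - f ω) 2 μ + eLpNorm (fun ω => c n ω - f ω) 2 μ := fun n => by
      -- Since f has regression zero, the correction is the regression of c n - f, so its norm is at
      -- most the truncation error.
      have h1 := ((hM n).sub h (hcL n) hfL).eLpNorm_le ((hcL n).sub hfL)
      simp only [sub_zero] at h1
      have e : (fun ω => c n ω - M n (φ ω) - f ω) =
          (fun ω => c n ω - f ω) - fun ω => M n (φ ω) := by
        ext ω
        simp only [Pi.sub_apply]
        ring
      rw [e]
      exact (eLpNorm_sub_le ((hcm n).sub hf).aestronglyMeasurable (hMφ n).aestronglyMeasurable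
        one_le_two).trans (add_le_add_right h1 _)
    have h2 := hct.add hct
    rw [add_zero] at h2
    exact tendsto_of_tendsto_of_tendsto_of_le_of_le tendsto_const_nhds h2 (fun _ => zero_le) hle

end IsRegression

end General

variable {𝒳 𝒮 : Type*} [MeasurableSpace 𝒳] [MeasurableSpace 𝒮]
  {P : ProbabilityMeasure (FullData 𝒳 𝒮)} {e : 𝒳 → ℝ} {r : Bool → 𝒳 → 𝒮 → ℝ} {ε : ℝ}

theorem withDensity_ofReal_le {Ω : Type*} [MeasurableSpace Ω] {μ : Measure Ω} {k : Ω → ℝ}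
    (hk : ∀ ω, k ω ≤ 1) : (μ.withDensity fun ω => ENNReal.ofReal (k ω)) ≤ μ := by
  conv_rhs => rw [← withDensity_one (μ := μ)]
  refine withDensity_mono (ae_of_all _ fun ω => ?_)
  simpa using hk ω

theorem IsIdentified.eLpNorm_obsXSY_le (hε : 0 < ε) (h : IsIdentified ε P e r) {t : Bool}
    {F : (𝒳 × 𝒮) × ℝ → ℝ} (hF : Measurable F) :
    eLpNorm ((obsLabelled 𝒳 𝒮 t).indicator fun w => F (obsXSY w)) 2 (obsLaw P) ≤
      eLpNorm F 2 ((P : Measure (FullData 𝒳 𝒮)).map (armData t)) := by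
  have h1 := eLpNorm_map_measure (μ := (obsLaw P).restrict (obsLabelled 𝒳 𝒮 t)) (p := 2)
    hF.aestronglyMeasurable measurable_obsXSY.aemeasurable
  rw [eLpNorm_indicator_eq_eLpNorm_restrict (measurableSet_obsLabelled t)]
  refine h1.symm.le.trans ?_
  rw [h.map_obsXSY_eq]
  exact eLpNorm_mono_measure _ (withDensity_ofReal_le fun p => h.label_le hε t p.1)

theorem IsIdentified.eLpNorm_obsXS_le (hε : 0 < ε) (h : IsIdentified ε P e r) {t : Bool}
    {F : 𝒳 × 𝒮 → ℝ} (hF : Measurable F) :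
    eLpNorm ((obsArm 𝒳 𝒮 t).indicator fun w => F (obsXS w)) 2 (obsLaw P) ≤
      eLpNorm F 2 (((P : Measure (FullData 𝒳 𝒮)).map (armData t)).map Prod.fst) := by
  have h1 := eLpNorm_map_measure (μ := (obsLaw P).restrict (obsArm 𝒳 𝒮 t)) (p := 2)
    hF.aestronglyMeasurable measurable_obsXS.aemeasurable
  rw [eLpNorm_indicator_eq_eLpNorm_restrict (measurableSet_obsArm t)]
  refine h1.symm.le.trans ?_
  rw [h.map_obsXS_eq]
  exact eLpNorm_mono_measure _ (withDensity_ofReal_le fun p => h.armPropensity_le hε t p.1)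

/-- The score splits into the covariate part and, for each arm, a labelled and an unlabelled part.
Selection probabilities are at most 1, so each observed norm is bounded by the norm under the
corresponding arm law. -/
theorem IsIdentified.eLpNorm_tiltScore_sub_le (hε : 0 < ε) (h : IsIdentified ε P e r)
    {a a' : 𝒳 → ℝ} {β β' : Bool → (𝒳 × 𝒮) × ℝ → ℝ} {b b' : Bool → 𝒳 × 𝒮 → ℝ}
    (ha : Measurable fun x => a x - a' x) (hβ : ∀ t, Measurable fun p => β t p - β' t p)
    (hb : ∀ t, Measurable fun p => b t p - b' t p) :
    eLpNorm (fun w => tiltScore a β b w - tiltScore a' β' b' w) 2 (obsLaw P) ≤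
      eLpNorm (fun x => a x - a' x) 2 ((P : Measure (FullData 𝒳 𝒮)).map covX) +
      ∑ t : Bool, (eLpNorm (fun p => β t p - β' t p) 2
          ((P : Measure (FullData 𝒳 𝒮)).map (armData t)) +
        eLpNorm (fun p => b t p - b' t p) 2
          (((P : Measure (FullData 𝒳 𝒮)).map (armData t)).map Prod.fst)) := by
  set f₀ : ObsData 𝒳 𝒮 → ℝ := fun w => a w.1 - a' w.1
  set f : Bool → ObsData 𝒳 𝒮 → ℝ := fun t =>
    (obsLabelled 𝒳 𝒮 t).indicator fun w => β t (obsXSY w) - β' t (obsXSY w)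
  set g : Bool → ObsData 𝒳 𝒮 → ℝ := fun t =>
    (obsArm 𝒳 𝒮 t \ obsLabelled 𝒳 𝒮 t).indicator fun w => b t (obsXS w) - b' t (obsXS w)
  have hf₀ : AEStronglyMeasurable f₀ (obsLaw P) := (ha.comp measurable_fst).aestronglyMeasurable
  have hf : ∀ t, AEStronglyMeasurable (f t) (obsLaw P) := fun t =>
    (((hβ t).comp measurable_obsXSY).indicator (measurableSet_obsLabelled t)).aestronglyMeasurable
  have hg : ∀ t, AEStronglyMeasurable (g t) (obsLaw P) := fun t =>
    (((hb t).comp measurable_obsXS).indicator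
      ((measurableSet_obsArm t).diff (measurableSet_obsLabelled t))).aestronglyMeasurable
  have e1 : (fun w => tiltScore a β b w - tiltScore a' β' b' w) =
      f₀ + ∑ t : Bool, (f t + g t) := by
    ext w
    obtain ⟨x, t, s, ρ, y⟩ := w
    cases t <;> cases ρ <;>
      simp [f₀, f, g, tiltScore, obsLabelled, obsArm, obsXS, obsXSY] <;> ring
  rw [e1]
  refine (eLpNorm_add_le hf₀ (Finset.aestronglyMeasurable_sum _ fun t _ => (hf t).add (hg t))
    one_le_two).trans (add_le_add ?_ ((eLpNorm_sum_le (fun t _ => (hf t).add (hg t))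
      one_le_two).trans (Finset.sum_le_sum fun t _ =>
        (eLpNorm_add_le (hf t) (hg t) one_le_two).trans (add_le_add ?_ ?_))))
  · rw [← map_fst_obsLaw]
    exact (eLpNorm_map_measure ha.aestronglyMeasurable measurable_fst.aemeasurable).symm.le
  · exact h.eLpNorm_obsXSY_le hε (F := fun p => β t p - β' t p) (hβ t)
  · refine (eLpNorm_mono fun w => ?_).trans (h.eLpNorm_obsXS_le hε
      (F := fun p => b t p - b' t p) (hb t))
    exact norm_indicator_le_of_subset Set.sdiff_subset _ _

/-- Square-integrable perturbations are limits of bounded ones. -/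
theorem IsIdentified.exists_isTilt_tendsto (hε : 0 < ε) (h : IsIdentified ε P e r)
    {a : 𝒳 → ℝ} {β : Bool → (𝒳 × 𝒮) × ℝ → ℝ} {b : Bool → 𝒳 × 𝒮 → ℝ} (ha : Measurable a)
    (haL : MemLp a 2 ((P : Measure (FullData 𝒳 𝒮)).map covX))
    (ha0 : ∫ x, a x ∂((P : Measure (FullData 𝒳 𝒮)).map covX) = 0)
    (hβ : ∀ t, Measurable (β t))
    (hβL : ∀ t, MemLp (β t) 2 ((P : Measure (FullData 𝒳 𝒮)).map (armData t)))
    (hβX : ∀ t, IsRegression ((P : Measure (FullData 𝒳 𝒮)).map (armData t)) (β t)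
      (fun p => p.1.1) fun _ => 0)
    (hβS : ∀ t, IsRegression ((P : Measure (FullData 𝒳 𝒮)).map (armData t)) (β t) Prod.fst (b t)) :
    ∃ (a' : ℕ → 𝒳 → ℝ) (β' : ℕ → Bool → (𝒳 × 𝒮) × ℝ → ℝ) (b' : ℕ → Bool → 𝒳 × 𝒮 → ℝ),
      (∀ n : ℕ, IsTilt P (a' n) (β' n) (b' n) (4 * n)) ∧
      Tendsto (fun n => eLpNorm (fun w => tiltScore (a' n) (β' n) (b' n) w - tiltScore a β b w) 2
        (obsLaw P)) atTop (𝓝 0) := by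
  have hpX : IsProbabilityMeasure ((P : Measure (FullData 𝒳 𝒮)).map covX) :=
    Measure.isProbabilityMeasure_map measurable_covX.aemeasurable
  have hpH : ∀ t, IsProbabilityMeasure ((P : Measure (FullData 𝒳 𝒮)).map (armData t)) := fun t =>
    Measure.isProbabilityMeasure_map (measurable_armData t).aemeasurable
  -- Mean zero is centring given a constant variable, so the same approximation result applies to a.
  have hareg : IsRegression ((P : Measure (FullData 𝒳 𝒮)).map covX) a (fun _ => ()) fun _ => 0 := by
    refine ⟨measurable_const, MemLp.zero, fun k _ _ => ?_⟩
    rw [integral_mul_const, ha0]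
    simp
  obtain ⟨a', ha'm, ha'b, ha'r, ha't⟩ := hareg.exists_bounded_approx ha haL measurable_const
  choose β' hβ'm hβ'b hβ'r hβ't using fun t =>
    (hβX t).exists_bounded_approx (hβ t) (hβL t) measurable_fst.fst
  have h2n : ∀ n : ℕ, (0 : ℝ) ≤ 2 * n := fun n => by positivity
  choose b' hb'r hb'b using fun t n => IsRegression.exists_bounded
    (μ := (P : Measure (FullData 𝒳 𝒮)).map (armData t)) (hβ'm t n) (h2n n) (hβ'b t n)
    measurable_fst
  have hβ'L : ∀ t n, MemLp (β' t n) 2 ((P : Measure (FullData 𝒳 𝒮)).map (armData t)) := fun t n =>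
    MemLp.of_bound (hβ'm t n).aestronglyMeasurable _ (ae_of_all _ (hβ'b t n))
  refine ⟨a', fun n t => β' t n, fun n t => b' t n, fun n => ⟨ha'm n, fun t => hβ'm t n,
    fun x => ?_, fun t p => ?_, fun t p => ?_, ?_, fun t => hβ'r t n, fun t => hb'r t n⟩, ?_⟩
  · exact (ha'b n x).trans (by linarith [h2n n])
  · have := (abs_add_le (a' n p.1.1) (β' t n p)).trans (add_le_add (ha'b n _) (hβ'b t n p))
    linarith
  · have := (abs_add_le (a' n p.1) (b' t n p)).trans (add_le_add (ha'b n _) (hb'b t n p))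
    linarith
  · have h1 := (ha'r n).integral_mul (fun _ => 1) measurable_const (memLp_const 1)
    simp only [mul_one, integral_zero] at h1
    rw [← h1]
    exact (integral_map measurable_covX.aemeasurable (ha'm n).aestronglyMeasurable).symm
  -- The regressions on the surrogates converge because regression is a contraction.
  · have hbt : ∀ t, Tendsto (fun n => eLpNorm (fun p => b' t n p - b t p) 2
        (((P : Measure (FullData 𝒳 𝒮)).map (armData t)).map Prod.fst)) atTop (𝓝 0) := fun t => by
      refine tendsto_of_tendsto_of_tendsto_of_le_of_le tendsto_const_nhds (hβ't t)
        (fun _ => zero_le) fun n => ?_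
      have h1 := ((hb'r t n).sub (hβS t) (hβ'L t n) (hβL t))
      have h2 := h1.eLpNorm_le ((hβ'L t n).sub (hβL t))
      refine (eLpNorm_map_measure h1.measurable.aestronglyMeasurable
        measurable_fst.aemeasurable).le.trans h2
    have hsum := ha't.add (tendsto_finsetSum Finset.univ fun t _ => (hβ't t).add (hbt t))
    simp only [add_zero, Finset.sum_const_zero] at hsum
    refine tendsto_of_tendsto_of_tendsto_of_le_of_le tendsto_const_nhds hsum
      (fun _ => zero_le) fun n => ?_
    exact h.eLpNorm_tiltScore_sub_le hε ((ha'm n).sub ha) (fun t => (hβ'm t n).sub (hβ t))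
      fun t => (hb'r t n).measurable.sub (hβS t).measurable

end SurrogateATE

/-! ### The efficient influence function as a limit of scores -/

namespace SurrogateATE

section Direction

variable {𝒳 𝒮 : Type*}

/-- The sign with which the mean of arm `t` enters the average treatment effect. -/
def armSign (t : Bool) : ℝ := if t then 1 else -1

/-- The direction of the efficient influence function in arm `t`. -/
noncomputable def armDirection (e : 𝒳 → ℝ) (r mS : Bool → 𝒳 → 𝒮 → ℝ) (m : Bool → 𝒳 → ℝ)
    (t : Bool) (p : (𝒳 × 𝒮) × ℝ) : ℝ :=
  armSign t * ((mS t p.1.1 p.1.2 - m t p.1.1) / armPropensity e t p.1.1) +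
    armSign t * ((p.2 - mS t p.1.1 p.1.2) / (armPropensity e t p.1.1 * r t p.1.1 p.1.2))

/-- The regression of `armDirection` on the surrogates. -/
noncomputable def surrogateDirection (e : 𝒳 → ℝ) (mS : Bool → 𝒳 → 𝒮 → ℝ) (m : Bool → 𝒳 → ℝ)
    (t : Bool) (a : 𝒳 × 𝒮) : ℝ :=
  armSign t * ((mS t a.1 a.2 - m t a.1) / armPropensity e t a.1)

/-- This is what makes ψ tangent. The covariate direction is μ(1, x) - μ(0, x) - δ; labelled units
carry both signed residuals, unlabelled ones only the residual of μ̃ against μ, because the outcome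
term has the factor R. -/
theorem psi_eq_tiltScore (δ : ℝ) (e : 𝒳 → ℝ) (r mS : Bool → 𝒳 → 𝒮 → ℝ) (m : Bool → 𝒳 → ℝ) :
    psi δ e r mS m = tiltScore (fun x => m true x - m false x - δ) (armDirection e r mS m)
      (surrogateDirection e mS m) := by
  ext ⟨x, t, s, ρ, y⟩
  cases t <;> cases ρ <;>
    simp only [psi, tiltScore, armDirection, surrogateDirection, armSign, armPropensity, obsXS,
      obsXSY, ind, Bool.false_eq_true, if_true, if_false] <;> ring

end Direction

variable {𝒳 𝒮 : Type*} [MeasurableSpace 𝒳] [MeasurableSpace 𝒮]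
  {P : ProbabilityMeasure (FullData 𝒳 𝒮)} {e : 𝒳 → ℝ} {r mS : Bool → 𝒳 → 𝒮 → ℝ}
  {m : Bool → 𝒳 → ℝ} {ε : ℝ}

namespace IsIdentified

variable {t : Bool}

theorem measurable_armDirection (h : IsIdentified ε P e r)
    (hM : Measurable fun a : 𝒳 × 𝒮 => mS t a.1 a.2) (hm : Measurable (m t)) :
    Measurable (armDirection e r mS m t) := by
  have h1 : Measurable fun p : (𝒳 × 𝒮) × ℝ => mS t p.1.1 p.1.2 := hM.comp measurable_fst
  have h2 : Measurable fun p : (𝒳 × 𝒮) × ℝ => m t p.1.1 := hm.comp measurable_fst.fst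
  have h3 : Measurable fun p : (𝒳 × 𝒮) × ℝ => armPropensity e t p.1.1 :=
    (measurable_armPropensity h.measurable_e t).comp measurable_fst.fst
  have h4 : Measurable fun p : (𝒳 × 𝒮) × ℝ => armPropensity e t p.1.1 * r t p.1.1 p.1.2 :=
    (h.measurable_label t).comp measurable_fst
  exact (((h1.sub h2).div h3).const_mul _).add (((measurable_snd.sub h1).div h4).const_mul _)

theorem memLp_surrogateDirection (hε : 0 < ε) (h : IsIdentified ε P e r)
    (hM : IsRegression ((P : Measure (FullData 𝒳 𝒮)).map (armData t)) Prod.snd Prod.fst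
      fun a => mS t a.1 a.2)
    (hm : IsRegression ((P : Measure (FullData 𝒳 𝒮)).map (armData t)) Prod.snd
      (fun a => a.1.1) (m t)) :
    MemLp (fun p : (𝒳 × 𝒮) × ℝ => surrogateDirection e mS m t p.1) 2
      ((P : Measure (FullData 𝒳 𝒮)).map (armData t)) := by
  have h3 : Measurable fun p : (𝒳 × 𝒮) × ℝ => armPropensity e t p.1.1 :=
    (measurable_armPropensity h.measurable_e t).comp measurable_fst.fst
  exact (memLp_div_of_le (hM.memLp.sub hm.memLp) h3 hε
    fun p => h.le_armPropensity t p.1.1).const_mul (armSign t)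

theorem memLp_residual (hε : 0 < ε) (h : IsIdentified ε P e r)
    (hY : MemLp (potY t) 2 (P : Measure (FullData 𝒳 𝒮)))
    (hM : IsRegression ((P : Measure (FullData 𝒳 𝒮)).map (armData t)) Prod.snd Prod.fst
      fun a => mS t a.1 a.2) :
    MemLp (fun p : (𝒳 × 𝒮) × ℝ => armSign t * ((p.2 - mS t p.1.1 p.1.2) /
      (armPropensity e t p.1.1 * r t p.1.1 p.1.2))) 2
      ((P : Measure (FullData 𝒳 𝒮)).map (armData t)) :=
  (memLp_div_of_le ((memLp_snd_map_armData hY).sub hM.memLp)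
    ((h.measurable_label t).comp measurable_fst) (mul_pos hε hε)
    fun p => h.le_label hε t p.1).const_mul (armSign t)

theorem memLp_armDirection (hε : 0 < ε) (h : IsIdentified ε P e r)
    (hY : MemLp (potY t) 2 (P : Measure (FullData 𝒳 𝒮)))
    (hM : IsRegression ((P : Measure (FullData 𝒳 𝒮)).map (armData t)) Prod.snd Prod.fst
      fun a => mS t a.1 a.2)
    (hm : IsRegression ((P : Measure (FullData 𝒳 𝒮)).map (armData t)) Prod.snd
      (fun a => a.1.1) (m t)) :
    MemLp (armDirection e r mS m t) 2 ((P : Measure (FullData 𝒳 𝒮)).map (armData t)) :=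
  (h.memLp_surrogateDirection hε hM hm).add (h.memLp_residual hε hY hM)

/-- The outcome residual has regression zero on (X, S), and its weight 1/(e_t r_t), a function of
(X, S), is absorbed into the test function. -/
theorem isRegression_armDirection_fst (hε : 0 < ε) (h : IsIdentified ε P e r)
    (hY : MemLp (potY t) 2 (P : Measure (FullData 𝒳 𝒮)))
    (hM : IsRegression ((P : Measure (FullData 𝒳 𝒮)).map (armData t)) Prod.snd Prod.fst
      fun a => mS t a.1 a.2)
    (hm : IsRegression ((P : Measure (FullData 𝒳 𝒮)).map (armData t)) Prod.snd
      (fun a => a.1.1) (m t)) :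
    IsRegression ((P : Measure (FullData 𝒳 𝒮)).map (armData t)) (armDirection e r mS m t) Prod.fst
      (surrogateDirection e mS m t) := by
  have hL := h.memLp_surrogateDirection hε hM hm
  have hp : Measurable fun a : 𝒳 × 𝒮 => armPropensity e t a.1 :=
    (measurable_armPropensity h.measurable_e t).comp measurable_fst
  have hl := h.measurable_label t
  have hsm : Measurable (surrogateDirection e mS m t) :=
    ((hM.measurable.sub (hm.measurable.comp measurable_fst)).div hp).const_mul _
  refine ⟨hsm, hL, fun k hk hkL => ?_⟩
  have hres := h.memLp_residual hε hY hM
  have hkm : Measurable fun a : 𝒳 × 𝒮 =>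
      armSign t * (k a / (armPropensity e t a.1 * r t a.1 a.2)) := (hk.div hl).const_mul _
  have hk' : MemLp (fun p : (𝒳 × 𝒮) × ℝ =>
      armSign t * (k p.1 / (armPropensity e t p.1.1 * r t p.1.1 p.1.2))) 2
      ((P : Measure (FullData 𝒳 𝒮)).map (armData t)) :=
    (memLp_div_of_le hkL (hl.comp measurable_fst) (mul_pos hε hε)
      fun p => h.le_label hε t p.1).const_mul _
  have h1 := hM.integral_mul _ hkm hk'
  have i1 := integrable_mul_of_memLp_two (memLp_snd_map_armData hY) hk'
  have i2 := integrable_mul_of_memLp_two hM.memLp hk'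
  have h2 := integral_sub i1 i2
  rw [h1, sub_self] at h2
  have h3 := integral_add (integrable_mul_of_memLp_two hL hkL)
    (integrable_mul_of_memLp_two hres hkL)
  have h4 : ∫ p : (𝒳 × 𝒮) × ℝ, armSign t * ((p.2 - mS t p.1.1 p.1.2) /
      (armPropensity e t p.1.1 * r t p.1.1 p.1.2)) * k p.1
        ∂((P : Measure (FullData 𝒳 𝒮)).map (armData t)) = 0 := by
    rw [← h2]
    refine integral_congr_ae (ae_of_all _ fun p => ?_)
    simp only
    ring
  rw [h4, add_zero] at h3
  rw [← h3]
  refine integral_congr_ae (ae_of_all _ fun p => ?_)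
  simp only [armDirection, surrogateDirection]
  ring

/-- By the previous regression only the residual of μ̃ against μ remains. Both are projections of Y,
so they have the same pairing with functions of X. -/
theorem isRegression_armDirection_fst_fst (hε : 0 < ε) (h : IsIdentified ε P e r)
    (hY : MemLp (potY t) 2 (P : Measure (FullData 𝒳 𝒮)))
    (hM : IsRegression ((P : Measure (FullData 𝒳 𝒮)).map (armData t)) Prod.snd Prod.fst
      fun a => mS t a.1 a.2)
    (hm : IsRegression ((P : Measure (FullData 𝒳 𝒮)).map (armData t)) Prod.snd
      (fun a => a.1.1) (m t)) :
    IsRegression ((P : Measure (FullData 𝒳 𝒮)).map (armData t)) (armDirection e r mS m t)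
      (fun p => p.1.1) fun _ => 0 := by
  refine ⟨measurable_const, MemLp.zero, fun k hk hkL => ?_⟩
  have hp := measurable_armPropensity h.measurable_e t
  have h1 := (h.isRegression_armDirection_fst hε hY hM hm).integral_mul (fun a => k a.1)
    (hk.comp measurable_fst) hkL
  have hkm : Measurable fun x => armSign t * (k x / armPropensity e t x) :=
    (hk.div hp).const_mul _
  have hk' : MemLp (fun p : (𝒳 × 𝒮) × ℝ => armSign t * (k p.1.1 / armPropensity e t p.1.1)) 2
      ((P : Measure (FullData 𝒳 𝒮)).map (armData t)) :=
    (memLp_div_of_le hkL (hp.comp measurable_fst.fst) hε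
      fun p => h.le_armPropensity t p.1.1).const_mul _
  have h2 := hM.integral_mul (fun a => armSign t * (k a.1 / armPropensity e t a.1))
    (hkm.comp measurable_fst) hk'
  have h3 := hm.integral_mul _ hkm hk'
  have h4 := integral_sub (integrable_mul_of_memLp_two hM.memLp hk')
    (integrable_mul_of_memLp_two hm.memLp hk')
  rw [← h2, ← h3, sub_self] at h4
  simp only [zero_mul, integral_zero]
  rw [h1, ← h4]
  refine integral_congr_ae (ae_of_all _ fun p => ?_)
  simp only [surrogateDirection]
  ring

end IsIdentified

variable [StandardBorelSpace 𝒳] [StandardBorelSpace 𝒮]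

/-- The efficient influence function is a limit of scores of regular parametric submodels. -/
theorem exists_score_tendsto_psi (hε : 0 < ε) (hε' : ε < 1 / 2) (hP : P ∈ model 𝒳 𝒮 ε)
    (he : IsTreatmentPropensity P e) (hr : IsLabelPropensity P r)
    (hmS : IsSurrogateRegression P mS) (hm : IsOutcomeRegression P m) (knownE knownR : Prop) :
    ∃ g : ℕ → ObsData 𝒳 𝒮 → ℝ, (∀ n, MemLp (g n) 2 (obsLaw P)) ∧
      (∀ n, ∃ path, ∀ g', g' =ᵐ[obsLaw P] g n →
        IsRegularSubmodel (modelWith ε knownE knownR e r) P path g') ∧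
      Tendsto (fun n => eLpNorm (fun w => g n w - psi (ate P) e r mS m w) 2 (obsLaw P))
        atTop (𝓝 0) := by
  have hid := isIdentified_clamp hε hε' hP he hr
  have hY := hP.2.2.2
  have hMr := hid.isRegression_surrogate hε hY hmS
  have hmr := hid.isRegression_outcome hε hY hm
  have hprob : IsProbabilityMeasure (obsLaw P) :=
    Measure.isProbabilityMeasure_map measurable_obs.aemeasurable
  have hpX : IsProbabilityMeasure ((P : Measure (FullData 𝒳 𝒮)).map covX) :=
    Measure.isProbabilityMeasure_map measurable_covX.aemeasurable
  have hpH : ∀ t, IsProbabilityMeasure ((P : Measure (FullData 𝒳 𝒮)).map (armData t)) := fun t =>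
    Measure.isProbabilityMeasure_map (measurable_armData t).aemeasurable
  have hmL : ∀ t, MemLp (m t) 2 ((P : Measure (FullData 𝒳 𝒮)).map covX) := fun t => by
    rw [← map_fst_obsLaw]
    exact memLp_obsLaw_of_isRegression (hmr t)
  -- Testing the regression with the constant 1 gives E[μ(t, X)] = E[Y(t)]. The covariate direction
  -- is therefore centred when δ is the true effect.
  have hmi : ∀ t, ∫ x, m t x ∂((P : Measure (FullData 𝒳 𝒮)).map covX) =
      ∫ z, potY t z ∂(P : Measure (FullData 𝒳 𝒮)) := fun t => by
    have h1 := (hmr t).integral_mul (fun _ => 1) measurable_const (memLp_const 1)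
    simp only [mul_one] at h1
    have h2 := integral_map (μ := (P : Measure (FullData 𝒳 𝒮))) (measurable_armData t).aemeasurable
      measurable_snd.aestronglyMeasurable
    have h3 := integral_map (μ := (P : Measure (FullData 𝒳 𝒮))) (measurable_armData t).aemeasurable
      ((hmr t).measurable.comp measurable_fst.fst).aestronglyMeasurable
    have h4 := integral_map (μ := (P : Measure (FullData 𝒳 𝒮))) measurable_covX.aemeasurable
      (hmr t).measurable.aestronglyMeasurable
    exact h4.trans (h3.symm.trans (h1.symm.trans h2))
  have ha0 : ∫ x, m true x - m false x - ate P ∂((P : Measure (FullData 𝒳 𝒮)).map covX) = 0 := by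
    have i := fun t => (hmL t).integrable one_le_two
    have h1 := integral_sub ((i true).sub (i false)) (integrable_const (ate P))
    have h2 := integral_sub (i true) (i false)
    simp only [Pi.sub_apply] at h1
    rw [h1, h2, hmi, hmi]
    simp [ate]
  obtain ⟨a', β', b', htilt, hlim⟩ := hid.exists_isTilt_tendsto hε
    (((hmr true).measurable.sub (hmr false).measurable).sub_const (ate P))
    (((hmL true).sub (hmL false)).sub (memLp_const (ate P))) ha0
    (fun t => hid.measurable_armDirection (hMr t).measurable (hmr t).measurable)
    (fun t => hid.memLp_armDirection hε (hY t) (hMr t) (hmr t))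
    (fun t => hid.isRegression_armDirection_fst_fst hε (hY t) (hMr t) (hmr t))
    (fun t => hid.isRegression_armDirection_fst hε (hY t) (hMr t) (hmr t))
  refine ⟨fun n => tiltScore (a' n) (β' n) (b' n), fun n => ?_, fun n => ?_, ?_⟩
  · exact MemLp.of_bound (htilt n).measurable_tiltScore.aestronglyMeasurable _
      (ae_of_all _ (htilt n).abs_tiltScore_le)
  · exact (htilt n).exists_isRegularSubmodel hε hε' hP he hr knownE knownR
  · refine hlim.congr fun n => eLpNorm_congr_ae ?_
    filter_upwards [psi_clamp_ae_eq (mS := mS) (m := m) hε hε' hP he hr (ate P)] with w hw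
    rw [hw, psi_eq_tiltScore]
    rfl

end SurrogateATE

/-! ### The efficiency bound in terms of limits of scores -/

namespace SurrogateATE

variable {𝒳 𝒮 : Type*} [MeasurableSpace 𝒳] [MeasurableSpace 𝒮]
  {M : Set (ProbabilityMeasure (FullData 𝒳 𝒮))} {θ : ProbabilityMeasure (FullData 𝒳 𝒮) → ℝ}
  {P : ProbabilityMeasure (FullData 𝒳 𝒮)} {ψ : ObsData 𝒳 𝒮 → ℝ}

/-- A square-integrable gradient that is an `L²` limit of scores is the efficient influence
function. -/
theorem isEfficientInfluenceFunction_of_tendsto_score (hψ : MemLp ψ 2 (obsLaw P))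
    (hder : ∀ path g, IsRegularSubmodel M P path g →
      HasDerivAt (fun γ => θ (path γ)) (∫ w, ψ w * g w ∂(obsLaw P)) 0)
    {g : ℕ → ObsData 𝒳 𝒮 → ℝ} (hg : ∀ n, MemLp (g n) 2 (obsLaw P))
    (hpath : ∀ n, ∃ path, ∀ g', g' =ᵐ[obsLaw P] g n → IsRegularSubmodel M P path g')
    (hlim : Tendsto (fun n => eLpNorm (fun w => g n w - ψ w) 2 (obsLaw P)) atTop (𝓝 0)) :
    IsEfficientInfluenceFunction M θ P ψ := by
  refine ⟨hder, hψ, ?_⟩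
  have hmem : ∀ n, (hg n).toLp (g n) ∈ Submodule.span ℝ (tangentSet M P) := fun n => by
    obtain ⟨path, hp⟩ := hpath n
    -- The representative of the L² class differs from `g n` on a null set, which the path
    -- tolerates.
    exact Submodule.subset_span ⟨path, hp _ (hg n).coeFn_toLp⟩
  refine mem_closure_of_tendsto (b := atTop) (f := fun n => (hg n).toLp (g n)) ?_
    (Eventually.of_forall hmem)
  exact (Lp.tendsto_Lp_iff_tendsto_eLpNorm'' g hg ψ hψ).2 hlim

/-- If the efficient influence function is an `L²` limit of scores, its second moment is the
supremum of the Cramér–Rao bounds. -/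
theorem IsEfficientInfluenceFunction.isEfficiencyLowerBound
    (h : IsEfficientInfluenceFunction M θ P ψ)
    {g : ℕ → ObsData 𝒳 𝒮 → ℝ} (hg : ∀ n, MemLp (g n) 2 (obsLaw P))
    (hpath : ∀ n, ∃ path, IsRegularSubmodel M P path (g n))
    (hlim : Tendsto (fun n => eLpNorm (fun w => g n w - ψ w) 2 (obsLaw P)) atTop (𝓝 0)) :
    IsEfficiencyLowerBound M θ P (∫ w, ψ w ^ 2 ∂(obsLaw P)) := by
  have hψ : MemLp ψ 2 (obsLaw P) := h.2.1
  have hV : 0 ≤ ∫ w, ψ w ^ 2 ∂(obsLaw P) := integral_nonneg fun w => sq_nonneg _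
  refine ⟨⟨ψ, h, rfl⟩, ?_, fun b hb => ?_⟩
  · rintro v ⟨path, k, d, hk, hd, rfl⟩
    -- The derivative is the pairing with ψ, so Cauchy–Schwarz gives the bound; a vanishing
    -- denominator is covered because the quotient is then 0.
    rw [hd.unique (h.1 path k hk)]
    exact div_le_of_le_mul₀ (integral_nonneg fun w => sq_nonneg _) hV
      (sq_integral_mul_le hψ hk.score_memLp)
  · have hbound : ∀ n, (∫ w, ψ w * g n w ∂(obsLaw P)) ^ 2 / ∫ w, g n w ^ 2 ∂(obsLaw P) ≤ b := by
      intro n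
      obtain ⟨path, hp⟩ := hpath n
      exact hb ⟨path, g n, _, hp, h.1 path _ hp, rfl⟩
    -- If ψ has second moment zero, any single nonnegative Cramér–Rao bound suffices; otherwise the
    -- quotients converge to V²/V = V.
    rcases hV.eq_or_lt with h0 | hpos
    · rw [← h0]
      exact (div_nonneg (sq_nonneg _) (integral_nonneg fun w => sq_nonneg _)).trans (hbound 0)
    have hL : Tendsto (fun n => (hg n).toLp (g n)) atTop (𝓝 (hψ.toLp ψ)) :=
      (Lp.tendsto_Lp_iff_tendsto_eLpNorm'' g hg ψ hψ).2 hlim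
    have hinner : ∀ {f k : ObsData 𝒳 𝒮 → ℝ} (hf : MemLp f 2 (obsLaw P))
        (hk : MemLp k 2 (obsLaw P)),
        inner ℝ (hf.toLp f) (hk.toLp k) = ∫ w, f w * k w ∂(obsLaw P) := fun hf hk => by
      rw [L2.inner_def]
      refine integral_congr_ae ?_
      filter_upwards [hf.coeFn_toLp, hk.coeFn_toLp] with w h1 h2
      rw [h1, h2]
      exact mul_comm _ _
    have hcross : Tendsto (fun n => ∫ w, ψ w * g n w ∂(obsLaw P)) atTop
        (𝓝 (∫ w, ψ w ^ 2 ∂(obsLaw P))) := by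
      have := (tendsto_const_nhds (x := hψ.toLp ψ)).inner hL (𝕜 := ℝ)
      simpa only [hinner, pow_two] using this
    have hsq : Tendsto (fun n => ∫ w, g n w ^ 2 ∂(obsLaw P)) atTop
        (𝓝 (∫ w, ψ w ^ 2 ∂(obsLaw P))) := by
      have := hL.inner hL (𝕜 := ℝ)
      simpa only [hinner, pow_two] using this
    have hquot := (hcross.pow 2).div hsq hpos.ne'
    rw [pow_two, mul_div_cancel_right₀ _ hpos.ne'] at hquot
    exact le_of_tendsto' hquot hbound

end SurrogateATE

theorem theorem1 {𝒳 𝒮 : Type*} [MeasurableSpace 𝒳] [StandardBorelSpace 𝒳]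
    [MeasurableSpace 𝒮] [StandardBorelSpace 𝒮]
    (ε : ℝ) (hε : 0 < ε) (hε' : ε < 1 / 2)
    (P : ProbabilityMeasure (SurrogateATE.FullData 𝒳 𝒮))
    (hP : P ∈ SurrogateATE.model 𝒳 𝒮 ε)
    (e : 𝒳 → ℝ) (r mS : Bool → 𝒳 → 𝒮 → ℝ) (m : Bool → 𝒳 → ℝ)
    (he : SurrogateATE.IsTreatmentPropensity P e)
    (hr : SurrogateATE.IsLabelPropensity P r)
    (hmS : SurrogateATE.IsSurrogateRegression P mS)
    (hm : SurrogateATE.IsOutcomeRegression P m)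
    (knownE knownR : Prop) :
    SurrogateATE.IsEfficientInfluenceFunction
      (SurrogateATE.modelWith ε knownE knownR e r) SurrogateATE.ate P
      (SurrogateATE.psi (SurrogateATE.ate P) e r mS m) ∧
    SurrogateATE.IsEfficiencyLowerBound
      (SurrogateATE.modelWith ε knownE knownR e r) SurrogateATE.ate P
      (∫ w, SurrogateATE.psi (SurrogateATE.ate P) e r mS m w ^ 2
        ∂(SurrogateATE.obsLaw P)) := by
  obtain ⟨g, hg, hpath, hlim⟩ :=
    SurrogateATE.exists_score_tendsto_psi hε hε' hP he hr hmS hm knownE knownR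
  have hEIF := SurrogateATE.isEfficientInfluenceFunction_of_tendsto_score
    (θ := SurrogateATE.ate)
    (SurrogateATE.memLp_psi hε hε' hP he hr hmS hm (SurrogateATE.ate P))
    (fun path g h => SurrogateATE.IsRegularSubmodel.hasDerivAt_ate hε hε' hP he hr hmS hm
      (SurrogateATE.ate P) (fun _ hQ => hQ.1) h) hg hpath hlim
  exact ⟨hEIF, hEIF.isEfficiencyLowerBound hg
    (fun n => (hpath n).imp fun _ h => h _ EventuallyEq.rfl) hlim⟩
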